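/- Let $\eta\neq 0$ be a real constant and consider on $\mathbb{R}^3$ the vector fields \[ \dot a(x)=\eta\Bigl(-\partial_2\Bigl[\tfrac{1}{\log(e+|x|^2)}\Bigr],\ \partial_1\Bigl[\tfrac{1}{\log(e+|x|^2)}\Bigr],\ 0\Bigr), \qquad \overline a(x)=\dot a(x)\,\sin(|x|^2). \] For a divergence-free $a\in L^3(\mathbb{R}^3)$ and $0<T\le\infty$, an $L^3$ solution on $[0,T)$ of the Navier--Stokes equations arising from $a$ is a function $u\in C([0,T),L^3(\mathbb{R}^3))$ with $u(0)=a$ and \[ u(t)=e^{t\Delta}a-\int_0^t e^{(t-s)\Delta}\,\mathbb{P}\nabla\cdot(u\otimes u)(s)\,ds\qquad(0<t<T), \] where $\mathbb{P}=\mathrm{Id}-\nabla\Delta^{-1}\mathrm{div}$ is the Leray--Hopf projector. Then: 1. Both $\dot a$ and $\overline a$ are divergence-free and belong to $L^3(\mathbb{R}^3)$, but belong to $L^p(\mathbb{R}^3)$ for no $1\le p<3$. 2. For each of the data $a=\dot a$ and $a=\overline a$ there is an $L^3$ solution arising from $a$ on $[0,T)$ for some $0<T\le\infty$ (possibly depending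 on $\eta$), and for every $0<T\le\infty$ there is at most one such solution on $[0,T)$. 3. If $u$ is the $L^3$ solution on $[0,T)$ arising from $\dot a$, then $u(t)\notin L^q(\mathbb{R}^3)$ for every $t\in(0,T)$ and every $q\in[1,3)$. 4. If $u$ is the $L^3$ solution on $[0,T)$ arising from $\overline a$, then $u(t)\in L^q(\mathbb{R}^3)$ for every $t\in(0,T)$ and every $q\in[1,3)$. -/

import Mathlib

open MeasureTheory
open scoped ENNReal FourierTransform

noncomputable section

namespace NavierStokes

/-- Three-dimensional Euclidean space `ℝ³`. -/
abbrev E3 : Type := EuclideanSpace ℝ (Fin 3)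

instance fact_one_le_three : Fact ((1 : ℝ≥0∞) ≤ 3) := ⟨by norm_num⟩

/-- The partial derivative `∂ᵢ f (x)` of a scalar function on `ℝ³` (with `i = 0, 1, 2`). -/
def partialDeriv (i : Fin 3) (f : E3 → ℝ) (x : E3) : ℝ :=
  fderiv ℝ f x (EuclideanSpace.single i 1)

/-- A differentiable vector field on `ℝ³` whose divergence vanishes everywhere. -/
def IsDivergenceFree (v : E3 → E3) : Prop :=
  Differentiable ℝ v ∧ ∀ x, ∑ i : Fin 3, partialDeriv i (fun y => v y i) x = 0

/-- The function `x ↦ [log (e + |x|²)]⁻¹`. -/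
def invLog (x : E3) : ℝ := (Real.log (Real.exp 1 + ‖x‖ ^ 2))⁻¹

/-- The datum `ȧ = η (-∂₂ [log (e + |x|²)]⁻¹, ∂₁ [log (e + |x|²)]⁻¹, 0)`;
the coordinates `1, 2, 3` are indexed by `0, 1, 2`. -/
def dotA (η : ℝ) (x : E3) : E3 :=
  η • !₂[-partialDeriv 1 invLog x, partialDeriv 0 invLog x, 0]

/-- The datum `ā (x) = ȧ (x) sin (|x|²)`. -/
def barA (η : ℝ) (x : E3) : E3 := Real.sin (‖x‖ ^ 2) • dotA η x

/-- The Gauss--Weierstrass kernel `(4πt)^{-3/2} exp (-|x|²/(4t))` on `ℝ³`. -/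
def heatKernel (t : ℝ) (x : E3) : ℝ :=
  (4 * Real.pi * t) ^ (-(3 / 2 : ℝ)) * Real.exp (-(‖x‖ ^ 2) / (4 * t))

/-- The heat semigroup `e^{tΔ} a` for `t > 0`. -/
def heat (t : ℝ) (a : E3 → E3) (x : E3) : E3 :=
  ∫ y, heatKernel t (x - y) • a y

/-- The Fourier symbol of the operator `e^{tΔ} P_{jk} ∂ₕ`, where
`P = Id - ∇ Δ⁻¹ div` is the Leray--Hopf projector. Fourier transforms use the character
`exp (-2πi x·ξ)`, so that `∂ₕ`, `Δ` and `P_{jk}` have the symbols `2πi ξₕ`, `-4π²|ξ|²` and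
`δ_{jk} - ξⱼ ξₖ / |ξ|²`. -/
def oseenSymbol (j h k : Fin 3) (t : ℝ) (ξ : E3) : ℂ :=
  (Real.exp (-(4 * Real.pi ^ 2 * t * ‖ξ‖ ^ 2)) : ℂ)
    * (((if j = k then (1 : ℝ) else 0) - ξ j * ξ k / ‖ξ‖ ^ 2 : ℝ) : ℂ)
    * (2 * Real.pi * Complex.I * (ξ h : ℂ))

/-- The convolution kernel of `e^{tΔ} P_{jk} ∂ₕ` for `t > 0`: the inverse Fourier transform of the
(integrable) symbol. It is real, because the symbol takes conjugate values at `ξ` and `-ξ`. -/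
def oseenKernel (j h k : Fin 3) (t : ℝ) (x : E3) : ℝ :=
  (𝓕⁻ (oseenSymbol j h k t) x).re

/-- `e^{tΔ} P ∇·(v ⊗ w)` for `t > 0`, where `(∇·(v ⊗ w))ₖ = ∑ₕ ∂ₕ (vₕ wₖ)`. -/
def oseen (t : ℝ) (v w : E3 → E3) (x : E3) : E3 :=
  WithLp.toLp 2 fun j =>
    ∑ h : Fin 3, ∑ k : Fin 3, ∫ y, oseenKernel j h k t (x - y) * (v y h * w y k)

/-- The bilinear operator `B(u,v)(t) = -∫₀ᵗ e^{(t-s)Δ} P ∇·(u ⊗ v)(s) ds`. -/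
def bilinear (u v : ℝ → E3 → E3) (t : ℝ) (x : E3) : E3 :=
  -∫ s in (0 : ℝ)..t, oseen (t - s) (u s) (v s) x

/-- `u ∈ C([0,T), L³(ℝ³))` is a solution on `[0,T)`, `T ≤ ∞`, of the Navier--Stokes equations
with datum `a`, in the integral form `u(t) = e^{tΔ} a + B(u,u)(t)`. The values of `u` outside
`[0,T)` play no role. -/
structure IsL3Solution (a : E3 → E3) (T : EReal) (u : ℝ → Lp E3 3 (volume : Measure E3)) :
    Prop where
  continuousOn : ContinuousOn u {t : ℝ | 0 ≤ t ∧ (t : EReal) < T}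
  initial : u 0 =ᵐ[volume] a
  integral_eq : ∀ t : ℝ, 0 < t → (t : EReal) < T →
    u t =ᵐ[volume] fun x => heat t a x + bilinear (fun s => u s) (fun s => u s) t x

end NavierStokes

end

/-!
The equation is treated through the convolution kernel of `e^{τΔ} P ∇·`. Writing the factor
`1 / |ξ|²` of the Leray projector as an integral of Gaussians over times beyond `τ`, one sees by
scaling that this kernel has `L¹` norm `O(τ^{-1/2})` and supremum `O(τ^{-2})`
(`exists_oseenMajorant_bound`). Everything about the bilinear operator follows from these two
bounds, applied to the majorant of the Duhamel integral obtained by taking absolute values inside.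

*Uniqueness.* The bilinear operator is not bounded on `C([0,T), L³)`, but it is bounded from
`L^∞(weak L^{3/2})` to `L^∞(weak L³)`, because the time integral can be split at
`t - s = |E|^{2/3}` when the result is tested against a set `E`
(`setLIntegral_duhamelMajorant_le_weak`). If two solutions agree up to time `x`, their common value
at time `x` is the sum of a bounded function and of a function small in `L³`; by continuity both
solutions keep this form for a short time, and their difference `w` satisfies
`‖w‖ ≤ ½ ‖w‖` in weak `L³` (`ae_eq_zero_of_le_duhamelMajorant`, `exists_gt_eq_of_eq`). Hence the set
of times up to which they agree is open and closed (`IsL3Solution.unique`).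

*Existence.* Both data are bounded. With the nonlinearity clipped at a level above the supremum of
the datum, the Picard map is a contraction of `C([0,T], L³)` for small `T`, and the fixed point is
bounded by the clipping level, so that the clipping is inactive (`exists_isL3Solution`).

*The data.* Both are radial multiples of the rotation field `(x₂, -x₁, 0)`, hence divergence-free
(`HasRadialGradient.isDivergenceFree`). The amplitude of `ȧ` is `|x|⁻¹ log⁻² |x|` up to constants
and a factor vanishing on the third axis, which is in `L³` but in no smaller `Lᵖ`. For `ā` the sine
might be small, but not at a point `x` near `R e₁` and at its translate by `e₁ / (2R)` at the same
time (`one_div_eight_le_abs_sin`, `not_memLp_barA`).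

*The solution arising from `ȧ`.* The components of `ȧ` are symbols of order one (`IsSymbol`), so
that `e^{tΔ} ȧ - ȧ = O(|x|⁻²)` at infinity (`exists_bound_heat_dotA_sub`), and the Duhamel term is
in `L^r` for `3/2 ≤ r ≤ 3` (`IsL3Solution.memLp_sub_heat`). Were `u(t)` in `L^q` with `q < 3`, then
`ȧ` would be in `L^r` with `r = max q 2 < 3`.

*The solution arising from `ā`.* Because of the factor `sin |x|²`, whose frequency grows with `|x|`,
the heat flow makes `ā` decay to any order (`exists_bound_scaledConv_osc`). Thus `e^{tΔ} ā` is
in `L¹`, and `‖e^{sΔ} ā‖₂² = O(s^{-3/4})`. Since the Duhamel term is bounded in `L²`, the product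
`u ⊗ u` has an `L¹` norm `O(s^{-3/4})`, and the Duhamel integral
`∫₀ᵗ (t - s)^{-1/2} s^{-3/4} ds` converges in `L¹` (`memLp_one_of_isL3Solution_barA`).
-/

open MeasureTheory
open scoped ENNReal FourierTransform SchwartzMap Topology

noncomputable section

namespace NavierStokes

open Set Filter

/-! ### Gaussians and their Fourier transforms -/

/-- The Gaussian `exp (-c |x|²)`, `c > 0`, as a Schwartz function. -/
def gaussianSchwartz (c : ℝ) (hc : 0 < c) : 𝓢(E3, ℝ) where
  toFun x := Real.exp (-(c * ‖x‖ ^ 2))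
  smooth' := (contDiff_const.mul (contDiff_norm_sq ℝ)).neg.exp
  decay' k n := by
    have hf : (fun x : E3 => -(c * ‖x‖ ^ 2)).HasTemperateGrowth := by
      have h := ((Function.HasTemperateGrowth.const (-c) :
        (fun _ : E3 => -c).HasTemperateGrowth)).mul (Function.hasTemperateGrowth_norm_sq E3)
      have e : (fun x : E3 => -(c * ‖x‖ ^ 2)) = (fun _ => -c) * fun x => ‖x‖ ^ 2 := by
        ext x; simp
      rwa [e]
    obtain ⟨l, C, hC, hl⟩ := hf.norm_iteratedFDeriv_le_uniform n
    have key : ∀ x : E3, ‖iteratedFDeriv ℝ n (fun x : E3 => Real.exp (-(c * ‖x‖ ^ 2))) x‖ ≤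
        n.factorial * Real.exp (-(c * ‖x‖ ^ 2)) * ((1 + C) * (1 + ‖x‖) ^ l) ^ n := by
      intro x
      refine norm_iteratedFDeriv_comp_le (g := Real.exp) (N := ((⊤ : ℕ∞) : WithTop ℕ∞)) (n := n)
        Real.contDiff_exp hf.1 (by exact_mod_cast le_top) x ?_ ?_
      · intro i _
        rw [norm_iteratedFDeriv_eq_norm_iteratedDeriv, iteratedDeriv_eq_iterate,
          Real.iter_deriv_exp]
        simp
      · intro i hi hin
        refine (hl i hin x).trans ?_
        have h1 : (1 : ℝ) ≤ (1 + ‖x‖) ^ l := one_le_pow₀ (by linarith [norm_nonneg x])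
        have h2 : (1 : ℝ) ≤ (1 + C) * (1 + ‖x‖) ^ l := by nlinarith
        calc C * (1 + ‖x‖) ^ l ≤ (1 + C) * (1 + ‖x‖) ^ l := by gcongr; linarith
          _ ≤ _ := le_self_pow₀ h2 (by omega)
    -- an exponential in `|x|²` beats every power of `1 + |x|`
    have hdecay : ∃ B : ℝ, ∀ r : ℝ, 0 ≤ r →
        (1 + r) ^ (k + l * n) * Real.exp (-(c * r ^ 2)) ≤ B := by
      set N := k + l * n
      refine ⟨2 ^ N * (1 + N.factorial / c ^ N), fun r hr => ?_⟩
      have hexp : Real.exp (-(c * r ^ 2)) ≤ 1 := Real.exp_le_one_iff.2 (by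
        have := mul_nonneg hc.le (sq_nonneg r); linarith)
      rcases le_total r 1 with h | h
      · calc (1 + r) ^ N * Real.exp (-(c * r ^ 2)) ≤ 2 ^ N * 1 := by
              gcongr; linarith
          _ ≤ _ := by
              gcongr
              have : 0 ≤ (N.factorial : ℝ) / c ^ N := by positivity
              linarith
      · have h3 : (c * r ^ 2) ^ N / N.factorial ≤ Real.exp (c * r ^ 2) :=
          Real.pow_div_factorial_le_exp _ (by positivity) _
        have h4 : r ^ N * Real.exp (-(c * r ^ 2)) ≤ N.factorial / c ^ N := by
          rw [Real.exp_neg, ← div_eq_mul_inv, div_le_div_iff₀ (Real.exp_pos _) (by positivity)]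
          rw [div_le_iff₀ (by positivity)] at h3
          calc r ^ N * c ^ N ≤ (c * r ^ 2) ^ N := by
                rw [← mul_pow]
                have h5 : r ≤ r ^ 2 := by nlinarith
                exact pow_le_pow_left₀ (by positivity)
                  (by rw [mul_comm]; exact mul_le_mul_of_nonneg_left h5 hc.le) _
            _ ≤ _ := by linarith
        calc (1 + r) ^ N * Real.exp (-(c * r ^ 2)) ≤ (2 * r) ^ N * Real.exp (-(c * r ^ 2)) := by
              gcongr; linarith
          _ = 2 ^ N * (r ^ N * Real.exp (-(c * r ^ 2))) := by rw [mul_pow]; ring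
          _ ≤ _ := by gcongr; linarith
    obtain ⟨B, hB⟩ := hdecay
    refine ⟨n.factorial * (1 + C) ^ n * B, fun x => ?_⟩
    have hx := norm_nonneg x
    calc ‖x‖ ^ k * ‖iteratedFDeriv ℝ n (fun x : E3 => Real.exp (-(c * ‖x‖ ^ 2))) x‖
        ≤ (1 + ‖x‖) ^ k * (n.factorial * Real.exp (-(c * ‖x‖ ^ 2)) *
            ((1 + C) * (1 + ‖x‖) ^ l) ^ n) := by
          gcongr
          · linarith
          · exact key x
      _ = n.factorial * (1 + C) ^ n * ((1 + ‖x‖) ^ (k + l * n) * Real.exp (-(c * ‖x‖ ^ 2))) := by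
          rw [mul_pow, ← pow_mul, pow_add]; ring
      _ ≤ _ := by gcongr; exact hB _ hx

@[simp] lemma gaussianSchwartz_apply (c : ℝ) (hc : 0 < c) (x : E3) :
    gaussianSchwartz c hc x = Real.exp (-(c * ‖x‖ ^ 2)) := rfl

/-- The product of the factor `g` and of the Fourier symbol of the heat semigroup at time `σ`. -/
def gaussSymbol (g : E3 → ℂ) (σ : ℝ) (ξ : E3) : ℂ :=
  g ξ * (Real.exp (-(4 * Real.pi ^ 2 * σ * ‖ξ‖ ^ 2)) : ℂ)

/-- For a factor `g` of temperate growth, `gaussSymbol g σ` is a Schwartz function. -/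
lemma exists_schwartz_gaussSymbol {g : E3 → ℂ} (hg : g.HasTemperateGrowth) {σ : ℝ} (hσ : 0 < σ) :
    ∃ f : 𝓢(E3, ℂ), ⇑f = gaussSymbol g σ := by
  refine ⟨SchwartzMap.bilinLeftCLM (ContinuousLinearMap.lsmul ℝ ℝ (E := ℂ)) hg
    (gaussianSchwartz (4 * Real.pi ^ 2 * σ) (by positivity)), ?_⟩
  ext ξ
  simp [gaussSymbol, mul_comm]

lemma integrable_gaussSymbol {g : E3 → ℂ} (hg : g.HasTemperateGrowth) {σ : ℝ} (hσ : 0 < σ) :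
    Integrable (gaussSymbol g σ) := by
  obtain ⟨f, hf⟩ := exists_schwartz_gaussSymbol hg hσ
  rw [← hf]; exact f.integrable

lemma integrable_fourierInv_gaussSymbol {g : E3 → ℂ} (hg : g.HasTemperateGrowth) {σ : ℝ}
    (hσ : 0 < σ) : Integrable (𝓕⁻ (gaussSymbol g σ)) := by
  obtain ⟨f, hf⟩ := exists_schwartz_gaussSymbol hg hσ
  rw [← hf, ← SchwartzMap.fourierInv_coe]; exact (𝓕⁻ f).integrable

/-- Scaling of the symbols whose factor is homogeneous of degree `n`. -/
lemma gaussSymbol_scale {g : E3 → ℂ} {n : ℕ} (hom : ∀ (r : ℝ) ξ, g (r • ξ) = (r : ℂ) ^ n * g ξ)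
    {σ : ℝ} (hσ : 0 < σ) (ξ : E3) :
    gaussSymbol g σ ξ = ((σ ^ (-(n / 2 : ℝ)) : ℝ) : ℂ) * gaussSymbol g 1 (√σ • ξ) := by
  have h1 : (σ ^ (-(n / 2 : ℝ)) : ℝ) * √σ ^ n = 1 := by
    rw [Real.sqrt_eq_rpow, ← Real.rpow_natCast, ← Real.rpow_mul hσ.le, ← Real.rpow_add hσ]
    rw [show (-(n / 2 : ℝ) + 1 / 2 * n) = 0 by ring, Real.rpow_zero]
  have h2 : ‖√σ • ξ‖ ^ 2 = σ * ‖ξ‖ ^ 2 := by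
    rw [norm_smul, mul_pow, Real.norm_of_nonneg (Real.sqrt_nonneg _), Real.sq_sqrt hσ.le]
  rw [gaussSymbol, gaussSymbol, hom, h2]
  rw [show (4 * Real.pi ^ 2 * 1 * (σ * ‖ξ‖ ^ 2)) = 4 * Real.pi ^ 2 * σ * ‖ξ‖ ^ 2 by ring]
  have h3 : ((σ ^ (-(n / 2 : ℝ)) : ℝ) : ℂ) * (√σ : ℂ) ^ n = 1 := by exact_mod_cast h1
  linear_combination (-(g ξ * (Real.exp (-(4 * Real.pi ^ 2 * σ * ‖ξ‖ ^ 2)) : ℂ))) * h3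

lemma lintegral_comp_smul_E3 (f : E3 → ℝ≥0∞) {r : ℝ} (hr : 0 < r) :
    ∫⁻ x, f (r • x) = ENNReal.ofReal (r ^ (-3 : ℝ)) * ∫⁻ x, f x := by
  have hmap := Measure.map_addHaar_smul (volume : Measure E3) hr.ne'
  have h1 : ∫⁻ x, f (r • x) = ∫⁻ x, f x ∂(Measure.map (r • ·) (volume : Measure E3)) :=
    ((Homeomorph.smulOfNeZero r hr.ne').measurableEmbedding.lintegral_map f).symm
  rw [h1, hmap, lintegral_smul_measure]
  simp only [finrank_euclideanSpace, Fintype.card_fin, smul_eq_mul]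
  congr 2
  rw [abs_of_nonneg (by positivity), Real.rpow_neg hr.le]
  norm_cast

lemma fourierInv_gaussSymbol_scale {g : E3 → ℂ} {n : ℕ}
    (hom : ∀ (r : ℝ) ξ, g (r • ξ) = (r : ℂ) ^ n * g ξ) {σ : ℝ} (hσ : 0 < σ) (x : E3) :
    𝓕⁻ (gaussSymbol g σ) x = ((σ ^ (-(n / 2 : ℝ)) * σ ^ (-(3 / 2) : ℝ) : ℝ) : ℂ) *
      𝓕⁻ (gaussSymbol g 1) ((√σ)⁻¹ • x) := by
  have hs : 0 < √σ := Real.sqrt_pos.2 hσ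
  rw [Real.fourierInv_eq, Real.fourierInv_eq]
  have key := Measure.integral_comp_smul_of_nonneg (volume : Measure E3)
    (fun v => (Real.fourierChar (inner ℝ v ((√σ)⁻¹ • x)) : Circle) • gaussSymbol g 1 v) √σ
    (hR := hs.le)
  have h3 : (√σ ^ 3)⁻¹ = σ ^ (-(3 / 2) : ℝ) := by
    rw [Real.sqrt_eq_rpow, ← Real.rpow_natCast, ← Real.rpow_mul hσ.le, ← Real.rpow_neg hσ.le]
    norm_num
  simp only [finrank_euclideanSpace, Fintype.card_fin, h3] at key
  rw [Complex.ofReal_mul, mul_assoc, ← Complex.real_smul (x := σ ^ (-(3 / 2) : ℝ)), ← key,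
    ← integral_const_mul]
  congr 1 with v
  rw [gaussSymbol_scale hom hσ, inner_smul_left, inner_smul_right]
  simp only [conj_trivial, mul_inv_cancel_left₀ hs.ne', Circle.smul_def, smul_eq_mul]
  ring

/-- The inverse Fourier transform of a Gaussian times a homogeneous factor of degree `n` has an
`L¹` norm proportional to `σ^{-n/2}`. -/
lemma lintegral_fourierInv_gaussSymbol {g : E3 → ℂ} {n : ℕ}
    (hom : ∀ (r : ℝ) ξ, g (r • ξ) = (r : ℂ) ^ n * g ξ) {σ : ℝ} (hσ : 0 < σ) :
    ∫⁻ x, ‖𝓕⁻ (gaussSymbol g σ) x‖ₑ =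
      ENNReal.ofReal (σ ^ (-(n / 2 : ℝ))) * ∫⁻ x, ‖𝓕⁻ (gaussSymbol g 1) x‖ₑ := by
  have hs : 0 < √σ := Real.sqrt_pos.2 hσ
  simp_rw [fourierInv_gaussSymbol_scale hom hσ, enorm_mul]
  rw [lintegral_const_mul' _ _ enorm_ne_top,
    lintegral_comp_smul_E3 (fun x => ‖𝓕⁻ (gaussSymbol g 1) x‖ₑ) (inv_pos.2 hs), ← mul_assoc]
  congr 1
  rw [← ofReal_norm, ← ENNReal.ofReal_mul (norm_nonneg _), Complex.norm_real,
    Real.norm_of_nonneg (by positivity), mul_assoc]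
  congr 1
  rw [Real.sqrt_eq_rpow, ← Real.rpow_neg hσ.le, ← Real.rpow_mul hσ.le, ← Real.rpow_add hσ]
  norm_num

lemma lintegral_gaussSymbol {g : E3 → ℂ} {n : ℕ}
    (hom : ∀ (r : ℝ) ξ, g (r • ξ) = (r : ℂ) ^ n * g ξ) {σ : ℝ} (hσ : 0 < σ) :
    ∫⁻ ξ, ‖gaussSymbol g σ ξ‖ₑ =
      ENNReal.ofReal (σ ^ (-((n + 3) / 2 : ℝ))) * ∫⁻ ξ, ‖gaussSymbol g 1 ξ‖ₑ := by
  have hs : 0 < √σ := Real.sqrt_pos.2 hσ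
  simp_rw [gaussSymbol_scale hom hσ, enorm_mul]
  rw [lintegral_const_mul' _ _ enorm_ne_top,
    lintegral_comp_smul_E3 (fun x => ‖gaussSymbol g 1 x‖ₑ) hs, ← mul_assoc]
  congr 1
  rw [← ofReal_norm, ← ENNReal.ofReal_mul (norm_nonneg _), Complex.norm_real,
    Real.norm_of_nonneg (by positivity)]
  congr 1
  rw [Real.sqrt_eq_rpow, ← Real.rpow_mul hσ.le, ← Real.rpow_add hσ]
  congr 1; ring

/-! ### The Oseen kernel as an integral of Gaussians -/

/-- Joint measurability of the inverse Fourier transform of a family of symbols. -/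
lemma measurable_fourierInv_param {f : ℝ → E3 → ℂ} (hf : Measurable (Function.uncurry f)) :
    Measurable fun p : ℝ × E3 => 𝓕⁻ (f p.1) p.2 := by
  simp_rw [Real.fourierInv_eq']
  have h : StronglyMeasurable fun q : (ℝ × E3) × E3 =>
      Complex.exp ((↑(2 * Real.pi * inner ℝ q.2 q.1.2) * Complex.I)) • f q.1.1 q.2 := by
    apply Measurable.stronglyMeasurable
    have h1 : Measurable fun q : (ℝ × E3) × E3 => f q.1.1 q.2 :=
      hf.comp ((measurable_fst.comp measurable_fst).prodMk measurable_snd)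
    have h2 : Measurable fun q : (ℝ × E3) × E3 => inner ℝ q.2 q.1.2 := by
      have : Continuous fun q : (ℝ × E3) × E3 => inner ℝ q.2 q.1.2 := by fun_prop
      exact this.measurable
    fun_prop
  exact h.integral_prod_right.measurable

lemma measurable_oseenSymbol (j h k : Fin 3) :
    Measurable (Function.uncurry (oseenSymbol j h k)) := by
  unfold oseenSymbol Function.uncurry
  fun_prop

lemma measurable_oseenKernel (j h k : Fin 3) :
    Measurable fun p : ℝ × E3 => oseenKernel j h k p.1 p.2 := by
  unfold oseenKernel
  exact Complex.measurable_re.comp (measurable_fourierInv_param (measurable_oseenSymbol j h k))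

/-- The symbol of `∂ₕ`. -/
def derivSymbol (h : Fin 3) (ξ : E3) : ℂ := 2 * Real.pi * Complex.I * (ξ h : ℂ)

/-- Up to a constant, the symbol of `∂ⱼ ∂ₖ ∂ₕ`. -/
def tripleSymbol (j h k : Fin 3) (ξ : E3) : ℂ := (ξ j * ξ k : ℝ) * derivSymbol h ξ

lemma temperate_coord (i : Fin 3) : (fun ξ : E3 => (ξ i : ℂ)).HasTemperateGrowth :=
  (Complex.ofRealCLM ∘L (EuclideanSpace.proj i : E3 →L[ℝ] ℝ)).hasTemperateGrowth

lemma temperate_derivSymbol (h : Fin 3) : (derivSymbol h).HasTemperateGrowth :=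
  (Function.HasTemperateGrowth.const _).mul (temperate_coord h)

lemma temperate_tripleSymbol (j h k : Fin 3) : (tripleSymbol j h k).HasTemperateGrowth := by
  have h1 := ((temperate_coord j).mul (temperate_coord k)).mul (temperate_derivSymbol h)
  have e : tripleSymbol j h k =
      ((fun ξ : E3 => (ξ j : ℂ)) * fun ξ : E3 => (ξ k : ℂ)) * derivSymbol h := by
    ext ξ
    simp [tripleSymbol]
  rwa [e]

lemma derivSymbol_smul (h : Fin 3) (r : ℝ) (ξ : E3) :
    derivSymbol h (r • ξ) = (r : ℂ) ^ 1 * derivSymbol h ξ := by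
  simp [derivSymbol]; ring

lemma tripleSymbol_smul (j h k : Fin 3) (r : ℝ) (ξ : E3) :
    tripleSymbol j h k (r • ξ) = (r : ℂ) ^ 3 * tripleSymbol j h k ξ := by
  simp [tripleSymbol, derivSymbol]; ring

lemma norm_tripleSymbol_le (j h k : Fin 3) (ξ : E3) :
    ‖tripleSymbol j h k ξ‖ ≤ ‖ξ‖ ^ 2 * ‖derivSymbol h ξ‖ := by
  rw [tripleSymbol, norm_mul, Complex.norm_real, norm_mul, sq]
  gcongr <;> exact PiLp.norm_apply_le ξ _

/-- Writing `1/|ξ|²` as an integral of Gaussians removes the singularity of the Leray projector. -/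
lemma integral_gaussSymbol_Ioi (g : E3 → ℂ) (τ : ℝ) {ξ : E3} (hξ : ξ ≠ 0) :
    IntegrableOn (fun σ => gaussSymbol g σ ξ) (Ioi τ) ∧
    ∫ σ in Ioi τ, gaussSymbol g σ ξ =
      gaussSymbol g τ ξ / (4 * Real.pi ^ 2 * ‖ξ‖ ^ 2 : ℝ) := by
  have ha : 0 < 4 * Real.pi ^ 2 * ‖ξ‖ ^ 2 := by have := norm_pos_iff.2 hξ; positivity
  set a := 4 * Real.pi ^ 2 * ‖ξ‖ ^ 2 with hadef
  have e : ∀ σ, gaussSymbol g σ ξ = g ξ * ((Real.exp (-a * σ) : ℝ) : ℂ) := fun σ => by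
    rw [gaussSymbol, hadef]; congr 3; ring
  simp_rw [e]
  refine ⟨((integrableOn_exp_mul_Ioi (by linarith) τ).ofReal).const_mul _, ?_⟩
  rw [integral_const_mul, integral_complex_ofReal, integral_exp_mul_Ioi (by linarith)]
  push_cast
  have : (a : ℂ) ≠ 0 := by exact_mod_cast ha.ne'
  field_simp

/-- The Leray projector as a superposition of Gaussians. The formula holds at `ξ = 0` too, where the
symbol vanishes together with the factor `ξₕ`. -/
lemma oseenSymbol_eq (j h k : Fin 3) (τ : ℝ) (ξ : E3) :
    oseenSymbol j h k τ ξ = (if j = k then (1 : ℂ) else 0) * gaussSymbol (derivSymbol h) τ ξ -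
      (4 * Real.pi ^ 2 : ℝ) * ∫ σ in Ioi τ, gaussSymbol (tripleSymbol j h k) σ ξ := by
  rcases eq_or_ne ξ 0 with rfl | hξ
  · simp [oseenSymbol, gaussSymbol, tripleSymbol, derivSymbol]
  · rw [(integral_gaussSymbol_Ioi _ τ hξ).2]
    have h1 : (‖ξ‖ : ℂ) ≠ 0 := by exact_mod_cast (norm_pos_iff.2 hξ).ne'
    have h2 : (Real.pi : ℂ) ≠ 0 := by exact_mod_cast Real.pi_ne_zero
    simp only [oseenSymbol, gaussSymbol, tripleSymbol, derivSymbol]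
    split_ifs <;> push_cast <;> field_simp

lemma measurable_gaussSymbol {g : E3 → ℂ} (hg : Measurable g) :
    Measurable (Function.uncurry (gaussSymbol g)) := by
  unfold gaussSymbol Function.uncurry
  fun_prop

/-- The integrability that allows the inverse Fourier transform to be taken under the integral over
the Gaussians; the singularity `1 / |ξ|²` at the origin is compensated by `ξⱼ ξₖ`. -/
lemma integrable_prod_tripleSymbol (j h k : Fin 3) {τ : ℝ} (hτ : 0 < τ) :
    Integrable (fun p : E3 × ℝ => gaussSymbol (tripleSymbol j h k) p.2 p.1)
      ((volume : Measure E3).prod (volume.restrict (Ioi τ))) := by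
  have hm : Measurable (fun p : E3 × ℝ => gaussSymbol (tripleSymbol j h k) p.2 p.1) := by
    have h1 : Measurable (tripleSymbol j h k) :=
      (temperate_tripleSymbol j h k).1.continuous.measurable
    unfold gaussSymbol
    fun_prop
  rw [integrable_prod_iff hm.aestronglyMeasurable]
  have hne : ∀ᵐ ξ : E3, ξ ≠ 0 := Measure.ae_ne volume 0
  refine ⟨hne.mono fun ξ hξ => (integral_gaussSymbol_Ioi _ τ hξ).1, ?_⟩
  refine Integrable.mono' (((integrable_gaussSymbol (temperate_derivSymbol h) hτ).norm).const_mul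
    (4 * Real.pi ^ 2)⁻¹) hm.norm.stronglyMeasurable.integral_prod_right.aestronglyMeasurable ?_
  filter_upwards [hne] with ξ hξ
  have hn := norm_pos_iff.2 hξ
  have e : ∀ σ, ‖gaussSymbol (tripleSymbol j h k) σ ξ‖ =
      ‖gaussSymbol (fun ξ => (‖tripleSymbol j h k ξ‖ : ℂ)) σ ξ‖ := fun σ => by
    simp [gaussSymbol]
  have e2 : ∀ σ, (‖gaussSymbol (tripleSymbol j h k) σ ξ‖ : ℂ) =
      gaussSymbol (fun ξ => (‖tripleSymbol j h k ξ‖ : ℂ)) σ ξ := fun σ => by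
    rw [gaussSymbol, gaussSymbol, norm_mul, Complex.norm_real,
      Real.norm_of_nonneg (Real.exp_nonneg _)]
    push_cast; ring
  have h3 : ((∫ σ in Ioi τ, ‖gaussSymbol (tripleSymbol j h k) σ ξ‖ : ℝ) : ℂ) =
      gaussSymbol (fun ξ => (‖tripleSymbol j h k ξ‖ : ℂ)) τ ξ /
        (4 * Real.pi ^ 2 * ‖ξ‖ ^ 2 : ℝ) := by
    rw [← integral_complex_ofReal]
    simp_rw [e2]
    exact (integral_gaussSymbol_Ioi _ τ hξ).2
  rw [← Complex.norm_real, h3, norm_div, Complex.norm_real]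
  rw [Real.norm_of_nonneg (show (0:ℝ) ≤ 4 * Real.pi ^ 2 * ‖ξ‖ ^ 2 by positivity), ← e τ]
  rw [gaussSymbol, gaussSymbol, norm_mul, norm_mul]
  rw [div_le_iff₀ (by positivity)]
  have := norm_tripleSymbol_le j h k ξ
  calc _ ≤ (‖ξ‖ ^ 2 * ‖derivSymbol h ξ‖) *
        ‖((Real.exp (-(4 * Real.pi ^ 2 * τ * ‖ξ‖ ^ 2)) : ℝ) : ℂ)‖ := by gcongr
    _ = _ := by field_simp

/-- The Oseen kernel is dominated by kernels without singular factor, whose scaling is explicit. -/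
lemma enorm_oseenKernel_le (j h k : Fin 3) {τ : ℝ} (hτ : 0 < τ) (x : E3) :
    ‖oseenKernel j h k τ x‖ₑ ≤ ‖𝓕⁻ (gaussSymbol (derivSymbol h) τ) x‖ₑ +
      ENNReal.ofReal (4 * Real.pi ^ 2) *
        ∫⁻ σ in Ioi τ, ‖𝓕⁻ (gaussSymbol (tripleSymbol j h k) σ) x‖ₑ := by
  have hre : ‖oseenKernel j h k τ x‖ₑ ≤ ‖𝓕⁻ (oseenSymbol j h k τ) x‖ₑ := by
    rw [← ofReal_norm, ← ofReal_norm]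
    exact ENNReal.ofReal_le_ofReal (Complex.abs_re_le_norm _)
  refine hre.trans ?_
  have hint := integrable_prod_tripleSymbol j h k hτ
  have hchar : Measurable fun v : E3 => ((Real.fourierChar (inner ℝ v x) : Circle) : ℂ) := by
    have : Continuous fun v : E3 => ((Real.fourierChar (inner ℝ v x) : Circle) : ℂ) :=
      continuous_subtype_val.comp (Real.continuous_fourierChar.comp (by fun_prop))
    exact this.measurable
  have hnorm : ∀ v : E3, ‖((Real.fourierChar (inner ℝ v x) : Circle) : ℂ)‖ = 1 :=
    fun v => Circle.norm_coe _
  have hswap : ∫ v : E3, ((Real.fourierChar (inner ℝ v x) : Circle) : ℂ) *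
      (∫ σ in Ioi τ, gaussSymbol (tripleSymbol j h k) σ v) =
      ∫ σ in Ioi τ, 𝓕⁻ (gaussSymbol (tripleSymbol j h k) σ) x := by
    simp_rw [Real.fourierInv_eq, Circle.smul_def, smul_eq_mul, ← integral_const_mul]
    refine integral_integral_swap ?_
    refine (hint.bdd_mul (c := 1) (f := fun p : E3 × ℝ =>
      ((Real.fourierChar (inner ℝ p.1 x) : Circle) : ℂ))
      (hchar.comp measurable_fst).aestronglyMeasurable
      (Eventually.of_forall fun p => (hnorm _).le))
  have hF : 𝓕⁻ (oseenSymbol j h k τ) x =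
      (if j = k then (1 : ℂ) else 0) * 𝓕⁻ (gaussSymbol (derivSymbol h) τ) x -
      (4 * Real.pi ^ 2 : ℝ) * ∫ σ in Ioi τ, 𝓕⁻ (gaussSymbol (tripleSymbol j h k) σ) x := by
    rw [← hswap, Real.fourierInv_eq, Real.fourierInv_eq, ← integral_const_mul,
      ← integral_const_mul, ← integral_sub]
    · congr 1 with v
      rw [oseenSymbol_eq]
      simp only [Circle.smul_def, smul_eq_mul]
      ring
    · refine Integrable.const_mul ?_ _
      simp only [Circle.smul_def, smul_eq_mul]
      exact (integrable_gaussSymbol (temperate_derivSymbol h) hτ).bdd_mul (c := 1)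
        hchar.aestronglyMeasurable (Eventually.of_forall fun p => (hnorm _).le)
    · refine Integrable.const_mul ?_ _
      exact (hint.integral_prod_left).bdd_mul (c := 1)
        hchar.aestronglyMeasurable (Eventually.of_forall fun p => (hnorm _).le)
  rw [hF, sub_eq_add_neg]
  refine (enorm_add_le _ _).trans (add_le_add ?_ ?_)
  · rw [enorm_mul]
    split_ifs <;> simp
  · rw [enorm_neg, enorm_mul]
    gcongr
    · rw [← ofReal_norm, Complex.norm_real, Real.norm_of_nonneg (by positivity)]
    · exact enorm_integral_le_lintegral_enorm _

/-! ### Size estimates of the Oseen kernel -/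

lemma lintegral_Ioi_rpow {p τ : ℝ} (hp : p < -1) (hτ : 0 < τ) :
    ∫⁻ σ in Ioi τ, ENNReal.ofReal (σ ^ p) = ENNReal.ofReal (-τ ^ (p + 1) / (p + 1)) := by
  rw [← integral_Ioi_rpow_of_lt hp hτ, ofReal_integral_eq_lintegral_ofReal
    (integrableOn_Ioi_rpow_of_lt hp hτ)]
  filter_upwards [ae_restrict_mem measurableSet_Ioi] with σ hσ
  exact Real.rpow_nonneg (hτ.le.trans (le_of_lt hσ)) _

lemma enorm_oseenSymbol_le (j h k : Fin 3) (τ : ℝ) (ξ : E3) :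
    ‖oseenSymbol j h k τ ξ‖ₑ ≤ 2 * ‖gaussSymbol (derivSymbol h) τ ξ‖ₑ := by
  have h1 : |(if j = k then (1 : ℝ) else 0) - ξ j * ξ k / ‖ξ‖ ^ 2| ≤ 2 := by
    have h2 : |ξ j * ξ k / ‖ξ‖ ^ 2| ≤ 1 := by
      rw [abs_div, abs_mul, abs_of_nonneg (sq_nonneg ‖ξ‖), sq]
      exact div_le_one_of_le₀ (mul_le_mul (PiLp.norm_apply_le ξ _) (PiLp.norm_apply_le ξ _)
        (abs_nonneg _) (norm_nonneg _)) (by positivity)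
    refine (abs_sub _ _).trans ?_
    have : |if j = k then (1 : ℝ) else 0| ≤ 1 := by split_ifs <;> simp
    linarith
  have e : oseenSymbol j h k τ ξ =
      (((if j = k then (1 : ℝ) else 0) - ξ j * ξ k / ‖ξ‖ ^ 2 : ℝ) : ℂ) *
        gaussSymbol (derivSymbol h) τ ξ := by
    simp only [oseenSymbol, gaussSymbol, derivSymbol]; ring
  rw [e, enorm_mul]
  gcongr
  rw [← ofReal_norm, Complex.norm_real]
  exact (ENNReal.ofReal_le_ofReal h1).trans (by simp)

/-- The `L¹` bound comes from the Gaussians at the times `σ > τ`, whose contributions `σ^{-3/2}` are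
integrated in `σ`; the supremum is bounded by the `L¹` norm of the symbol. -/
lemma exists_oseenKernel_bound (j h k : Fin 3) : ∃ C : ℝ, 0 < C ∧ ∀ τ : ℝ, 0 < τ →
    ∫⁻ x, ‖oseenKernel j h k τ x‖ₑ ≤ ENNReal.ofReal (C * τ ^ (-(1 / 2) : ℝ)) ∧
    ∀ x, ‖oseenKernel j h k τ x‖ₑ ≤ ENNReal.ofReal (C * τ ^ (-2 : ℝ)) := by
  set g₁ := derivSymbol h
  set g₃ := tripleSymbol j h k
  have hom₁ := derivSymbol_smul h
  have hom₃ := tripleSymbol_smul j h k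
  have f₁ : ∫⁻ x, ‖𝓕⁻ (gaussSymbol g₁ 1) x‖ₑ ≠ ∞ :=
    (integrable_fourierInv_gaussSymbol (temperate_derivSymbol h) one_pos).hasFiniteIntegral.ne
  have f₃ : ∫⁻ x, ‖𝓕⁻ (gaussSymbol g₃ 1) x‖ₑ ≠ ∞ :=
    (integrable_fourierInv_gaussSymbol (temperate_tripleSymbol j h k)
      one_pos).hasFiniteIntegral.ne
  have f₂ : ∫⁻ ξ, ‖gaussSymbol g₁ 1 ξ‖ₑ ≠ ∞ :=
    (integrable_gaussSymbol (temperate_derivSymbol h) one_pos).hasFiniteIntegral.ne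
  obtain ⟨A₁, hA₁⟩ : ∃ A, A = (∫⁻ x, ‖𝓕⁻ (gaussSymbol g₁ 1) x‖ₑ).toReal := ⟨_, rfl⟩
  obtain ⟨A₃, hA₃⟩ : ∃ A, A = (∫⁻ x, ‖𝓕⁻ (gaussSymbol g₃ 1) x‖ₑ).toReal := ⟨_, rfl⟩
  obtain ⟨A₂, hA₂⟩ : ∃ A, A = (∫⁻ ξ, ‖gaussSymbol g₁ 1 ξ‖ₑ).toReal := ⟨_, rfl⟩
  have n₁ : 0 ≤ A₁ := hA₁ ▸ ENNReal.toReal_nonneg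
  have n₂ : 0 ≤ A₂ := hA₂ ▸ ENNReal.toReal_nonneg
  have n₃ : 0 ≤ A₃ := hA₃ ▸ ENNReal.toReal_nonneg
  have e₁ : ∫⁻ x, ‖𝓕⁻ (gaussSymbol g₁ 1) x‖ₑ = ENNReal.ofReal A₁ := by
    rw [hA₁, ENNReal.ofReal_toReal f₁]
  have e₂ : ∫⁻ ξ, ‖gaussSymbol g₁ 1 ξ‖ₑ = ENNReal.ofReal A₂ := by
    rw [hA₂, ENNReal.ofReal_toReal f₂]
  have e₃ : ∫⁻ x, ‖𝓕⁻ (gaussSymbol g₃ 1) x‖ₑ = ENNReal.ofReal A₃ := by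
    rw [hA₃, ENNReal.ofReal_toReal f₃]
  refine ⟨A₁ + 4 * Real.pi ^ 2 * (2 * A₃) + 2 * A₂ + 1, by positivity, fun τ hτ => ⟨?_, ?_⟩⟩
  · have hmeas : Measurable fun p : ℝ × E3 => 𝓕⁻ (gaussSymbol g₃ p.1) p.2 :=
      measurable_fourierInv_param (measurable_gaussSymbol
        (temperate_tripleSymbol j h k).1.continuous.measurable)
    have hmeas₁ : Measurable fun p : ℝ × E3 => 𝓕⁻ (gaussSymbol g₁ p.1) p.2 :=
      measurable_fourierInv_param (measurable_gaussSymbol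
        (temperate_derivSymbol h).1.continuous.measurable)
    have hm₁ : Measurable fun x => ‖𝓕⁻ (gaussSymbol g₁ τ) x‖ₑ :=
      (hmeas₁.comp (measurable_const.prodMk measurable_id)).enorm
    have hswap : ∫⁻ x, ∫⁻ σ in Ioi τ, ‖𝓕⁻ (gaussSymbol g₃ σ) x‖ₑ =
        ENNReal.ofReal (2 * τ ^ (-(1 / 2) : ℝ) * A₃) := by
      rw [lintegral_lintegral_swap (hmeas.comp measurable_swap).enorm.aemeasurable]
      have : ∀ σ ∈ Ioi τ, ∫⁻ x, ‖𝓕⁻ (gaussSymbol g₃ σ) x‖ₑ =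
          ENNReal.ofReal (σ ^ (-(3 / 2) : ℝ)) * ENNReal.ofReal A₃ := fun σ hσ => by
        rw [lintegral_fourierInv_gaussSymbol hom₃ (hτ.trans hσ), e₃]
        norm_num
      rw [setLIntegral_congr_fun measurableSet_Ioi this,
        lintegral_mul_const' _ _ ENNReal.ofReal_ne_top,
        lintegral_Ioi_rpow (by norm_num) hτ, ← ENNReal.ofReal_mul']
      · rw [show (-(3 / 2) : ℝ) + 1 = -(1 / 2) by norm_num]
        congr 1; ring
      · exact n₃
    calc ∫⁻ x, ‖oseenKernel j h k τ x‖ₑ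
        ≤ ∫⁻ x, (‖𝓕⁻ (gaussSymbol g₁ τ) x‖ₑ + ENNReal.ofReal (4 * Real.pi ^ 2) *
            ∫⁻ σ in Ioi τ, ‖𝓕⁻ (gaussSymbol g₃ σ) x‖ₑ) :=
          lintegral_mono fun x => enorm_oseenKernel_le j h k hτ x
      _ = ENNReal.ofReal (τ ^ (-(1 / 2) : ℝ)) * ENNReal.ofReal A₁ +
          ENNReal.ofReal (4 * Real.pi ^ 2) * ENNReal.ofReal (2 * τ ^ (-(1 / 2) : ℝ) * A₃) := by
          rw [lintegral_add_left hm₁, lintegral_const_mul' _ _ ENNReal.ofReal_ne_top, hswap,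
            lintegral_fourierInv_gaussSymbol hom₁ hτ, e₁]
          norm_num
      _ ≤ _ := by
          rw [← ENNReal.ofReal_mul (by positivity), ← ENNReal.ofReal_mul (by positivity),
            ← ENNReal.ofReal_add (by positivity) (by positivity)]
          refine ENNReal.ofReal_le_ofReal ?_
          have h0 : 0 ≤ τ ^ (-(1 / 2) : ℝ) := Real.rpow_nonneg hτ.le _
          have h1 := mul_nonneg n₂ h0
          nlinarith
  · intro x
    have hre : ‖oseenKernel j h k τ x‖ₑ ≤ ‖𝓕⁻ (oseenSymbol j h k τ) x‖ₑ := by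
      rw [← ofReal_norm, ← ofReal_norm]
      exact ENNReal.ofReal_le_ofReal (Complex.abs_re_le_norm _)
    calc ‖oseenKernel j h k τ x‖ₑ ≤ ‖𝓕⁻ (oseenSymbol j h k τ) x‖ₑ := hre
      _ ≤ ∫⁻ ξ, ‖oseenSymbol j h k τ ξ‖ₑ := by
          rw [Real.fourierInv_eq]
          refine (enorm_integral_le_lintegral_enorm _).trans (lintegral_mono fun ξ => ?_)
          rw [← ofReal_norm, ← ofReal_norm, Circle.norm_smul]
      _ ≤ ∫⁻ ξ, 2 * ‖gaussSymbol g₁ τ ξ‖ₑ := lintegral_mono fun ξ => enorm_oseenSymbol_le j h k τ ξ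
      _ = 2 * (ENNReal.ofReal (τ ^ (-2 : ℝ)) * ENNReal.ofReal A₂) := by
          rw [lintegral_const_mul' _ _ (by simp), lintegral_gaussSymbol hom₁ hτ, e₂]
          norm_num
      _ ≤ _ := by
          rw [← ENNReal.ofReal_mul (by positivity), ← ENNReal.ofReal_ofNat 2,
            ← ENNReal.ofReal_mul (by positivity)]
          refine ENNReal.ofReal_le_ofReal ?_
          have h0 : 0 ≤ τ ^ (-2 : ℝ) := Real.rpow_nonneg hτ.le _
          have h1 : 0 ≤ (A₁ + 4 * Real.pi ^ 2 * (2 * A₃) + 1) * τ ^ (-2 : ℝ) := by positivity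
          linarith

/-- The sum of the absolute values of the components of the kernel of `e^{τΔ} P ∇·`. -/
def oseenMajorant (τ : ℝ) (z : E3) : ℝ≥0∞ :=
  ∑ j : Fin 3, ∑ h : Fin 3, ∑ k : Fin 3, ‖oseenKernel j h k τ z‖ₑ

lemma measurable_oseenKernel_comp {α : Type*} [MeasurableSpace α] (j h k : Fin 3) {f : α → ℝ}
    {g : α → E3} (hf : Measurable f) (hg : Measurable g) :
    Measurable fun a => oseenKernel j h k (f a) (g a) := by
  have h1 := (measurable_oseenKernel j h k).comp (hf.prodMk hg)
  simpa only [Function.comp_def] using h1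

lemma measurable_oseenMajorant {α : Type*} [MeasurableSpace α] {f : α → ℝ} {g : α → E3}
    (hf : Measurable f) (hg : Measurable g) : Measurable fun a => oseenMajorant (f a) (g a) :=
  Finset.measurable_sum _ fun j _ => Finset.measurable_sum _ fun h _ =>
    Finset.measurable_sum _ fun k _ => (measurable_oseenKernel_comp j h k hf hg).enorm

/-- The two size estimates of the Oseen kernel on which the whole analysis of the bilinear
operator rests. -/
lemma exists_oseenMajorant_bound : ∃ C : ℝ, 0 < C ∧ ∀ τ : ℝ, 0 < τ →
    ∫⁻ z, oseenMajorant τ z ≤ ENNReal.ofReal (C * τ ^ (-(1 / 2) : ℝ)) ∧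
    ∀ z, oseenMajorant τ z ≤ ENNReal.ofReal (C * τ ^ (-2 : ℝ)) := by
  choose C hC h using exists_oseenKernel_bound
  refine ⟨∑ j, ∑ h, ∑ k, C j h k, Finset.sum_pos (fun j _ => Finset.sum_pos (fun h _ =>
    Finset.sum_pos (fun k _ => hC j h k) Finset.univ_nonempty) Finset.univ_nonempty)
    Finset.univ_nonempty, fun τ hτ => ?_⟩
  have hofReal : ∀ a : ℝ, 0 ≤ a → ENNReal.ofReal ((∑ j, ∑ h, ∑ k, C j h k) * a) =
      ∑ j, ∑ h, ∑ k, ENNReal.ofReal (C j h k * a) := fun a ha => by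
    simp_rw [Finset.sum_mul]
    rw [ENNReal.ofReal_sum_of_nonneg fun j _ => Finset.sum_nonneg fun h _ =>
      Finset.sum_nonneg fun k _ => mul_nonneg (hC j h k).le ha]
    refine Finset.sum_congr rfl fun j _ => ?_
    rw [ENNReal.ofReal_sum_of_nonneg fun h _ =>
      Finset.sum_nonneg fun k _ => mul_nonneg (hC j h k).le ha]
    refine Finset.sum_congr rfl fun h _ => ?_
    rw [ENNReal.ofReal_sum_of_nonneg fun k _ => mul_nonneg (hC j h k).le ha]
  have hm : ∀ j h k, Measurable fun z : E3 => ‖oseenKernel j h k τ z‖ₑ := fun j h k =>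
    (measurable_oseenKernel_comp j h k measurable_const measurable_id).enorm
  constructor
  · rw [hofReal _ (Real.rpow_nonneg hτ.le _)]
    unfold oseenMajorant
    rw [lintegral_finsetSum _ fun j _ => Finset.measurable_sum _ fun h _ =>
      Finset.measurable_sum _ fun k _ => hm j h k]
    refine Finset.sum_le_sum fun j _ => ?_
    rw [lintegral_finsetSum _ fun h _ => Finset.measurable_sum _ fun k _ => hm j h k]
    refine Finset.sum_le_sum fun i _ => ?_
    rw [lintegral_finsetSum _ fun k _ => hm j i k]
    exact Finset.sum_le_sum fun k _ => (h j i k τ hτ).1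
  · intro z
    rw [hofReal _ (Real.rpow_nonneg hτ.le _)]
    exact Finset.sum_le_sum fun j _ => Finset.sum_le_sum fun i _ =>
      Finset.sum_le_sum fun k _ => (h j i k τ hτ).2 z

/-- A constant for the size estimates of the Oseen kernel. -/
def oseenConst : ℝ := exists_oseenMajorant_bound.choose

lemma oseenConst_pos : 0 < oseenConst := exists_oseenMajorant_bound.choose_spec.1

lemma lintegral_oseenMajorant_le {τ : ℝ} (hτ : 0 < τ) :
    ∫⁻ z, oseenMajorant τ z ≤ ENNReal.ofReal (oseenConst * τ ^ (-(1 / 2) : ℝ)) :=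
  (exists_oseenMajorant_bound.choose_spec.2 τ hτ).1

lemma oseenMajorant_le {τ : ℝ} (hτ : 0 < τ) (z : E3) :
    oseenMajorant τ z ≤ ENNReal.ofReal (oseenConst * τ ^ (-2 : ℝ)) :=
  (exists_oseenMajorant_bound.choose_spec.2 τ hτ).2 z

/-! ### Jointly measurable representatives and a convexity inequality -/

/-- A uniformly continuous curve in `Lᵖ` has a jointly measurable representative: it is the limit
of step functions converging so fast that they converge almost everywhere at each time. -/
lemma exists_measurable_representative {X E : Type*} [MeasurableSpace X] {μ : Measure X}
    [NormedAddCommGroup E] [CompleteSpace E] [MeasurableSpace E] [BorelSpace E]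
    [SecondCountableTopology E] {p : ℝ≥0∞} [hp : Fact (1 ≤ p)] {u : ℝ → Lp E p μ}
    (hu : UniformContinuous u) :
    ∃ U : ℝ → X → E, Measurable (Function.uncurry U) ∧ ∀ s, U s =ᵐ[μ] u s := by
  have h1 : ∀ n : ℕ, ∃ δ > 0, ∀ s s' : ℝ, dist s s' < δ → dist (u s) (u s') < (1 / 2) ^ (n + 1) :=
    fun n => by
      obtain ⟨δ, hδ, h⟩ := Metric.uniformContinuous_iff.1 hu ((1 / 2) ^ (n + 1)) (by positivity)
      exact ⟨δ, hδ, fun s s' hs => h hs⟩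
  choose δ hδ hd using h1
  -- step functions with uniform error `2^{-(n+1)}`
  set q : ℕ → ℝ → Lp E p μ := fun n s => u (δ n * ⌊s / δ n⌋) with hq
  have hqd : ∀ n s, dist (q n s) (u s) < (1 / 2) ^ (n + 1) := fun n s => by
    refine hd n _ _ ?_
    have e : s = δ n * (s / δ n) := by field_simp [(hδ n).ne']
    rw [dist_comm, Real.dist_eq]
    nth_rw 1 [e]
    rw [← mul_sub, abs_mul, abs_of_pos (hδ n), Int.self_sub_floor,
      abs_of_nonneg (Int.fract_nonneg _)]
    have := Int.fract_lt_one (s / δ n)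
    nlinarith [hδ n]
  have hmeas : ∀ n, Measurable fun z : ℝ × X => q n z.1 z.2 := fun n => by
    have h2 : Measurable fun z : ℤ × X => (u (δ n * z.1) : X → E) z.2 :=
      measurable_from_prod_countable_right fun m =>
        (Lp.stronglyMeasurable (u (δ n * m))).measurable
    exact h2.comp (((Int.measurable_floor.comp (measurable_fst.div_const _))).prodMk measurable_snd)
  refine ⟨fun s x => limUnder atTop fun n => q n s x, ?_, fun s => ?_⟩
  · exact (StronglyMeasurable.limUnder fun n => (hmeas n).stronglyMeasurable).measurable
  · have hcau : ∀ᵐ x ∂μ, ∃ l : E, Tendsto (fun n => q n s x) atTop (𝓝 l) := by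
      refine Lp.ae_tendsto_of_cauchy_eLpNorm (p := p) (fun n => Lp.aestronglyMeasurable _) hp.out
        (B := fun n => ENNReal.ofReal ((1 / 2) ^ n)) ?_ ?_
      · rw [← ENNReal.ofReal_tsum_of_nonneg (fun n => by positivity) summable_geometric_two]
        exact ENNReal.ofReal_ne_top
      · intro N n m hn hm
        rw [← Lp.edist_def, edist_dist]
        refine (ENNReal.ofReal_lt_ofReal_iff (by positivity)).2 ?_
        have hn' : ((1 : ℝ) / 2) ^ (n + 1) ≤ (1 / 2) ^ (N + 1) :=
          pow_le_pow_of_le_one (by norm_num) (by norm_num) (by omega)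
        have hm' : ((1 : ℝ) / 2) ^ (m + 1) ≤ (1 / 2) ^ (N + 1) :=
          pow_le_pow_of_le_one (by norm_num) (by norm_num) (by omega)
        have := dist_triangle_right (q n s) (q m s) (u s)
        have h3 := hqd n s
        have h4 := hqd m s
        calc _ < ((1 : ℝ) / 2) ^ (N + 1) + (1 / 2) ^ (N + 1) := by linarith
          _ = _ := by rw [pow_succ]; ring
    have hlim : Tendsto (fun n => q n s) atTop (𝓝 (u s)) := by
      rw [tendsto_iff_dist_tendsto_zero]
      refine squeeze_zero (fun n => dist_nonneg) (fun n => (hqd n s).le) ?_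
      exact (tendsto_pow_atTop_nhds_zero_of_lt_one (by norm_num) (by norm_num)).comp
        (tendsto_add_atTop_nat 1)
    have hin := tendstoInMeasure_of_tendsto_eLpNorm (zero_lt_one.trans_le hp.out).ne'
      (fun n => Lp.aestronglyMeasurable (q n s)) (Lp.aestronglyMeasurable (u s))
      ((Lp.tendsto_Lp_iff_tendsto_eLpNorm' _ _).1 hlim)
    obtain ⟨ns, hns, hsub⟩ := hin.exists_seq_tendsto_ae
    filter_upwards [hcau, hsub] with x ⟨l, hl⟩ hx
    rw [hl.limUnder_eq]
    exact tendsto_nhds_unique (hl.comp hns.tendsto_atTop) hx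

/-- Jensen's inequality for a measure of arbitrary mass, integrated in a parameter. -/
lemma lintegral_lintegral_rpow_le {Z X : Type*} [MeasurableSpace Z] [MeasurableSpace X]
    {ν : Measure Z} {μ : Measure X} [SFinite ν] [SFinite μ] {g : Z × X → ℝ≥0∞} (hg : Measurable g)
    {p : ℝ} (hp : 1 ≤ p) :
    ∫⁻ x, (∫⁻ z, g (z, x) ∂ν) ^ p ∂μ ≤ ν univ ^ (p - 1) * ∫⁻ z, ∫⁻ x, g (z, x) ^ p ∂μ ∂ν := by
  have hJ : ∀ x, (∫⁻ z, g (z, x) ∂ν) ^ p ≤ ν univ ^ (p - 1) * ∫⁻ z, g (z, x) ^ p ∂ν := by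
    intro x
    rcases eq_or_lt_of_le hp with rfl | hp1
    · simp
    · have hc := Real.HolderConjugate.conjExponent hp1
      have hm : Measurable fun z => g (z, x) := hg.comp (measurable_id.prodMk measurable_const)
      have h := ENNReal.lintegral_mul_le_Lp_mul_Lq ν hc hm.aemeasurable
        (aemeasurable_const (b := (1 : ℝ≥0∞)))
      simp only [Pi.mul_apply, mul_one, ENNReal.one_rpow, lintegral_const, one_mul] at h
      have h2 := ENNReal.rpow_le_rpow h (zero_le_one.trans hp)
      rw [ENNReal.mul_rpow_of_nonneg _ _ (zero_le_one.trans hp), ← ENNReal.rpow_mul,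
        ← ENNReal.rpow_mul] at h2
      have e1 : 1 / p * p = 1 := by field_simp
      have e2 : 1 / p.conjExponent * p = p - 1 := by
        rw [Real.conjExponent]; field_simp
      rw [e1, e2, ENNReal.rpow_one] at h2
      rwa [mul_comm]
  refine (lintegral_mono hJ).trans ?_
  rw [lintegral_const_mul]
  · gcongr
    exact (lintegral_lintegral_swap (μ := μ) (ν := ν) (f := fun x z => g (z, x) ^ p)
      ((hg.comp measurable_swap).pow_const p).aemeasurable).le
  · exact Measurable.lintegral_prod_left' (μ := ν) (f := fun z => g z ^ p) (hg.pow_const p)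

/-! ### The Duhamel majorant -/

/-- `e^{tΔ} P ∇·F` for a tensor field `F`. -/
def oseenTensor (t : ℝ) (F : E3 → Fin 3 → Fin 3 → ℝ) (x : E3) : E3 :=
  WithLp.toLp 2 fun j =>
    ∑ h : Fin 3, ∑ k : Fin 3, ∫ y, oseenKernel j h k t (x - y) * F y h k

/-- The tensor product of two vectors. -/
def tensor (v w : E3) (h k : Fin 3) : ℝ := v h * w k

lemma enorm_E3_le_sum (v : E3) : ‖v‖ₑ ≤ ∑ j, ‖v j‖ₑ := by
  have h : ‖v‖ ≤ ∑ j, ‖v j‖ := by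
    rw [EuclideanSpace.norm_eq]
    refine Real.sqrt_le_iff.2 ⟨Finset.sum_nonneg fun j _ => norm_nonneg _, ?_⟩
    exact Finset.sum_sq_le_sq_sum_of_nonneg fun j _ => norm_nonneg _
  rw [← ofReal_norm]
  refine (ENNReal.ofReal_le_ofReal h).trans_eq ?_
  rw [ENNReal.ofReal_sum_of_nonneg fun j _ => norm_nonneg _]
  simp_rw [ofReal_norm]

lemma enorm_component_le (M : Fin 3 → Fin 3 → ℝ) (h k : Fin 3) : ‖M h k‖ₑ ≤ ‖M‖ₑ := by
  rw [← ofReal_norm, ← ofReal_norm]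
  exact ENNReal.ofReal_le_ofReal ((norm_le_pi_norm (M h) k).trans (norm_le_pi_norm M h))

lemma enorm_oseenTensor_le {F : E3 → Fin 3 → Fin 3 → ℝ} (hF : Measurable F) (t : ℝ) (x : E3) :
    ‖oseenTensor t F x‖ₑ ≤ ∫⁻ y, oseenMajorant t y * ‖F (x - y)‖ₑ := by
  have hm : ∀ j h k, Measurable fun y : E3 => ‖oseenKernel j h k t (x - y)‖ₑ * ‖F y‖ₑ :=
    fun j h k => (measurable_oseenKernel_comp j h k measurable_const
      (measurable_const.sub measurable_id)).enorm.mul hF.enorm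
  calc ‖oseenTensor t F x‖ₑ ≤ ∑ j, ‖∑ h : Fin 3, ∑ k : Fin 3,
        ∫ y, oseenKernel j h k t (x - y) * F y h k‖ₑ := enorm_E3_le_sum _
    _ ≤ ∑ j, ∑ h : Fin 3, ∑ k : Fin 3, ∫⁻ y, ‖oseenKernel j h k t (x - y)‖ₑ * ‖F y‖ₑ := by
        refine Finset.sum_le_sum fun j _ => (enorm_sum_le _ _).trans ?_
        refine Finset.sum_le_sum fun h _ => (enorm_sum_le _ _).trans ?_
        refine Finset.sum_le_sum fun k _ => (enorm_integral_le_lintegral_enorm _).trans ?_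
        refine lintegral_mono fun y => ?_
        rw [enorm_mul]
        gcongr
        exact enorm_component_le _ _ _
    _ = ∫⁻ y, oseenMajorant t (x - y) * ‖F y‖ₑ := by
        simp_rw [oseenMajorant, Finset.sum_mul]
        rw [lintegral_finsetSum _ fun j _ => Finset.measurable_sum _ fun h _ =>
          Finset.measurable_sum _ fun k _ => hm j h k]
        refine Finset.sum_congr rfl fun j _ => ?_
        rw [lintegral_finsetSum _ fun h _ => Finset.measurable_sum _ fun k _ => hm j h k]
        refine Finset.sum_congr rfl fun h _ => ?_
        rw [lintegral_finsetSum _ fun k _ => hm j h k]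
    _ = _ := by
        rw [← lintegral_sub_left_eq_self _ x]
        simp

/-- The measure `κ(t - s, y) dy ds` on `(a, t) × ℝ³`, with `κ` the majorant of the Oseen kernel. -/
def oseenMeasure (a t : ℝ) : Measure (ℝ × E3) :=
  ((volume.restrict (Ioo a t)).prod volume).withDensity fun p => oseenMajorant (t - p.1) p.2

instance (a t : ℝ) : SFinite (oseenMeasure a t) := by unfold oseenMeasure; infer_instance

lemma lintegral_oseenMeasure (a t : ℝ) {G : ℝ × E3 → ℝ≥0∞} (hG : Measurable G) :
    ∫⁻ p, G p ∂(oseenMeasure a t) =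
      ∫⁻ s in Ioo a t, ∫⁻ y, oseenMajorant (t - s) y * G (s, y) := by
  have hm : Measurable fun p : ℝ × E3 => oseenMajorant (t - p.1) p.2 :=
    measurable_oseenMajorant (measurable_const.sub measurable_fst) measurable_snd
  rw [oseenMeasure, lintegral_withDensity_eq_lintegral_mul _ hm hG,
    lintegral_prod _ (hm.mul hG).aemeasurable]
  rfl

/-- The singularity `(t - s)^{-1/2}` contributes the square root of the length of a time interval,
wherever the interval lies before `t`. -/
lemma lintegral_Ioo_rpow {a t b : ℝ} (hab : a ≤ b) (hbt : b ≤ t) :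
    ∫⁻ s in Ioo a b, ENNReal.ofReal (oseenConst * (t - s) ^ (-(1 / 2) : ℝ)) ≤
      ENNReal.ofReal (2 * oseenConst * √(b - a)) := by
  have hint : IntervalIntegrable (fun s : ℝ => oseenConst * (t - s) ^ (-(1 / 2) : ℝ)) volume a b :=
    (by simpa using (intervalIntegral.intervalIntegrable_rpow' (a := t - a) (b := t - b)
      (by norm_num : (-1 : ℝ) < -(1 / 2))).comp_sub_left t :
      IntervalIntegrable (fun s : ℝ => (t - s) ^ (-(1 / 2) : ℝ)) volume a b).const_mul _
  have hnn : ∀ s ∈ Ioc a b, 0 ≤ oseenConst * (t - s) ^ (-(1 / 2) : ℝ) := fun s hs =>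
    mul_nonneg oseenConst_pos.le (Real.rpow_nonneg (by linarith [hs.2]) _)
  rw [restrict_Ioo_eq_restrict_Ioc, ← ofReal_integral_eq_lintegral_ofReal
    ((intervalIntegrable_iff_integrableOn_Ioc_of_le hab).1 hint)
    ((ae_restrict_mem measurableSet_Ioc).mono hnn), ← intervalIntegral.integral_of_le hab]
  refine ENNReal.ofReal_le_ofReal ?_
  rw [intervalIntegral.integral_const_mul,
    intervalIntegral.integral_comp_sub_left (fun s => s ^ (-(1 / 2) : ℝ)) t,
    integral_rpow (Or.inl (by norm_num))]
  have e : (-(1 / 2) : ℝ) + 1 = 1 / 2 := by norm_num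
  rw [e, ← Real.sqrt_eq_rpow, ← Real.sqrt_eq_rpow]
  -- subadditivity of the square root
  have h1 : √(t - a) ≤ √(t - b) + √(b - a) := by
    refine Real.sqrt_le_iff.2 ⟨by positivity, ?_⟩
    have h2 := Real.sq_sqrt (show 0 ≤ t - b by linarith)
    have h3 := Real.sq_sqrt (show 0 ≤ b - a by linarith)
    nlinarith [mul_nonneg (Real.sqrt_nonneg (t - b)) (Real.sqrt_nonneg (b - a))]
  have h4 := oseenConst_pos
  have h5 : oseenConst * (√(t - a) - √(t - b)) ≤ oseenConst * √(b - a) := by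
    gcongr; linarith
  calc _ = 2 * (oseenConst * (√(t - a) - √(t - b))) := by ring
    _ ≤ _ := by linarith

lemma oseenMeasure_univ_le {a t : ℝ} (hat : a ≤ t) :
    oseenMeasure a t univ ≤ ENNReal.ofReal (2 * oseenConst * √(t - a)) := by
  have h := lintegral_oseenMeasure a t (G := 1) measurable_const
  simp only [Pi.one_apply, lintegral_one, mul_one] at h
  rw [h]
  refine le_trans (setLIntegral_mono' measurableSet_Ioo fun s hs => ?_)
    (lintegral_Ioo_rpow hat le_rfl)
  exact lintegral_oseenMajorant_le (sub_pos.2 hs.2)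

/-- The majorant of the Duhamel integral over `(a, t)` of a tensor field of size `f`. -/
def duhamelMajorant (a t : ℝ) (f : ℝ → E3 → ℝ≥0∞) (x : E3) : ℝ≥0∞ :=
  ∫⁻ p, f p.1 (x - p.2) ∂(oseenMeasure a t)

lemma measurable_shift {f : ℝ → E3 → ℝ≥0∞} (hf : Measurable (Function.uncurry f)) :
    Measurable fun z : (ℝ × E3) × E3 => f z.1.1 (z.2 - z.1.2) :=
  hf.comp (((measurable_fst.comp measurable_fst)).prodMk
    (measurable_snd.sub (measurable_snd.comp measurable_fst)))

lemma duhamelMajorant_eq {f : ℝ → E3 → ℝ≥0∞} (hf : Measurable (Function.uncurry f)) (a t : ℝ)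
    (x : E3) : duhamelMajorant a t f x =
      ∫⁻ s in Ioo a t, ∫⁻ y, oseenMajorant (t - s) y * f s (x - y) :=
  lintegral_oseenMeasure a t
    (hf.comp (measurable_fst.prodMk (measurable_const.sub measurable_snd)) :
      Measurable fun p : ℝ × E3 => f p.1 (x - p.2))

lemma measurable_duhamelMajorant {f : ℝ → E3 → ℝ≥0∞} (hf : Measurable (Function.uncurry f))
    (a t : ℝ) : Measurable (duhamelMajorant a t f) :=
  (measurable_shift hf).lintegral_prod_left'

lemma duhamelMajorant_mono (a t : ℝ) {f g : ℝ → E3 → ℝ≥0∞} (h : ∀ s x, f s x ≤ g s x) (x : E3) :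
    duhamelMajorant a t f x ≤ duhamelMajorant a t g x :=
  lintegral_mono fun _ => h _ _

/-- The `Lᵖ` estimate of the Duhamel majorant. -/
lemma lintegral_duhamelMajorant_rpow_le {f : ℝ → E3 → ℝ≥0∞}
    (hf : Measurable (Function.uncurry f)) (a t : ℝ) {p : ℝ} (hp : 1 ≤ p) :
    ∫⁻ x, duhamelMajorant a t f x ^ p ≤ oseenMeasure a t univ ^ (p - 1) *
      ∫⁻ s in Ioo a t, ENNReal.ofReal (oseenConst * (t - s) ^ (-(1 / 2) : ℝ)) *
        ∫⁻ x, f s x ^ p := by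
  refine (lintegral_lintegral_rpow_le (measurable_shift hf) hp).trans ?_
  gcongr
  have hG : Measurable fun z : ℝ × E3 => ∫⁻ x, f z.1 (x - z.2) ^ p :=
    ((measurable_shift hf).pow_const p).lintegral_prod_right'
  rw [lintegral_oseenMeasure a t hG]
  refine setLIntegral_mono' measurableSet_Ioo fun s hs => ?_
  have e : ∀ y : E3, ∫⁻ x, f s (x - y) ^ p = ∫⁻ x, f s x ^ p := fun y =>
    lintegral_sub_right_eq_self (fun x => f s x ^ p) y
  simp_rw [e]
  rw [lintegral_mul_const]
  · gcongr
    exact lintegral_oseenMajorant_le (sub_pos.2 hs.2)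
  · exact measurable_oseenMajorant measurable_const measurable_id

lemma lintegral_duhamelMajorant_rpow_le_const {f : ℝ → E3 → ℝ≥0∞}
    (hf : Measurable (Function.uncurry f)) {a t : ℝ} (hat : a ≤ t) {p : ℝ} (hp : 1 ≤ p) {A : ℝ≥0∞}
    (hA : ∀ s ∈ Ioo a t, ∫⁻ x, f s x ^ p ≤ A) :
    ∫⁻ x, duhamelMajorant a t f x ^ p ≤
      ENNReal.ofReal (2 * oseenConst * √(t - a)) ^ p * A := by
  refine (lintegral_duhamelMajorant_rpow_le hf a t hp).trans ?_
  have h1 : ∫⁻ s in Ioo a t, ENNReal.ofReal (oseenConst * (t - s) ^ (-(1 / 2) : ℝ)) *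
        ∫⁻ x, f s x ^ p ≤ ENNReal.ofReal (2 * oseenConst * √(t - a)) * A := by
    refine (setLIntegral_mono' measurableSet_Ioo fun s hs =>
      (by gcongr; exact hA s hs : _ ≤
        ENNReal.ofReal (oseenConst * (t - s) ^ (-(1 / 2) : ℝ)) * A)).trans ?_
    rw [lintegral_mul_const _ (by fun_prop)]
    gcongr
    exact lintegral_Ioo_rpow hat le_rfl
  calc _ ≤ ENNReal.ofReal (2 * oseenConst * √(t - a)) ^ (p - 1) *
        (ENNReal.ofReal (2 * oseenConst * √(t - a)) * A) := by
        gcongr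
        exact oseenMeasure_univ_le hat
    _ = _ := by
        rw [← mul_assoc]
        congr 1
        nth_rw 2 [← ENNReal.rpow_one (ENNReal.ofReal (2 * oseenConst * √(t - a)))]
        rw [← ENNReal.rpow_add_of_nonneg _ _ (by linarith) zero_le_one]
        congr 1; ring

lemma duhamelMajorant_le_const {f : ℝ → E3 → ℝ≥0∞} {a t : ℝ} (hat : a ≤ t) {A : ℝ≥0∞}
    (hA : ∀ s x, f s x ≤ A) (x : E3) :
    duhamelMajorant a t f x ≤ ENNReal.ofReal (2 * oseenConst * √(t - a)) * A := by
  refine (lintegral_mono fun p => hA _ _).trans ?_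
  rw [lintegral_const, mul_comm]
  gcongr
  exact oseenMeasure_univ_le hat

lemma duhamelMajorant_congr {f g : ℝ → E3 → ℝ≥0∞} (hf : Measurable (Function.uncurry f))
    (hg : Measurable (Function.uncurry g)) {a t : ℝ} (h : ∀ s ∈ Ioo a t, f s =ᵐ[volume] g s)
    (x : E3) : duhamelMajorant a t f x = duhamelMajorant a t g x := by
  rw [duhamelMajorant_eq hf, duhamelMajorant_eq hg]
  refine setLIntegral_congr_fun measurableSet_Ioo fun s hs => lintegral_congr_ae ?_
  have h2 : ∀ᵐ y : E3, f s (x - y) = g s (x - y) :=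
    (Measure.measurePreserving_sub_left volume x).quasiMeasurePreserving.ae (h s hs)
  filter_upwards [h2] with y hy
  rw [hy]

/-! ### The Duhamel integral -/

/-- The Duhamel integral `∫₀ᵗ e^{(t-s)Δ} P ∇·F(s) ds`. -/
def duhamel (t : ℝ) (F : ℝ → E3 → Fin 3 → Fin 3 → ℝ) (x : E3) : E3 :=
  ∫ s in (0 : ℝ)..t, oseenTensor (t - s) (F s) x

lemma bilinear_eq_neg_duhamel (u v : ℝ → E3 → E3) (t : ℝ) (x : E3) :
    bilinear u v t x = -duhamel t (fun s y => tensor (u s y) (v s y)) x := rfl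

lemma oseenTensor_congr {F G : E3 → Fin 3 → Fin 3 → ℝ} (h : F =ᵐ[volume] G) (t : ℝ) (x : E3) :
    oseenTensor t F x = oseenTensor t G x := by
  unfold oseenTensor
  congr 1
  ext j
  refine Finset.sum_congr rfl fun i _ => Finset.sum_congr rfl fun k _ => integral_congr_ae ?_
  filter_upwards [h] with y hy
  rw [hy]

lemma duhamel_congr {F G : ℝ → E3 → Fin 3 → Fin 3 → ℝ} {t : ℝ} (ht : 0 ≤ t)
    (h : ∀ s ∈ Icc 0 t, F s =ᵐ[volume] G s) (x : E3) : duhamel t F x = duhamel t G x := by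
  unfold duhamel
  refine intervalIntegral.integral_congr fun s hs => ?_
  rw [uIcc_of_le ht] at hs
  exact oseenTensor_congr (h s hs) _ _

section Duhamel

variable {F G : ℝ → E3 → Fin 3 → Fin 3 → ℝ}

lemma measurable_component (hF : Measurable (Function.uncurry F)) (h k : Fin 3) :
    Measurable (Function.uncurry fun s y => F s y h k) :=
  (measurable_pi_apply k).comp ((measurable_pi_apply h).comp hF)

lemma measurable_oseenTensor (hF : Measurable (Function.uncurry F)) (t : ℝ) :
    Measurable fun q : ℝ × E3 => oseenTensor (t - q.1) (F q.1) q.2 := by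
  unfold oseenTensor
  refine (WithLp.measurable_toLp 2 _).comp (measurable_pi_lambda _ fun j =>
    Finset.measurable_sum _ fun h _ => Finset.measurable_sum _ fun k _ => ?_)
  have h1 : Measurable fun q : (ℝ × E3) × E3 =>
      oseenKernel j h k (t - q.1.1) (q.1.2 - q.2) * F q.1.1 q.2 h k :=
    (measurable_oseenKernel_comp j h k (measurable_const.sub measurable_fst.fst)
      (measurable_fst.snd.sub measurable_snd)).mul
      ((measurable_component hF h k).comp (measurable_fst.fst.prodMk measurable_snd))
  exact h1.stronglyMeasurable.integral_prod_right.measurable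

lemma measurable_duhamel (hF : Measurable (Function.uncurry F)) {t : ℝ} (ht : 0 ≤ t) :
    Measurable (duhamel t F) := by
  unfold duhamel
  simp_rw [intervalIntegral.integral_of_le ht]
  have h1 : Measurable fun q : E3 × ℝ => oseenTensor (t - q.2) (F q.2) q.1 := by
    simpa only [Function.comp_def, Prod.fst_swap, Prod.snd_swap] using
      (measurable_oseenTensor hF t).comp measurable_swap
  exact h1.stronglyMeasurable.integral_prod_right'.measurable

lemma measurable_enorm_field (hF : Measurable (Function.uncurry F)) :
    Measurable (Function.uncurry fun s y => ‖F s y‖ₑ) := hF.enorm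

lemma lintegral_enorm_oseenTensor_le (hF : Measurable (Function.uncurry F)) (t : ℝ) (x : E3) :
    ∫⁻ s in Ioo 0 t, ‖oseenTensor (t - s) (F s) x‖ₑ ≤
      duhamelMajorant 0 t (fun s y => ‖F s y‖ₑ) x := by
  rw [duhamelMajorant_eq (measurable_enorm_field hF)]
  exact lintegral_mono fun s =>
    enorm_oseenTensor_le (hF.comp (measurable_const.prodMk measurable_id)) _ _

/-- Valid at every point: where the majorant is infinite there is nothing to prove. -/
lemma enorm_duhamel_le (hF : Measurable (Function.uncurry F)) {t : ℝ} (ht : 0 ≤ t) (x : E3) :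
    ‖duhamel t F x‖ₑ ≤ duhamelMajorant 0 t (fun s y => ‖F s y‖ₑ) x := by
  refine le_trans ?_ (lintegral_enorm_oseenTensor_le hF t x)
  rw [duhamel, intervalIntegral.integral_of_le ht, ← restrict_Ioo_eq_restrict_Ioc]
  exact enorm_integral_le_lintegral_enorm _

lemma intervalIntegrable_oseenTensor (hF : Measurable (Function.uncurry F)) {t : ℝ} (ht : 0 ≤ t)
    {x : E3} (hx : duhamelMajorant 0 t (fun s y => ‖F s y‖ₑ) x ≠ ∞) :
    IntervalIntegrable (fun s => oseenTensor (t - s) (F s) x) volume 0 t := by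
  rw [intervalIntegrable_iff_integrableOn_Ioo_of_le ht]
  refine ⟨((measurable_oseenTensor hF t).comp
    (measurable_id.prodMk measurable_const)).aestronglyMeasurable, ?_⟩
  exact (lintegral_enorm_oseenTensor_le hF t x).trans_lt hx.lt_top

/-- Where the majorant is finite, the spatial integrals of the Duhamel integrand converge at almost
every time. -/
lemma ae_integrable_oseenKernel_mul (hF : Measurable (Function.uncurry F)) {t : ℝ}
    {x : E3} (hx : duhamelMajorant 0 t (fun s y => ‖F s y‖ₑ) x ≠ ∞) :
    ∀ᵐ s ∂(volume.restrict (Ioo 0 t)), ∀ j h k : Fin 3,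
      Integrable fun y => oseenKernel j h k (t - s) (x - y) * F s y h k := by
  rw [duhamelMajorant_eq (measurable_enorm_field hF)] at hx
  have hm₁ : Measurable fun q : ℝ × E3 => oseenMajorant (t - q.1) q.2 :=
    measurable_oseenMajorant (measurable_const.sub measurable_fst) measurable_snd
  have hm₂ : Measurable fun q : ℝ × E3 => ‖F q.1 (x - q.2)‖ₑ :=
    (hF.comp (measurable_fst.prodMk (measurable_const.sub measurable_snd))).enorm
  filter_upwards [ae_lt_top (hm₁.mul hm₂).lintegral_prod_right' hx] with s hs j h k
  have hk : Measurable fun y : E3 => oseenKernel j h k (t - s) (x - y) :=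
    measurable_oseenKernel_comp j h k measurable_const (measurable_const.sub measurable_id)
  have hFs : Measurable fun y : E3 => F s y h k :=
    (measurable_component hF h k).comp (measurable_const.prodMk measurable_id)
  refine ⟨(hk.mul hFs).aestronglyMeasurable, ?_⟩
  refine lt_of_le_of_lt ?_ hs
  rw [← lintegral_sub_left_eq_self _ x]
  refine lintegral_mono fun y => ?_
  simp only [sub_sub_cancel, enorm_mul]
  refine mul_le_mul' ?_ (enorm_component_le _ _ _)
  exact (Finset.single_le_sum (f := fun k => ‖oseenKernel j h k (t - s) y‖ₑ)
      (fun _ _ => zero_le) (Finset.mem_univ k)).trans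
      ((Finset.single_le_sum (f := fun h => ∑ k, ‖oseenKernel j h k (t - s) y‖ₑ)
      (fun _ _ => zero_le) (Finset.mem_univ h)).trans
      (Finset.single_le_sum (f := fun j => ∑ h, ∑ k, ‖oseenKernel j h k (t - s) y‖ₑ)
      (fun _ _ => zero_le) (Finset.mem_univ j)))

/-- Linearity of the Duhamel integral, which needs the convergence of all the integrals involved. -/
lemma duhamel_sub (hF : Measurable (Function.uncurry F)) (hG : Measurable (Function.uncurry G))
    {t : ℝ} (ht : 0 ≤ t) {x : E3} (hxF : duhamelMajorant 0 t (fun s y => ‖F s y‖ₑ) x ≠ ∞)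
    (hxG : duhamelMajorant 0 t (fun s y => ‖G s y‖ₑ) x ≠ ∞) :
    duhamel t F x - duhamel t G x = duhamel t (fun s y => F s y - G s y) x := by
  rw [duhamel, duhamel, duhamel, ← intervalIntegral.integral_sub
    (intervalIntegrable_oseenTensor hF ht hxF) (intervalIntegrable_oseenTensor hG ht hxG)]
  rw [intervalIntegral.integral_of_le ht, intervalIntegral.integral_of_le ht,
    ← restrict_Ioo_eq_restrict_Ioc]
  refine integral_congr_ae ?_
  filter_upwards [ae_integrable_oseenKernel_mul hF hxF, ae_integrable_oseenKernel_mul hG hxG]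
    with s h1 h2
  ext j
  simp only [oseenTensor, PiLp.sub_apply]
  simp_rw [← Finset.sum_sub_distrib]
  refine Finset.sum_congr rfl fun h _ => Finset.sum_congr rfl fun k _ => ?_
  rw [← integral_sub (h1 j h k) (h2 j h k)]
  simp only [Pi.sub_apply, mul_sub]

/-- The Duhamel majorant is almost everywhere finite if the field is bounded in some `Lᵖ`. -/
lemma ae_duhamelMajorant_lt_top {f : ℝ → E3 → ℝ≥0∞} (hf : Measurable (Function.uncurry f)) {t : ℝ}
    (ht : 0 ≤ t) {p : ℝ} (hp : 1 ≤ p) {A : ℝ≥0∞} (hA : A ≠ ∞)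
    (h : ∀ s ∈ Ioo 0 t, ∫⁻ x, f s x ^ p ≤ A) :
    ∀ᵐ x, duhamelMajorant 0 t f x ≠ ∞ := by
  have h1 := lintegral_duhamelMajorant_rpow_le_const hf ht hp h
  have h2 : ∫⁻ x, duhamelMajorant 0 t f x ^ p ≠ ∞ :=
    ne_top_of_le_ne_top (ENNReal.mul_ne_top (ENNReal.rpow_ne_top_of_nonneg (by linarith)
      ENNReal.ofReal_ne_top) hA) h1
  filter_upwards [ae_lt_top ((measurable_duhamelMajorant hf 0 t).pow_const p) h2] with x hx
  intro h3
  rw [h3, ENNReal.top_rpow_of_pos (by linarith)] at hx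
  exact lt_irrefl _ hx

end Duhamel

/-! ### Weak Lebesgue spaces and the endpoint estimate -/

section LayerCake

variable {X : Type*} [MeasurableSpace X] {μ : Measure X}

/-- The layer-cake formula with respect to the measure `f μ`. -/
lemma lintegral_mul_eq_lintegral_superlevel {f : X → ℝ≥0∞} (hf : Measurable f) {g : X → ℝ}
    (hg : Measurable g) (hg0 : 0 ≤ g) :
    ∫⁻ x, f x * ENNReal.ofReal (g x) ∂μ = ∫⁻ l in Ioi (0 : ℝ), ∫⁻ x in {x | l < g x}, f x ∂μ := by
  have h := lintegral_eq_lintegral_meas_lt (μ.withDensity f) (Eventually.of_forall hg0)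
    hg.aemeasurable
  rw [lintegral_withDensity_eq_lintegral_mul _ hf hg.ennreal_ofReal] at h
  simp only [Pi.mul_apply] at h
  rw [h]
  refine lintegral_congr fun l => ?_
  rw [withDensity_apply _ (measurableSet_lt measurable_const hg)]

/-- Product of a function in weak `L³` (in the form of a bound for its integrals over sets) and of a
function in `L³`: the result is in weak `L^{3/2}`. -/
lemma setLIntegral_mul_le_of_weak {f : X → ℝ≥0∞} (hf : Measurable f) {M : ℝ≥0∞}
    (hM : ∀ E, MeasurableSet E → μ E ≠ ∞ → ∫⁻ x in E, f x ∂μ ≤ M * μ E ^ (2 / 3 : ℝ))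
    {r : X → ℝ} (hr : Measurable r) (hr0 : 0 ≤ r) {ε : ℝ} (hε : 0 < ε)
    (hrε : ∫⁻ x, ENNReal.ofReal (r x) ^ (3 : ℝ) ∂μ ≤ ENNReal.ofReal ε ^ (3 : ℝ))
    {E : Set X} (hE : MeasurableSet E) (hEf : μ E ≠ ∞) :
    ∫⁻ x in E, f x * ENNReal.ofReal (r x) ∂μ ≤ ENNReal.ofReal (2 * ε) * M * μ E ^ (1 / 3 : ℝ) := by
  rcases eq_or_ne (μ E) 0 with h0 | h0
  · rw [setLIntegral_measure_zero _ _ h0]; exact zero_le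
  obtain ⟨e, he, heE⟩ : ∃ e : ℝ, 0 < e ∧ μ E = ENNReal.ofReal e :=
    ⟨(μ E).toReal, ENNReal.toReal_pos h0 hEf, (ENNReal.ofReal_toReal hEf).symm⟩
  -- the level at which the two bounds of the superlevel sets balance
  set l₀ := ε * e ^ (-(1 / 3) : ℝ) with hl₀
  have hl₀p : 0 < l₀ := by positivity
  have hlevel : ∀ l : ℝ, ∫⁻ x in {x | l < r x}, f x ∂(μ.restrict E) ≤
      M * μ (E ∩ {x | l < r x}) ^ (2 / 3 : ℝ) := fun l => by
    have hms : MeasurableSet {x | l < r x} := measurableSet_lt measurable_const hr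
    rw [Measure.restrict_restrict hms, inter_comm]
    exact hM _ (hE.inter hms) (ne_top_of_le_ne_top hEf (measure_mono inter_subset_left))
  have hcheb : ∀ l : ℝ, 0 < l → μ (E ∩ {x | l < r x}) ^ (2 / 3 : ℝ) ≤
      ENNReal.ofReal (ε ^ 2) * ENNReal.ofReal (l ^ (-2 : ℝ)) := fun l hl => by
    have h1 : ENNReal.ofReal l ^ (3 : ℝ) * μ (E ∩ {x | l < r x}) ≤ ENNReal.ofReal ε ^ (3 : ℝ) := by
      refine le_trans ?_ hrε
      refine le_trans ?_ (mul_meas_ge_le_lintegral (hr.ennreal_ofReal.pow_const (3 : ℝ))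
        (ENNReal.ofReal l ^ (3 : ℝ)))
      gcongr
      rintro x ⟨-, hx⟩
      exact ENNReal.rpow_le_rpow (ENNReal.ofReal_le_ofReal (le_of_lt hx)) (by norm_num)
    have h2 : μ (E ∩ {x | l < r x}) ≤ ENNReal.ofReal ((ε / l) ^ (3 : ℝ)) := by
      rw [← ENNReal.ofReal_rpow_of_pos (by positivity), ENNReal.ofReal_div_of_pos hl,
        ENNReal.div_rpow_of_nonneg _ _ (by norm_num)]
      rw [ENNReal.le_div_iff_mul_le (Or.inl (by simp [hl])) (Or.inl (by simp))]
      rwa [mul_comm]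
    calc _ ≤ ENNReal.ofReal ((ε / l) ^ (3 : ℝ)) ^ (2 / 3 : ℝ) := by gcongr
      _ = _ := by
        rw [ENNReal.ofReal_rpow_of_pos (by positivity), ← ENNReal.ofReal_mul (by positivity),
          ← Real.rpow_mul (by positivity), Real.rpow_neg hl.le]
        norm_num
        rw [div_pow, div_eq_mul_inv]
  rw [lintegral_mul_eq_lintegral_superlevel hf hr hr0, ← Ioc_union_Ioi_eq_Ioi hl₀p.le]
  refine (lintegral_union_le _ _ _).trans ?_
  have hA : ∫⁻ l in Ioc 0 l₀, ∫⁻ x in {x | l < r x}, f x ∂(μ.restrict E) ≤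
      ENNReal.ofReal (ε * e ^ (1 / 3 : ℝ)) * M := by
    calc _ ≤ ∫⁻ _l in Ioc 0 l₀, M * ENNReal.ofReal (e ^ (2 / 3 : ℝ)) := by
          refine lintegral_mono fun l => (hlevel l).trans ?_
          gcongr
          rw [← ENNReal.ofReal_rpow_of_pos he, ← heE]
          gcongr
          exact inter_subset_left
      _ = _ := by
          rw [lintegral_const, Measure.restrict_apply_univ, Real.volume_Ioc, sub_zero, mul_comm,
            mul_comm M, ← mul_assoc, ← ENNReal.ofReal_mul (by positivity), hl₀, mul_assoc,
            ← Real.rpow_add he]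
          norm_num
  have hB : ∫⁻ l in Ioi l₀, ∫⁻ x in {x | l < r x}, f x ∂(μ.restrict E) ≤
      ENNReal.ofReal (ε * e ^ (1 / 3 : ℝ)) * M := by
    calc _ ≤ ∫⁻ l in Ioi l₀, M * ENNReal.ofReal (ε ^ 2) * ENNReal.ofReal (l ^ (-2 : ℝ)) := by
          refine setLIntegral_mono' measurableSet_Ioi fun l hl => (hlevel l).trans ?_
          rw [mul_assoc]
          gcongr
          exact hcheb l (hl₀p.trans hl)
      _ = _ := by
          rw [lintegral_const_mul _ (by fun_prop), lintegral_Ioi_rpow (by norm_num) hl₀p, mul_assoc,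
            ← ENNReal.ofReal_mul (by positivity), mul_comm]
          congr 2
          have : (-2 : ℝ) + 1 = -1 := by norm_num
          rw [this, hl₀, Real.rpow_neg_one, mul_inv, ← Real.rpow_neg he.le]
          norm_num
          field_simp
  refine (add_le_add hA hB).trans_eq ?_
  rw [← two_mul, heE, ENNReal.ofReal_rpow_of_pos he, ENNReal.ofReal_mul zero_le_two,
    ENNReal.ofReal_mul hε.le]
  simp only [ENNReal.ofReal_ofNat]
  ring

/-- Duality between weak `L^{3/2}` and `L¹ ∩ L^∞`. -/
lemma lintegral_mul_le_of_weak {f : X → ℝ≥0∞} (hf : Measurable f) {K : ℝ≥0∞}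
    (hK : ∀ E, MeasurableSet E → μ E ≠ ∞ → ∫⁻ x in E, f x ∂μ ≤ K * μ E ^ (1 / 3 : ℝ))
    {g : X → ℝ≥0∞} (hg : Measurable g) {A B : ℝ} (hA : 0 < A) (hB : 0 < B)
    (hgB : ∀ x, g x ≤ ENNReal.ofReal B) (hgA : ∫⁻ x, g x ∂μ ≤ ENNReal.ofReal A) :
    ∫⁻ x, f x * g x ∂μ ≤
      ENNReal.ofReal (3 / 2 * (A ^ (1 / 3 : ℝ) * B ^ (2 / 3 : ℝ))) * K := by
  have hgt : ∀ x, ENNReal.ofReal (g x).toReal = g x := fun x =>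
    ENNReal.ofReal_toReal (ne_top_of_le_ne_top ENNReal.ofReal_ne_top (hgB x))
  have hgr : Measurable fun x => (g x).toReal := hg.ennreal_toReal
  have h := lintegral_mul_eq_lintegral_superlevel (μ := μ) hf hgr fun x => ENNReal.toReal_nonneg
  simp_rw [hgt] at h
  rw [h, ← Ioc_union_Ioi_eq_Ioi hB.le]
  refine (lintegral_union_le _ _ _).trans ?_
  have h2 : ∫⁻ l in Ioi B, ∫⁻ x in {x | l < (g x).toReal}, f x ∂μ = 0 := by
    rw [setLIntegral_congr_fun (g := 0) measurableSet_Ioi, Pi.zero_def, lintegral_zero]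
    intro l hl
    have : {x | l < (g x).toReal} = ∅ := by
      ext x
      simp only [mem_ofPred_eq, mem_empty_iff_false, iff_false, not_lt]
      exact (ENNReal.toReal_le_of_le_ofReal hB.le (hgB x)).trans (le_of_lt hl)
    simp [this]
  rw [h2, add_zero]
  have hint : IntervalIntegrable (fun l : ℝ => l ^ (-(1 / 3) : ℝ)) volume 0 B :=
    intervalIntegral.intervalIntegrable_rpow' (by norm_num)
  calc _ ≤ ∫⁻ l in Ioc 0 B, K * ENNReal.ofReal (A ^ (1 / 3 : ℝ)) *
        ENNReal.ofReal (l ^ (-(1 / 3) : ℝ)) := by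
        refine setLIntegral_mono' measurableSet_Ioc fun l hl => ?_
        have h1 : μ {x | l < (g x).toReal} ≤ ENNReal.ofReal (A / l) := by
          rw [ENNReal.ofReal_div_of_pos hl.1, ENNReal.le_div_iff_mul_le (Or.inl (by simp [hl.1]))
            (Or.inl (by simp)), mul_comm]
          refine le_trans ?_ hgA
          refine le_trans ?_ (mul_meas_ge_le_lintegral hg (ENNReal.ofReal l))
          gcongr with x
          intro hx
          rw [← hgt x]
          exact ENNReal.ofReal_le_ofReal (le_of_lt hx)
        refine (hK _ (measurableSet_lt measurable_const hgr)
          (ne_top_of_le_ne_top ENNReal.ofReal_ne_top h1)).trans ?_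
        rw [mul_assoc]
        gcongr
        calc _ ≤ ENNReal.ofReal (A / l) ^ (1 / 3 : ℝ) := by gcongr
          _ = _ := by
            rw [ENNReal.ofReal_rpow_of_pos (div_pos hA hl.1), ← ENNReal.ofReal_mul (by positivity),
              Real.div_rpow hA.le hl.1.le, Real.rpow_neg hl.1.le, div_eq_mul_inv]
    _ = _ := by
        rw [lintegral_const_mul _ (by fun_prop), ← ofReal_integral_eq_lintegral_ofReal
          ((intervalIntegrable_iff_integrableOn_Ioc_of_le hB.le).1 hint)
          ((ae_restrict_mem measurableSet_Ioc).mono fun l hl => Real.rpow_nonneg hl.1.le _),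
          ← intervalIntegral.integral_of_le hB.le, integral_rpow (Or.inl (by norm_num)), mul_assoc,
          ← ENNReal.ofReal_mul (by positivity), mul_comm]
        congr 2
        norm_num
        ring

end LayerCake

lemma setLIntegral_shift {f : E3 → ℝ≥0∞} {E : Set E3} (hE : MeasurableSet E)
    (y : E3) : ∫⁻ x in E, f (x - y) = ∫⁻ x in (· + y) ⁻¹' E, f x := by
  have hE' : MeasurableSet ((· + y) ⁻¹' E) := (measurable_id.add_const y) hE
  rw [← lintegral_indicator hE, ← lintegral_indicator hE',
    ← lintegral_sub_right_eq_self (indicator ((· + y) ⁻¹' E) f) y]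
  refine lintegral_congr fun x => ?_
  have h : x - y ∈ (· + y) ⁻¹' E ↔ x ∈ E := by rw [mem_preimage, sub_add_cancel]
  by_cases hx : x ∈ E
  · rw [indicator_of_mem hx, indicator_of_mem (h.2 hx)]
  · rw [indicator_of_notMem hx, indicator_of_notMem (mt h.1 hx)]

lemma setLIntegral_duhamelMajorant {f : ℝ → E3 → ℝ≥0∞} (hf : Measurable (Function.uncurry f))
    (a t : ℝ) (E : Set E3) : ∫⁻ x in E, duhamelMajorant a t f x =
      ∫⁻ s in Ioo a t, ∫⁻ y, oseenMajorant (t - s) y * ∫⁻ x in E, f s (x - y) := by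
  unfold duhamelMajorant
  rw [lintegral_lintegral_swap]
  · refine lintegral_oseenMeasure a t ?_
    exact (measurable_shift hf).lintegral_prod_right'
  · exact ((measurable_shift hf).comp measurable_swap).aemeasurable

/-- Convolution with the Oseen kernel preserves weak Lebesgue spaces, in the form of bounds for the
integrals over sets: the bound `K |E| ^ θ` is invariant under translations of `E`. -/
lemma lintegral_oseenMajorant_mul_le {f : E3 → ℝ≥0∞} {τ : ℝ} (hτ : 0 < τ) {E : Set E3}
    (hE : MeasurableSet E) (hEf : volume E ≠ ∞) {K : ℝ≥0∞} {θ : ℝ}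
    (hK : ∀ E : Set E3, MeasurableSet E → volume E ≠ ∞ → ∫⁻ x in E, f x ≤ K * volume E ^ θ) :
    ∫⁻ y, oseenMajorant τ y * ∫⁻ x in E, f (x - y) ≤
      ENNReal.ofReal (oseenConst * τ ^ (-(1 / 2) : ℝ)) * (K * volume E ^ θ) := by
  refine le_trans (lintegral_mono fun y => ?_) (le_trans (lintegral_mul_const _
    (measurable_oseenMajorant measurable_const measurable_id')).le
    (mul_le_mul_left (lintegral_oseenMajorant_le hτ) _))
  gcongr
  rw [setLIntegral_shift hE]
  have hv : volume ((· + y) ⁻¹' E) = volume E := measure_preimage_add_right volume y E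
  have := hK _ ((measurable_id'.add_const y) hE) (by rw [hv]; exact hEf)
  rwa [hv] at this

/-- Integrals of a Duhamel majorant over a set, if the integrals of the field over the translates of
the set are bounded. -/
lemma setLIntegral_duhamelMajorant_le {f : ℝ → E3 → ℝ≥0∞} (hf : Measurable (Function.uncurry f))
    {a t : ℝ} (hat : a ≤ t) {E : Set E3} (hE : MeasurableSet E) (hEf : volume E ≠ ∞) {K : ℝ≥0∞}
    {θ : ℝ} (hK : ∀ s ∈ Ioo a t, ∀ E : Set E3, MeasurableSet E → volume E ≠ ∞ →
      ∫⁻ x in E, f s x ≤ K * volume E ^ θ) :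
    ∫⁻ x in E, duhamelMajorant a t f x ≤
      ENNReal.ofReal (2 * oseenConst * √(t - a)) * (K * volume E ^ θ) := by
  rw [setLIntegral_duhamelMajorant hf]
  refine (setLIntegral_mono' measurableSet_Ioo fun s hs =>
    lintegral_oseenMajorant_mul_le (sub_pos.2 hs.2) hE hEf (hK s hs)).trans ?_
  rw [lintegral_mul_const _ (by fun_prop)]
  gcongr
  exact lintegral_Ioo_rpow hat le_rfl

lemma lintegral_Iic_rpow {L : ℝ} (hL : 0 < L) (t : ℝ) :
    ∫⁻ s in Iic (t - L), ENNReal.ofReal ((t - s) ^ (-(3 / 2) : ℝ)) =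
      ENNReal.ofReal (2 * L ^ (-(1 / 2) : ℝ)) := by
  have h1 : ∫⁻ σ in Ici L, ENNReal.ofReal (σ ^ (-(3 / 2) : ℝ)) =
      ENNReal.ofReal (2 * L ^ (-(1 / 2) : ℝ)) := by
    rw [setLIntegral_congr Ioi_ae_eq_Ici.symm, lintegral_Ioi_rpow (by norm_num) hL]
    rw [show (-(3 / 2) : ℝ) + 1 = -(1 / 2) by norm_num]
    congr 1; ring
  rw [← h1, ← lintegral_indicator measurableSet_Ici, ← lintegral_indicator measurableSet_Iic,
    ← lintegral_sub_left_eq_self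
      (indicator (Ici L) fun σ => ENNReal.ofReal (σ ^ (-(3 / 2) : ℝ))) t]
  refine lintegral_congr fun s => ?_
  have h : s ∈ Iic (t - L) ↔ t - s ∈ Ici L := by
    simp only [mem_Iic, mem_Ici]; constructor <;> intro <;> linarith
  simp only [indicator, h]

/-- The endpoint estimate of the bilinear operator: the Duhamel integral of a field bounded in time
with values in weak `L^{3/2}` is bounded with values in weak `L³`. The times at distance less than
`|E|^{2/3}` of `t` are estimated by the `L¹` norm of the kernel, the others by the duality of weak
`L^{3/2}` and `L^{3,1}`; both time integrals converge. -/
lemma setLIntegral_duhamelMajorant_le_weak {f : ℝ → E3 → ℝ≥0∞}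
    (hf : Measurable (Function.uncurry f)) {a t : ℝ} {E : Set E3} (hE : MeasurableSet E)
    (hEf : volume E ≠ ∞) {K : ℝ≥0∞}
    (hK : ∀ s ∈ Ioo a t, ∀ E : Set E3, MeasurableSet E → volume E ≠ ∞ →
      ∫⁻ x in E, f s x ≤ K * volume E ^ (1 / 3 : ℝ)) :
    ∫⁻ x in E, duhamelMajorant a t f x ≤
      ENNReal.ofReal (5 * oseenConst) * K * volume E ^ (2 / 3 : ℝ) := by
  have hC := oseenConst_pos
  rcases eq_or_ne (volume E) 0 with h0 | h0
  · rw [setLIntegral_measure_zero _ _ h0]; exact zero_le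
  obtain ⟨e, he, heE⟩ : ∃ e : ℝ, 0 < e ∧ volume E = ENNReal.ofReal e :=
    ⟨(volume E).toReal, ENNReal.toReal_pos h0 hEf, (ENNReal.ofReal_toReal hEf).symm⟩
  set L := e ^ (2 / 3 : ℝ) with hL
  have hLp : 0 < L := by positivity
  rw [setLIntegral_duhamelMajorant hf]
  set Φ : ℝ → ℝ≥0∞ := fun s => ∫⁻ y, oseenMajorant (t - s) y * ∫⁻ x in E, f s (x - y) with hΦ
  have hi : ∀ s ∈ Ioo a t, Φ s ≤ ENNReal.ofReal (oseenConst * (t - s) ^ (-(1 / 2) : ℝ)) *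
      (K * volume E ^ (1 / 3 : ℝ)) := fun s hs =>
    lintegral_oseenMajorant_mul_le (sub_pos.2 hs.2) hE hEf (hK s hs)
  have hii : ∀ s ∈ Ioo a t, Φ s ≤ ENNReal.ofReal ((t - s) ^ (-(3 / 2) : ℝ)) *
      (ENNReal.ofReal (3 / 2 * oseenConst) * K * volume E) := fun s hs => by
    have hτ := sub_pos.2 hs.2
    have hfs : Measurable (f s) := hf.comp (measurable_const.prodMk measurable_id')
    have hκ : Measurable fun q : E3 × E3 => oseenMajorant (t - s) q.2 :=
      measurable_oseenMajorant measurable_const measurable_snd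
    have hsw : Φ s = ∫⁻ x in E, ∫⁻ y, oseenMajorant (t - s) y * f s (x - y) := by
      rw [lintegral_lintegral_swap
        (hκ.mul (hfs.comp (measurable_fst.sub measurable_snd))).aemeasurable]
      refine lintegral_congr fun y => ?_
      have hfy : Measurable fun x => f s (x - y) := hfs.comp (measurable_id'.sub_const y)
      rw [lintegral_const_mul _ hfy]
    have hin : ∀ x, ∫⁻ y, oseenMajorant (t - s) y * f s (x - y) ≤
        ENNReal.ofReal ((t - s) ^ (-(3 / 2) : ℝ)) * (ENNReal.ofReal (3 / 2 * oseenConst) * K) := by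
      intro x
      rw [← lintegral_sub_left_eq_self _ x]
      simp only [sub_sub_cancel]
      have h1 := lintegral_mul_le_of_weak hfs (hK s hs)
        (g := fun y => oseenMajorant (t - s) (x - y))
        (measurable_oseenMajorant measurable_const (measurable_const.sub measurable_id'))
        (A := oseenConst * (t - s) ^ (-(1 / 2) : ℝ)) (B := oseenConst * (t - s) ^ (-2 : ℝ))
        (by positivity) (by positivity) (fun y => oseenMajorant_le hτ _)
        (by rw [lintegral_sub_left_eq_self (fun y => oseenMajorant (t - s) y) x]
            exact lintegral_oseenMajorant_le hτ)
      simp_rw [mul_comm (oseenMajorant _ _)]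
      refine h1.trans_eq ?_
      rw [← mul_assoc (ENNReal.ofReal _), ← ENNReal.ofReal_mul (by positivity)]
      congr 2
      rw [Real.mul_rpow hC.le (by positivity), Real.mul_rpow hC.le (by positivity),
        ← Real.rpow_mul hτ.le, ← Real.rpow_mul hτ.le]
      have h2 : oseenConst ^ (1 / 3 : ℝ) * oseenConst ^ (2 / 3 : ℝ) = oseenConst := by
        rw [← Real.rpow_add hC]; norm_num
      have h3 : (t - s) ^ (-(1 / 2) * (1 / 3) : ℝ) * (t - s) ^ (-2 * (2 / 3) : ℝ) =
          (t - s) ^ (-(3 / 2) : ℝ) := by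
        rw [← Real.rpow_add hτ]; norm_num
      rw [← h3]
      nth_rw 3 [← h2]
      ring
    rw [hsw]
    refine (lintegral_mono hin).trans_eq ?_
    rw [lintegral_const, Measure.restrict_apply_univ]
    ring
  have hsub : Ioo a t ⊆ (Ioo a t ∩ Ioo (t - L) t) ∪ (Ioo a t ∩ Iic (t - L)) := fun s hs => by
    rcases lt_or_ge (t - L) s with h | h
    · exact Or.inl ⟨hs, h, hs.2⟩
    · exact Or.inr ⟨hs, h⟩
  refine (lintegral_mono_set hsub).trans ((lintegral_union_le _ _ _).trans ?_)
  have hA : ∫⁻ s in Ioo a t ∩ Ioo (t - L) t, Φ s ≤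
      ENNReal.ofReal (2 * oseenConst * √L) * (K * volume E ^ (1 / 3 : ℝ)) := by
    refine (setLIntegral_mono' (measurableSet_Ioo.inter measurableSet_Ioo)
      fun s hs => hi s hs.1).trans ((lintegral_mono_set inter_subset_right).trans ?_)
    rw [lintegral_mul_const _ (by fun_prop)]
    gcongr
    have := lintegral_Ioo_rpow (a := t - L) (b := t) (t := t) (by linarith) le_rfl
    rwa [sub_sub_cancel] at this
  have hB : ∫⁻ s in Ioo a t ∩ Iic (t - L), Φ s ≤ ENNReal.ofReal (2 * L ^ (-(1 / 2) : ℝ)) *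
      (ENNReal.ofReal (3 / 2 * oseenConst) * K * volume E) := by
    refine (setLIntegral_mono' (measurableSet_Ioo.inter measurableSet_Iic)
      fun s hs => hii s hs.1).trans ((lintegral_mono_set inter_subset_right).trans ?_)
    rw [lintegral_mul_const _ (by fun_prop), lintegral_Iic_rpow hLp]
  refine (add_le_add hA hB).trans_eq ?_
  have h13 : √L * e ^ (1 / 3 : ℝ) = L := by
    rw [hL, Real.sqrt_eq_rpow, ← Real.rpow_mul he.le, ← Real.rpow_add he]; norm_num
  have h23 : L ^ (-(1 / 2) : ℝ) * e = L := by
    rw [hL, ← Real.rpow_mul he.le]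
    nth_rw 2 [← Real.rpow_one e]
    rw [← Real.rpow_add he]; norm_num
  have e1 : ENNReal.ofReal (2 * oseenConst * √L) * (K * volume E ^ (1 / 3 : ℝ)) =
      ENNReal.ofReal (2 * oseenConst * L) * K := by
    rw [heE, ENNReal.ofReal_rpow_of_pos he, mul_comm K, ← mul_assoc,
      ← ENNReal.ofReal_mul (by positivity), mul_assoc (2 * oseenConst), h13]
  have e2 : ENNReal.ofReal (2 * L ^ (-(1 / 2) : ℝ)) *
      (ENNReal.ofReal (3 / 2 * oseenConst) * K * volume E) =
      ENNReal.ofReal (3 * oseenConst * L) * K := by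
    have : 3 * oseenConst * L = 2 * L ^ (-(1 / 2) : ℝ) * (3 / 2 * oseenConst) * e := by
      nth_rw 1 [← h23]; ring
    rw [this, ENNReal.ofReal_mul (q := e) (by positivity),
      ENNReal.ofReal_mul (q := 3 / 2 * oseenConst) (by positivity), heE]
    ring
  rw [e1, e2, ← add_mul, ← ENNReal.ofReal_add (by positivity) (by positivity), heE,
    ENNReal.ofReal_rpow_of_pos he, mul_right_comm (ENNReal.ofReal (5 * oseenConst)) K,
    ← ENNReal.ofReal_mul (by positivity)]
  congr 2
  ring

/-! ### Contraction in weak Lebesgue spaces -/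

/-- The contraction argument behind uniqueness: a field that is controlled by the Duhamel majorant
of its product with a bounded function plus a function small in `L³` vanishes on a short time
interval. Each use of the hypothesis halves the bound in weak `L³`. -/
lemma ae_eq_zero_of_le_duhamelMajorant {x y : ℝ} {W : ℝ → E3 → ℝ≥0∞}
    (hW : Measurable (Function.uncurry W)) {r : ℝ → E3 → ℝ} (hr : Measurable (Function.uncurry r))
    (hr0 : ∀ s z, 0 ≤ r s z) {B ε : ℝ} (hB : 0 ≤ B) (hε : 0 < ε)
    (hrε : ∀ s ∈ Ioc x y, ∫⁻ z, ENNReal.ofReal (r s z) ^ (3 : ℝ) ≤ ENNReal.ofReal ε ^ (3 : ℝ))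
    (hmaj : ∀ t ∈ Ioc x y, ∀ᵐ z, W t z ≤
      duhamelMajorant x t (fun s z => (ENNReal.ofReal B + ENNReal.ofReal (r s z)) * W s z) z)
    {M : ℝ≥0∞} (hM : M ≠ ∞) (hbase : ∀ t ∈ Ioc x y, ∀ E : Set E3, MeasurableSet E →
      volume E ≠ ∞ → ∫⁻ z in E, W t z ≤ M * volume E ^ (2 / 3 : ℝ))
    (hsmall : 2 * oseenConst * √(y - x) * B + 5 * oseenConst * (2 * ε) ≤ 1 / 2) :
    ∀ t ∈ Ioc x y, W t =ᵐ[volume] 0 := by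
  have hC := oseenConst_pos
  have hWs : ∀ s, Measurable (W s) := fun s => hW.comp (measurable_const.prodMk measurable_id')
  have hrs : ∀ s, Measurable (r s) := fun s => hr.comp (measurable_const.prodMk measurable_id')
  have hstep : ∀ n : ℕ, ∀ t ∈ Ioc x y, ∀ E : Set E3, MeasurableSet E → volume E ≠ ∞ →
      ∫⁻ z in E, W t z ≤ ENNReal.ofReal ((1 / 2) ^ n) * M * volume E ^ (2 / 3 : ℝ) := by
    intro n
    induction n with
    | zero => simpa using hbase
    | succ n ih =>
      intro t ht E hE hEf
      set N := ENNReal.ofReal ((1 / 2) ^ n) * M with hN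
      have hm1 : Measurable (Function.uncurry fun s z => ENNReal.ofReal B * W s z) :=
        measurable_const.mul hW
      have hm2 : Measurable (Function.uncurry fun s z => W s z * ENNReal.ofReal (r s z)) :=
        hW.mul hr.ennreal_ofReal
      have hsplit : ∀ z, duhamelMajorant x t
          (fun s z => (ENNReal.ofReal B + ENNReal.ofReal (r s z)) * W s z) z =
          duhamelMajorant x t (fun s z => ENNReal.ofReal B * W s z) z +
          duhamelMajorant x t (fun s z => W s z * ENNReal.ofReal (r s z)) z := fun z => by
        unfold duhamelMajorant
        rw [← lintegral_add_left]
        · refine lintegral_congr fun p => ?_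
          ring
        · exact hm1.comp (measurable_fst.prodMk (measurable_const.sub measurable_snd))
      have hI1 := setLIntegral_duhamelMajorant_le hm1 (a := x) (t := t) ht.1.le hE hEf
        (K := ENNReal.ofReal B * N) (θ := 2 / 3) (fun s hs E hE hEf => by
          rw [lintegral_const_mul _ (hWs s), mul_assoc]
          gcongr
          exact ih s ⟨hs.1, hs.2.le.trans ht.2⟩ E hE hEf)
      have hI2 := setLIntegral_duhamelMajorant_le_weak hm2 (a := x) (t := t) hE hEf
        (K := ENNReal.ofReal (2 * ε) * N) (fun s hs E hE hEf =>
          setLIntegral_mul_le_of_weak (hWs s) (ih s ⟨hs.1, hs.2.le.trans ht.2⟩) (hrs s)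
            (hr0 s) hε (hrε s ⟨hs.1, hs.2.le.trans ht.2⟩) hE hEf)
      calc ∫⁻ z in E, W t z
          ≤ ∫⁻ z in E, (duhamelMajorant x t (fun s z => ENNReal.ofReal B * W s z) z +
              duhamelMajorant x t (fun s z => W s z * ENNReal.ofReal (r s z)) z) := by
            refine lintegral_mono_ae (ae_restrict_of_ae ((hmaj t ht).mono fun z hz => ?_))
            rwa [hsplit z] at hz
        _ ≤ ENNReal.ofReal (2 * oseenConst * √(t - x)) *
              (ENNReal.ofReal B * N * volume E ^ (2 / 3 : ℝ)) +
            ENNReal.ofReal (5 * oseenConst) * (ENNReal.ofReal (2 * ε) * N) *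
              volume E ^ (2 / 3 : ℝ) := by
            rw [lintegral_add_left (measurable_duhamelMajorant hm1 x t)]
            exact add_le_add hI1 hI2
        _ = ENNReal.ofReal (2 * oseenConst * √(t - x) * B + 5 * oseenConst * (2 * ε)) * N *
              volume E ^ (2 / 3 : ℝ) := by
            rw [ENNReal.ofReal_add (by positivity) (by positivity),
              ENNReal.ofReal_mul (q := B) (by positivity),
              ENNReal.ofReal_mul (p := 5 * oseenConst) (by positivity)]
            ring
        _ ≤ ENNReal.ofReal (1 / 2) * N * volume E ^ (2 / 3 : ℝ) := by
            gcongr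
            refine le_trans ?_ hsmall
            have := ht.2
            gcongr
        _ = _ := by
            rw [hN, ← mul_assoc, ← ENNReal.ofReal_mul (by positivity), pow_succ,
              mul_comm (1 / 2 : ℝ)]
  intro t ht
  have hzero : ∀ E : Set E3, MeasurableSet E → volume E ≠ ∞ → ∫⁻ z in E, W t z = 0 := by
    intro E hE hEf
    have hlim : Tendsto (fun n : ℕ => ENNReal.ofReal ((1 / 2) ^ n) * (M * volume E ^ (2 / 3 : ℝ)))
        atTop (𝓝 0) := by
      have h1 : Tendsto (fun n : ℕ => ENNReal.ofReal ((1 / 2) ^ n)) atTop (𝓝 0) := by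
        rw [← ENNReal.ofReal_zero]
        exact ENNReal.tendsto_ofReal
          (tendsto_pow_atTop_nhds_zero_of_lt_one (by norm_num) (by norm_num))
      have h2 := ENNReal.Tendsto.mul_const h1 (b := M * volume E ^ (2 / 3 : ℝ))
        (Or.inr (ENNReal.mul_ne_top hM (ENNReal.rpow_ne_top_of_nonneg (by norm_num) hEf)))
      simpa using h2
    refine le_antisymm (ge_of_tendsto' hlim fun n => ?_) zero_le
    rw [← mul_assoc]
    exact hstep n t ht E hE hEf
  have hcov : ∀ n : ℕ, ∀ᵐ z ∂(volume.restrict (Metric.ball (0 : E3) n)), W t z = 0 := fun n =>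
    (lintegral_eq_zero_iff (hWs t)).1
      (hzero _ Metric.isOpen_ball.measurableSet measure_ball_lt_top.ne)
  have := (ae_restrict_iUnion_iff (fun n : ℕ => Metric.ball (0 : E3) n) (fun z => W t z = 0)).2 hcov
  rw [Metric.iUnion_ball_nat, Measure.restrict_univ] at this
  exact this

lemma lintegral_enorm_rpow_three {E : Type*} [NormedAddCommGroup E] (f : E3 → E) :
    ∫⁻ x, ‖f x‖ₑ ^ (3 : ℝ) = eLpNorm f 3 volume ^ (3 : ℝ) := by
  rw [eLpNorm_eq_lintegral_rpow_enorm_toReal (by norm_num) (by norm_num), ENNReal.toReal_ofNat,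
    ← ENNReal.rpow_mul]
  norm_num

lemma enorm_tensor_le (v w : E3) : ‖tensor v w‖ₑ ≤ ‖v‖ₑ * ‖w‖ₑ := by
  rw [← ofReal_norm, ← ofReal_norm, ← ofReal_norm, ← ENNReal.ofReal_mul (norm_nonneg _)]
  refine ENNReal.ofReal_le_ofReal ?_
  refine (pi_norm_le_iff_of_nonneg (by positivity)).2 fun h =>
    (pi_norm_le_iff_of_nonneg (by positivity)).2 fun k => ?_
  rw [tensor, norm_mul]
  gcongr <;> exact PiLp.norm_apply_le _ _

lemma enorm_tensor_sub_le (v w : E3) :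
    ‖tensor v v - tensor w w‖ₑ ≤ (‖v‖ₑ + ‖w‖ₑ) * ‖v - w‖ₑ := by
  have e : tensor v v - tensor w w = tensor v (v - w) + tensor (v - w) w := by
    ext h k
    simp only [tensor, Pi.sub_apply, Pi.add_apply, PiLp.sub_apply]
    ring
  rw [e]
  refine (enorm_add_le _ _).trans ((add_le_add (enorm_tensor_le _ _)
    (enorm_tensor_le _ _)).trans_eq ?_)
  ring

lemma measurable_tensor {α : Type*} [MeasurableSpace α] {f g : α → E3} (hf : Measurable f)
    (hg : Measurable g) : Measurable fun a => tensor (f a) (g a) :=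
  measurable_pi_lambda _ fun h => measurable_pi_lambda _ fun k => by
    unfold tensor
    fun_prop

/-- On a compact time interval a continuous `L³` curve has a jointly measurable representative,
bounded in `L³`. -/
lemma exists_representative_of_continuousOn {u : ℝ → Lp E3 3 (volume : Measure E3)} {t₁ : ℝ}
    (ht₁ : 0 ≤ t₁) (hu : ContinuousOn u (Icc 0 t₁)) :
    ∃ U : ℝ → E3 → E3, Measurable (Function.uncurry U) ∧ (∀ s ∈ Icc 0 t₁, U s =ᵐ[volume] u s) ∧
      ∃ A : ℝ≥0∞, A ≠ ∞ ∧ ∀ s, eLpNorm (U s) 3 volume ≤ A := by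
  have huc : UniformContinuous (IccExtend ht₁ (fun s : Icc 0 t₁ => u s)) :=
    (CompactSpace.uniformContinuous_of_continuous hu.domRestrict).comp
      (LipschitzWith.projIcc ht₁).uniformContinuous
  obtain ⟨U, hU, hUu⟩ := exists_measurable_representative huc
  obtain ⟨A, hA⟩ := (isCompact_Icc (a := (0 : ℝ)) (b := t₁)).exists_bound_of_continuousOn hu
  refine ⟨U, hU, fun s hs => ?_, ENNReal.ofReal A, ENNReal.ofReal_ne_top, fun s => ?_⟩
  · have := hUu s
    rwa [IccExtend_of_mem ht₁ _ hs] at this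
  · rw [eLpNorm_congr_ae (hUu s), ← Lp.enorm_def, ← ofReal_norm]
    exact ENNReal.ofReal_le_ofReal (hA _ (projIcc 0 t₁ ht₁ s).2)

lemma IsL3Solution.continuousOn_Icc {a : E3 → E3} {T : EReal}
    {u : ℝ → Lp E3 3 (volume : Measure E3)} (hu : IsL3Solution a T u) {t₁ : ℝ}
    (hT : (t₁ : EReal) < T) : ContinuousOn u (Icc 0 t₁) :=
  hu.continuousOn.mono fun _ hs => ⟨hs.1, lt_of_le_of_lt (EReal.coe_le_coe_iff.2 hs.2) hT⟩

/-- The integral equation, with a jointly measurable representative in the Duhamel term. -/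
lemma IsL3Solution.ae_eq_sub_duhamel {a : E3 → E3} {T : EReal}
    {u : ℝ → Lp E3 3 (volume : Measure E3)} (hu : IsL3Solution a T u) {t₁ : ℝ}
    (hT : (t₁ : EReal) < T) {U : ℝ → E3 → E3} (hU : ∀ s ∈ Icc 0 t₁, U s =ᵐ[volume] u s) {t : ℝ}
    (ht : t ∈ Ioc 0 t₁) : ∀ᵐ x, U t x = heat t a x -
      duhamel t (fun s y => tensor (U s y) (U s y)) x := by
  filter_upwards [hU t ⟨ht.1.le, ht.2⟩,
    hu.integral_eq t ht.1 (lt_of_le_of_lt (EReal.coe_le_coe_iff.2 ht.2) hT)] with x h1 h2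
  rw [h1, h2, bilinear_eq_neg_duhamel, ← sub_eq_add_neg]
  congr 1
  refine duhamel_congr ht.1.le (fun _ hs => ?_) x
  filter_upwards [hU _ ⟨hs.1, hs.2.trans ht.2⟩] with y hy
  rw [hy]

lemma lintegral_tensor_rpow_le {A : ℝ≥0∞} {f : E3 → E3} (hf : eLpNorm f 3 volume ≤ A) :
    ∫⁻ x, ‖tensor (f x) (f x)‖ₑ ^ (3 / 2 : ℝ) ≤ A ^ (3 : ℝ) := by
  calc _ ≤ ∫⁻ x, ‖f x‖ₑ ^ (3 : ℝ) := by
        refine lintegral_mono fun x => ?_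
        refine (ENNReal.rpow_le_rpow (enorm_tensor_le _ _) (by norm_num)).trans_eq ?_
        rw [← sq, ← ENNReal.rpow_natCast, ← ENNReal.rpow_mul]
        norm_num
    _ ≤ _ := by
        rw [lintegral_enorm_rpow_three]
        gcongr

/-- If the field vanishes up to time `a`, the Duhamel majorant may be started there. -/
lemma duhamelMajorant_zero_le {f : ℝ → E3 → ℝ≥0∞} (hf : Measurable (Function.uncurry f)) {a t : ℝ}
    (h0 : ∀ s ≤ a, ∀ y, f s y = 0) (x : E3) :
    duhamelMajorant 0 t f x ≤ duhamelMajorant a t f x := by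
  rw [duhamelMajorant_eq hf, duhamelMajorant_eq hf, ← lintegral_indicator measurableSet_Ioo,
    ← lintegral_indicator measurableSet_Ioo]
  refine lintegral_mono fun s => ?_
  rcases le_or_gt s a with h | h
  · simp [indicator, h0 s h]
  · by_cases hs : s ∈ Ioo 0 t
    · have h' : s ∈ Ioo a t := ⟨h, hs.2⟩
      rw [indicator_of_mem hs, indicator_of_mem h']
    · rw [indicator_of_notMem hs]
      exact zero_le

/-! ### Uniqueness of solutions -/

/-- The difference of two solutions is controlled by the Duhamel majorant, which may be started at
any time before which the solutions agree. -/
lemma enorm_sub_le_duhamelMajorant {a : E3 → E3} {T : EReal}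
    {u v : ℝ → Lp E3 3 (volume : Measure E3)} (hu : IsL3Solution a T u) (hv : IsL3Solution a T v)
    {t₁ : ℝ} (hT : (t₁ : EReal) < T) {U V : ℝ → E3 → E3} (hUm : Measurable (Function.uncurry U))
    (hVm : Measurable (Function.uncurry V)) (hU : ∀ s ∈ Icc 0 t₁, U s =ᵐ[volume] u s)
    (hV : ∀ s ∈ Icc 0 t₁, V s =ᵐ[volume] v s) {A : ℝ≥0∞} (hA : A ≠ ∞)
    (hUA : ∀ s, eLpNorm (U s) 3 volume ≤ A) (hVA : ∀ s, eLpNorm (V s) 3 volume ≤ A)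
    {x : ℝ} (hx : 0 ≤ x) (hxuv : ∀ s ∈ Icc 0 x, u s = v s) {t : ℝ} (ht : t ∈ Ioc x t₁)
    {g : ℝ → E3 → ℝ≥0∞} (hg : Measurable (Function.uncurry g))
    (hUVg : ∀ s y, ‖U s y‖ₑ + ‖V s y‖ₑ ≤ g s y) :
    ∀ᵐ z, ‖U t z - V t z‖ₑ ≤
      duhamelMajorant x t (fun s y => g s y * ‖U s y - V s y‖ₑ) z := by
  have ht' : t ∈ Ioc 0 t₁ := ⟨hx.trans_lt ht.1, ht.2⟩
  have hFU : Measurable (Function.uncurry fun s y => tensor (U s y) (U s y)) :=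
    measurable_tensor hUm hUm
  have hFV : Measurable (Function.uncurry fun s y => tensor (V s y) (V s y)) :=
    measurable_tensor hVm hVm
  have hA3 : A ^ (3 : ℝ) ≠ ∞ := ENNReal.rpow_ne_top_of_nonneg (by norm_num) hA
  have hfin : ∀ {F : ℝ → E3 → E3}, Measurable (Function.uncurry F) →
      (∀ s, eLpNorm (F s) 3 volume ≤ A) → ∀ᵐ z,
      duhamelMajorant 0 t (fun s y => ‖tensor (F s y) (F s y)‖ₑ) z ≠ ∞ := fun {F} hFm hFA =>
    ae_duhamelMajorant_lt_top (f := fun s y => ‖tensor (F s y) (F s y)‖ₑ)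
      (measurable_tensor hFm hFm).enorm ht'.1.le (p := 3 / 2) (by norm_num)
      hA3 fun s _ => lintegral_tensor_rpow_le (hFA s)
  filter_upwards [hu.ae_eq_sub_duhamel hT hU ht', hv.ae_eq_sub_duhamel hT hV ht', hfin hUm hUA,
    hfin hVm hVA] with z hz1 hz2 hz3 hz4
  have hd : Measurable (Function.uncurry fun s y => ‖U s y - V s y‖ₑ) := (hUm.sub hVm).enorm
  -- the integrand vanishes almost everywhere before time `x`, so it may be cut off there
  have hcut : Measurable (Function.uncurry fun s y =>
      (Ioi x).indicator (fun _ => g s y * ‖U s y - V s y‖ₑ) s) := by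
    have : (Function.uncurry fun s y => (Ioi x).indicator (fun _ => g s y * ‖U s y - V s y‖ₑ) s) =
        (Prod.fst ⁻¹' Ioi x).indicator (Function.uncurry fun s y => g s y * ‖U s y - V s y‖ₑ) := by
      ext ⟨s, y⟩
      simp only [Function.uncurry, indicator, mem_preimage]
    rw [this]
    exact (hg.mul hd).indicator (measurable_fst measurableSet_Ioi)
  calc ‖U t z - V t z‖ₑ = ‖duhamel t (fun s y => tensor (U s y) (U s y)) z -
        duhamel t (fun s y => tensor (V s y) (V s y)) z‖ₑ := by
        rw [hz1, hz2, sub_sub_sub_cancel_left, ← enorm_neg, neg_sub]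
    _ ≤ duhamelMajorant 0 t
        (fun s y => ‖tensor (U s y) (U s y) - tensor (V s y) (V s y)‖ₑ) z := by
        rw [duhamel_sub hFU hFV ht'.1.le hz3 hz4]
        exact enorm_duhamel_le (F := fun s y => tensor (U s y) (U s y) - tensor (V s y) (V s y))
          (hFU.sub hFV) ht'.1.le z
    _ ≤ duhamelMajorant 0 t (fun s y => g s y * ‖U s y - V s y‖ₑ) z := by
        refine duhamelMajorant_mono 0 t (fun s y => ?_) z
        refine (enorm_tensor_sub_le _ _).trans ?_
        gcongr
        exact hUVg s y
    _ = duhamelMajorant 0 t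
        (fun s y => (Ioi x).indicator (fun _ => g s y * ‖U s y - V s y‖ₑ) s) z := by
        refine duhamelMajorant_congr (f := fun s y => g s y * ‖U s y - V s y‖ₑ) (hg.mul hd) hcut
          (fun s hs => ?_) z
        rcases le_or_gt s x with h | h
        · filter_upwards [hU s ⟨hs.1.le, h.trans (ht.1.le.trans ht.2)⟩,
            hV s ⟨hs.1.le, h.trans (ht.1.le.trans ht.2)⟩] with y hy1 hy2
          rw [hy1, hy2, hxuv s ⟨hs.1.le, h⟩]
          simp
        · filter_upwards with y
          rw [indicator_of_mem (show s ∈ Ioi x from h)]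
    _ ≤ duhamelMajorant x t
        (fun s y => (Ioi x).indicator (fun _ => g s y * ‖U s y - V s y‖ₑ) s) z := by
        refine duhamelMajorant_zero_le hcut (fun s hs y => ?_) z
        rw [indicator_of_notMem (by simpa using hs)]
    _ ≤ _ := by
        refine duhamelMajorant_mono x t (fun s y => ?_) z
        by_cases h : s ∈ Ioi x
        · rw [indicator_of_mem h]
        · rw [indicator_of_notMem h]
          exact zero_le

/-- Hölder's inequality on a set of finite measure. -/
lemma setLIntegral_le_eLpNorm_three_mul {f : E3 → E3} (hf : Measurable f) (E : Set E3) :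
    ∫⁻ z in E, ‖f z‖ₑ ≤ eLpNorm f 3 volume * volume E ^ (2 / 3 : ℝ) := by
  have h := eLpNorm_le_eLpNorm_mul_rpow_measure_univ (μ := volume.restrict E) (p := 1) (q := 3)
    (by norm_num) hf.aestronglyMeasurable
  rw [eLpNorm_one_eq_lintegral_enorm, Measure.restrict_apply_univ] at h
  refine h.trans ?_
  norm_num
  gcongr
  exact Measure.restrict_le_self

/-- Two solutions that agree up to time `x` agree a little longer. At time `x` the common value is
split into a bounded part, whose contribution is small on a short interval, and a part small in
`L³`, which stays small by continuity. -/
lemma exists_gt_eq_of_eq {a : E3 → E3} {T : EReal}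
    {u v : ℝ → Lp E3 3 (volume : Measure E3)} (hu : IsL3Solution a T u) (hv : IsL3Solution a T v)
    {t₁ : ℝ} (hT : (t₁ : EReal) < T) {x : ℝ} (hx : 0 ≤ x) (hxt : x < t₁)
    (hxuv : ∀ s ∈ Icc 0 x, u s = v s) : ∃ y ∈ Ioc x t₁, ∀ s ∈ Icc 0 y, u s = v s := by
  have hC := oseenConst_pos
  have ht₁ : 0 ≤ t₁ := hx.trans hxt.le
  obtain ⟨U, hUm, hU, A₁, hA₁, hUA₁⟩ :=
    exists_representative_of_continuousOn ht₁ (hu.continuousOn_Icc hT)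
  obtain ⟨V, hVm, hV, A₂, hA₂, hVA₂⟩ :=
    exists_representative_of_continuousOn ht₁ (hv.continuousOn_Icc hT)
  have hA : A₁ + A₂ ≠ ∞ := ENNReal.add_ne_top.2 ⟨hA₁, hA₂⟩
  -- with this `ε` the small part contributes `1/4` to the contraction factor
  set ε : ℝ := 1 / (40 * oseenConst) with hε
  have hεp : 0 < ε := by positivity
  -- bounded part of the common value at time `x`
  obtain ⟨b, hb, hbL⟩ := (Lp.memLp (u x)).exists_boundedContinuous_eLpNorm_sub_le (by norm_num)
    (ε := ENNReal.ofReal (ε / 4)) (by simpa using hεp)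
  obtain ⟨y₁, hy₁, hclose⟩ : ∃ y₁ ∈ Ioc x t₁, ∀ s ∈ Ioc x y₁,
      dist (u s) (u x) ≤ ε / 4 ∧ dist (v s) (v x) ≤ ε / 4 := by
    have hmem : x ∈ Icc 0 t₁ := ⟨hx, hxt.le⟩
    obtain ⟨δ₁, hδ₁, h1⟩ := Metric.continuousWithinAt_iff.1 (hu.continuousOn_Icc hT x hmem) (ε / 4)
      (by positivity)
    obtain ⟨δ₂, hδ₂, h2⟩ := Metric.continuousWithinAt_iff.1 (hv.continuousOn_Icc hT x hmem) (ε / 4)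
      (by positivity)
    refine ⟨min t₁ (x + min δ₁ δ₂ / 2), ⟨lt_min hxt (by have := lt_min hδ₁ hδ₂; linarith),
      min_le_left _ _⟩, fun s hs => ?_⟩
    have hs1 : s ∈ Icc 0 t₁ := ⟨hx.trans hs.1.le, hs.2.trans (min_le_left _ _)⟩
    have hs2 : dist s x < min δ₁ δ₂ := by
      rw [Real.dist_eq, abs_of_pos (sub_pos.2 hs.1)]
      have := hs.2.trans (min_le_right _ _)
      have := lt_min hδ₁ hδ₂
      linarith
    exact ⟨(h1 hs1 (hs2.trans_le (min_le_left _ _))).le,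
      (h2 hs1 (hs2.trans_le (min_le_right _ _))).le⟩
  obtain ⟨B, hB⟩ : ∃ B, B = ‖b‖ := ⟨_, rfl⟩
  have hB0 : 0 ≤ B := hB ▸ norm_nonneg _
  -- on an interval of length `δ` the bounded part contributes at most `1/4`
  set δ : ℝ := (1 / (16 * oseenConst * (B + 1))) ^ 2 with hδ
  set y := min y₁ (x + δ) with hy
  have hxy : x < y := lt_min hy₁.1 (by have : 0 < δ := by positivity
                                       linarith)
  have hyt : y ≤ t₁ := (min_le_left _ _).trans hy₁.2
  refine ⟨y, ⟨hxy, hyt⟩, ?_⟩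
  have hbm : Measurable b := b.continuous.measurable
  set r : ℝ → E3 → ℝ := fun s z => ‖U s z - b z‖ + ‖V s z - b z‖ with hr
  have hrm : Measurable (Function.uncurry r) :=
    (hUm.sub (hbm.comp measurable_snd)).norm.add (hVm.sub (hbm.comp measurable_snd)).norm
  have hUs : ∀ s, Measurable (U s) := fun s => hUm.comp (measurable_const.prodMk measurable_id')
  have hVs : ∀ s, Measurable (V s) := fun s => hVm.comp (measurable_const.prodMk measurable_id')
  have hhalf : ∀ {w : ℝ → Lp E3 3 (volume : Measure E3)} {W : ℝ → E3 → E3} {s : ℝ},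
      W s =ᵐ[volume] w s → w x = u x → dist (w s) (w x) ≤ ε / 4 →
      eLpNorm (fun z => W s z - b z) 3 volume ≤ ENNReal.ofReal (ε / 2) := by
    intro w W s hW hwx hd
    have e : (fun z => W s z - b z) =ᵐ[volume] (⇑(w s) - ⇑(w x)) + (⇑(u x) - ⇑b) := by
      filter_upwards [hW] with z hz
      simp only [Pi.add_apply, Pi.sub_apply, hz, hwx]
      abel
    rw [eLpNorm_congr_ae e]
    refine (eLpNorm_add_le ((Lp.aestronglyMeasurable _).sub (Lp.aestronglyMeasurable _))
      ((Lp.aestronglyMeasurable _).sub hbm.aestronglyMeasurable) (by norm_num)).trans ?_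
    rw [← Lp.edist_def, edist_dist]
    refine (add_le_add (ENNReal.ofReal_le_ofReal hd) hb).trans_eq ?_
    rw [← ENNReal.ofReal_add (by positivity) (by positivity)]
    congr 1; ring
  have hrε : ∀ s ∈ Ioc x y, ∫⁻ z, ENNReal.ofReal (r s z) ^ (3 : ℝ) ≤
      ENNReal.ofReal ε ^ (3 : ℝ) := by
    intro s hs
    have hs1 : s ∈ Icc 0 t₁ := ⟨hx.trans hs.1.le, hs.2.trans hyt⟩
    have hs2 := hclose s ⟨hs.1, hs.2.trans (min_le_left _ _)⟩
    have h1 := hhalf (hU s hs1) rfl hs2.1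
    have h2 := hhalf (hV s hs1) (hxuv x ⟨hx, le_rfl⟩).symm hs2.2
    have h3 : eLpNorm (r s) 3 volume ≤ ENNReal.ofReal ε := by
      refine (eLpNorm_add_le (f := fun z => ‖U s z - b z‖) (g := fun z => ‖V s z - b z‖)
        ((hUs s).sub hbm).norm.aestronglyMeasurable ((hVs s).sub hbm).norm.aestronglyMeasurable
        (by norm_num)).trans ?_
      rw [eLpNorm_norm, eLpNorm_norm]
      refine (add_le_add h1 h2).trans_eq ?_
      rw [← ENNReal.ofReal_add (by positivity) (by positivity)]
      congr 1; ring
    rw [eLpNorm_eq_lintegral_rpow_enorm_toReal (by norm_num) (by norm_num),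
      ENNReal.toReal_ofNat] at h3
    have h4 := ENNReal.rpow_le_rpow h3 (show (0 : ℝ) ≤ 3 by norm_num)
    rw [← ENNReal.rpow_mul] at h4
    norm_num at h4
    refine le_trans (le_of_eq (lintegral_congr fun z => ?_)) (by exact_mod_cast h4)
    rw [Real.enorm_of_nonneg (by positivity)]
    norm_cast
  set g : ℝ → E3 → ℝ≥0∞ := fun s z => ENNReal.ofReal (2 * B) + ENNReal.ofReal (r s z) with hg
  have hgm : Measurable (Function.uncurry g) := measurable_const.add hrm.ennreal_ofReal
  have hUVg : ∀ s z, ‖U s z‖ₑ + ‖V s z‖ₑ ≤ g s z := by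
    intro s z
    simp only [hg]
    rw [← ofReal_norm, ← ofReal_norm, ← ENNReal.ofReal_add (norm_nonneg _) (norm_nonneg _),
      ← ENNReal.ofReal_add (by positivity) (by positivity)]
    refine ENNReal.ofReal_le_ofReal ?_
    have h1 := norm_le_norm_sub_add (U s z) (b z)
    have h2 := norm_le_norm_sub_add (V s z) (b z)
    have h3 := hB ▸ b.norm_coe_le_norm z
    simp only [hr]
    linarith
  have hres := ae_eq_zero_of_le_duhamelMajorant (x := x) (y := y)
    (W := fun s z => ‖U s z - V s z‖ₑ) (hUm.sub hVm).enorm hrm (fun s z => by positivity)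
    (B := 2 * B) (by positivity) hεp hrε
    (fun t ht => enorm_sub_le_duhamelMajorant hu hv hT hUm hVm hU hV hA
      (fun s => (hUA₁ s).trans le_self_add) (fun s => (hVA₂ s).trans le_add_self) hx hxuv
      ⟨ht.1, ht.2.trans hyt⟩ hgm hUVg) hA
    (fun t _ E _ _ => (setLIntegral_le_eLpNorm_three_mul ((hUs t).sub (hVs t)) E).trans (by
      gcongr
      exact (eLpNorm_sub_le (hUs t).aestronglyMeasurable (hVs t).aestronglyMeasurable
        (by norm_num)).trans (add_le_add (hUA₁ t) (hVA₂ t)))) (by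
      have h1 : √(y - x) ≤ 1 / (16 * oseenConst * (B + 1)) := by
        refine (Real.sqrt_le_sqrt (show y - x ≤ δ by
          have := min_le_right y₁ (x + δ); linarith)).trans_eq ?_
        rw [hδ, Real.sqrt_sq (by positivity)]
      have h2 : 2 * oseenConst * √(y - x) * (2 * B) ≤ 1 / 4 := by
        calc _ ≤ 2 * oseenConst * (1 / (16 * oseenConst * (B + 1))) * (2 * (B + 1)) := by
              gcongr; linarith
          _ = 1 / 4 := by field_simp; norm_num
      have h3 : 5 * oseenConst * (2 * ε) = 1 / 4 := by rw [hε]; field_simp; norm_num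
      linarith)
  intro s hs
  rcases le_or_gt s x with h | h
  · exact hxuv s ⟨hs.1, h⟩
  · refine Lp.ext ?_
    have hs1 : s ∈ Icc 0 t₁ := ⟨hs.1, hs.2.trans hyt⟩
    filter_upwards [hres s ⟨h, hs.2⟩, hU s hs1, hV s hs1] with z hz h1 h2
    rw [← h1, ← h2]
    simpa [sub_eq_zero] using hz

/-- Uniqueness in `C([0,T), L³)`. -/
theorem IsL3Solution.unique {a : E3 → E3} {T : EReal}
    {u v : ℝ → Lp E3 3 (volume : Measure E3)} (hu : IsL3Solution a T u) (hv : IsL3Solution a T v)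
    {t : ℝ} (ht : 0 ≤ t) (hT : (t : EReal) < T) : u t = v t := by
  have hmem : t ∈ {s : ℝ | ∀ s' ∈ Icc 0 s, u s' = v s'} := by
    refine IsClosed.mem_of_ge_of_forall_exists_gt (a := 0) ?_ ?_ ht ?_
    · refine isClosed_of_closure_subset fun s hs => ?_
      have hst : s ∈ Icc 0 t := isClosed_Icc.closure_subset_iff.2 inter_subset_right hs
      refine ⟨fun s' hs' => ?_, hst⟩
      rcases eq_or_lt_of_le hs'.2 with rfl | hlt
      · have h1 : ContinuousOn (fun q => dist (u q) (v q)) (Icc 0 t) :=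
          continuous_dist.comp_continuousOn
            ((hu.continuousOn_Icc hT).prodMk (hv.continuousOn_Icc hT))
        have hcl : IsClosed (Icc 0 t ∩ (fun q => dist (u q) (v q)) ⁻¹' {0}) :=
          h1.preimage_isClosed_of_isClosed isClosed_Icc isClosed_singleton
        have h2 := hcl.closure_subset_iff.2 (fun q (hq : q ∈ {s : ℝ | ∀ s' ∈ Icc 0 s, u s' = v s'} ∩
          Icc 0 t) => ⟨hq.2, by
            have := hq.1 q ⟨hq.2.1, le_rfl⟩
            simp [this]⟩) hs
        exact dist_eq_zero.1 h2.2
      · obtain ⟨q, hq, hqs⟩ := mem_closure_iff_nhds.1 hs (Ioi s') (Ioi_mem_nhds hlt)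
        exact hqs.1 s' ⟨hs'.1, le_of_lt hq⟩
    · intro s hs
      have : s = 0 := le_antisymm hs.2 hs.1
      rw [this]
      exact Lp.ext (hu.initial.trans hv.initial.symm)
    · rintro x ⟨hx, hx0, hxt⟩
      obtain ⟨y, hy, h⟩ := exists_gt_eq_of_eq hu hv hT hx0 hxt hx
      exact ⟨y, h, hy⟩
  exact hmem t ⟨ht, le_rfl⟩

/-! ### The heat semigroup in `L³` -/

/-- The Gauss--Weierstrass kernel at a positive time as a Schwartz function. -/
def heatSchwartz (t : ℝ) (ht : 0 < t) : 𝓢(E3, ℝ) :=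
  ((4 * Real.pi * t) ^ (-(3 / 2 : ℝ)) : ℝ) • gaussianSchwartz (1 / (4 * t)) (by positivity)

lemma heatSchwartz_apply (t : ℝ) (ht : 0 < t) (x : E3) : heatSchwartz t ht x = heatKernel t x := by
  simp only [heatSchwartz, smul_apply, gaussianSchwartz_apply, heatKernel, smul_eq_mul]
  congr 2
  ring

lemma heatKernel_nonneg {t : ℝ} (ht : 0 < t) (x : E3) : 0 ≤ heatKernel t x := by
  unfold heatKernel; positivity

lemma continuous_heatKernel (t : ℝ) : Continuous (heatKernel t) := by
  unfold heatKernel; fun_prop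

lemma integrable_heatKernel {t : ℝ} (ht : 0 < t) : Integrable (heatKernel t) := by
  have h := (heatSchwartz t ht).integrable (μ := volume)
  rwa [show ⇑(heatSchwartz t ht) = heatKernel t from funext (heatSchwartz_apply t ht)] at h

lemma integral_heatKernel_one : ∫ x, heatKernel 1 x = 1 := by
  have h := GaussianFourier.integral_rexp_neg_mul_sq_norm (V := E3)
    (show (0 : ℝ) < 1 / 4 by norm_num)
  have e : ∀ x : E3, heatKernel 1 x =
      (4 * Real.pi) ^ (-(3 / 2 : ℝ)) * Real.exp (-(1 / 4) * ‖x‖ ^ 2) := fun x => by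
    unfold heatKernel
    congr 2
    · ring
    · ring
  simp_rw [e]
  rw [integral_const_mul, h, finrank_euclideanSpace, Fintype.card_fin]
  have h2 : Real.pi / (1 / 4) = 4 * Real.pi := by ring
  rw [h2, ← Real.rpow_add (by positivity)]
  norm_num

/-- The convolution `∫ K(z) a(x - r z) dz` of `a` with the rescaled kernel `K` of `e^Δ`; it is
`e^{r²Δ} a` and makes sense for `r = 0`. -/
def heatScaled (r : ℝ) (a : E3 → E3) (x : E3) : E3 := ∫ z, heatKernel 1 z • a (x - r • z)

lemma heatKernel_sqrt_smul {t : ℝ} (ht : 0 < t) (z : E3) :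
    heatKernel t (√t • z) = (√t ^ 3)⁻¹ * heatKernel 1 z := by
  unfold heatKernel
  have h1 : ‖√t • z‖ ^ 2 = t * ‖z‖ ^ 2 := by
    rw [norm_smul, mul_pow, Real.norm_of_nonneg (Real.sqrt_nonneg _), Real.sq_sqrt ht.le]
  have h2 : (√t ^ 3)⁻¹ = t ^ (-(3 / 2) : ℝ) := by
    rw [Real.sqrt_eq_rpow, ← Real.rpow_natCast, ← Real.rpow_mul ht.le, ← Real.rpow_neg ht.le]
    norm_num
  rw [h1, h2, Real.mul_rpow (by positivity) ht.le, mul_one, ← mul_assoc, mul_comm (t ^ _)]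
  congr 2
  field_simp

/-- The parabolic scaling of the heat kernel. -/
lemma integral_heatKernel_smul {V : Type*} [NormedAddCommGroup V] [NormedSpace ℝ V] {t : ℝ}
    (ht : 0 < t) (f : E3 → V) :
    ∫ z, heatKernel t z • f z = ∫ z, heatKernel 1 z • f (√t • z) := by
  have hs : 0 < √t := Real.sqrt_pos.2 ht
  have h := Measure.integral_comp_smul_of_nonneg (volume : Measure E3)
    (fun z => heatKernel t z • f z) √t (hR := hs.le)
  rw [finrank_euclideanSpace, Fintype.card_fin] at h
  have h2 : ∀ z, heatKernel t (√t • z) • f (√t • z) =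
      (√t ^ 3)⁻¹ • (heatKernel 1 z • f (√t • z)) := fun z => by
    rw [heatKernel_sqrt_smul ht, mul_smul]
  simp_rw [h2] at h
  rw [integral_smul] at h
  exact (smul_right_injective _ (inv_ne_zero (pow_ne_zero 3 hs.ne')) h).symm

lemma heat_eq_integral_sub (t : ℝ) (a : E3 → E3) (x : E3) :
    heat t a x = ∫ z, heatKernel t z • a (x - z) := by
  rw [heat, ← integral_sub_left_eq_self _ _ x]
  simp

lemma heat_eq_heatScaled {t : ℝ} (ht : 0 < t) (a : E3 → E3) (x : E3) :
    heat t a x = heatScaled √t a x := by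
  rw [heat_eq_integral_sub, heatScaled, integral_heatKernel_smul ht (fun z => a (x - z))]

lemma heatScaled_zero (a : E3 → E3) : heatScaled 0 a = a := by
  ext1 x
  simp [heatScaled, integral_smul_const, integral_heatKernel_one]

/-- The standard Gaussian probability measure for the heat equation. -/
def gaussMeasure : Measure E3 := volume.withDensity fun z => ENNReal.ofReal (heatKernel 1 z)

lemma measurable_ofReal_heatKernel : Measurable fun z => ENNReal.ofReal (heatKernel 1 z) :=
  (continuous_heatKernel 1).measurable.ennreal_ofReal

instance : IsProbabilityMeasure gaussMeasure := ⟨by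
  rw [gaussMeasure, withDensity_apply _ MeasurableSet.univ, Measure.restrict_univ,
    ← ofReal_integral_eq_lintegral_ofReal (integrable_heatKernel one_pos)
      (Eventually.of_forall (heatKernel_nonneg one_pos)), integral_heatKernel_one,
    ENNReal.ofReal_one]⟩

lemma enorm_integral_heatKernel_smul_le {f : E3 → E3} (hf : Measurable f) :
    ‖∫ z, heatKernel 1 z • f z‖ₑ ≤ ∫⁻ z, ‖f z‖ₑ ∂gaussMeasure := by
  rw [gaussMeasure, lintegral_withDensity_eq_lintegral_mul _ measurable_ofReal_heatKernel hf.enorm]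
  refine (enorm_integral_le_lintegral_enorm _).trans (lintegral_mono fun z => ?_)
  rw [enorm_smul, Pi.mul_apply, Real.enorm_of_nonneg (heatKernel_nonneg one_pos z)]

lemma measurable_heatScaled_integrand {a : E3 → E3} (ha : Measurable a) (r : ℝ) :
    Measurable fun p : E3 × E3 => a (p.2 - r • p.1) :=
  ha.comp (measurable_snd.sub (measurable_fst.const_smul r))

lemma measurable_heatScaled {a : E3 → E3} (ha : Measurable a) (r : ℝ) :
    Measurable (heatScaled r a) := by
  have h : Measurable fun p : E3 × E3 => heatKernel 1 p.2 • a (p.1 - r • p.2) :=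
    ((continuous_heatKernel 1).measurable.comp measurable_snd).smul
      (ha.comp (measurable_fst.sub (measurable_snd.const_smul r)))
  exact h.stronglyMeasurable.integral_prod_right'.measurable

lemma integrable_heatKernel_smul {t : ℝ} (ht : 0 < t) {f : E3 → E3} (hf : Measurable f) {A : ℝ}
    (hA : ∀ x, ‖f x‖ ≤ A) : Integrable fun z => heatKernel t z • f z :=
  (integrable_heatKernel ht).smul_bdd A hf.aestronglyMeasurable (Eventually.of_forall hA)

lemma norm_heatScaled_le {a : E3 → E3} {A : ℝ} (hA : ∀ x, ‖a x‖ ≤ A) (r : ℝ) (x : E3) :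
    ‖heatScaled r a x‖ ≤ A := by
  refine (norm_integral_le_of_norm_le ((integrable_heatKernel one_pos).mul_const A)
    (Eventually.of_forall fun z => ?_)).trans_eq ?_
  · rw [norm_smul, Real.norm_of_nonneg (heatKernel_nonneg one_pos z)]
    exact mul_le_mul_of_nonneg_left (hA _) (heatKernel_nonneg one_pos z)
  · rw [integral_mul_const, integral_heatKernel_one, one_mul]

/-- The heat flow is a contraction in `Lᵖ`, by Jensen for the Gaussian probability measure. -/
lemma lintegral_heatScaled_rpow_le {a : E3 → E3} (ha : Measurable a) (r : ℝ) {p : ℝ} (hp : 1 ≤ p) :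
    ∫⁻ x, ‖heatScaled r a x‖ₑ ^ p ≤ ∫⁻ x, ‖a x‖ₑ ^ p := by
  have hm : Measurable fun q : E3 × E3 => ‖a (q.2 - r • q.1)‖ₑ :=
    (measurable_heatScaled_integrand ha r).enorm
  calc _ ≤ ∫⁻ x, (∫⁻ z, ‖a (x - r • z)‖ₑ ∂gaussMeasure) ^ p := by
        refine lintegral_mono fun x => ENNReal.rpow_le_rpow
          (enorm_integral_heatKernel_smul_le ?_) (by linarith)
        exact ha.comp (measurable_const.sub (measurable_id'.const_smul r))
    _ ≤ gaussMeasure univ ^ (p - 1) * ∫⁻ z, ∫⁻ x, ‖a (x - r • z)‖ₑ ^ p ∂volume ∂gaussMeasure :=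
        lintegral_lintegral_rpow_le (ν := gaussMeasure) (μ := volume) hm hp
    _ = _ := by
        simp_rw [lintegral_sub_right_eq_self (fun x => ‖a x‖ₑ ^ p)]
        simp

lemma memLp_heatScaled {a : E3 → E3} (ha : Measurable a) (h3 : MemLp a 3 volume) (r : ℝ) :
    MemLp (heatScaled r a) 3 volume := by
  refine ⟨(measurable_heatScaled ha r).aestronglyMeasurable, ?_⟩
  have h := lintegral_heatScaled_rpow_le ha r (p := 3) (by norm_num)
  rw [lintegral_enorm_rpow_three, lintegral_enorm_rpow_three] at h
  exact lt_of_le_of_lt ((ENNReal.rpow_le_rpow_iff (by norm_num)).1 h) h3.2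

/-- Translations are continuous in `L³`. -/
lemma tendsto_lintegral_translate_sub {a : E3 → E3} (h3 : MemLp a 3 volume) (h₀ : E3) :
    Tendsto (fun h => ∫⁻ x, ‖a (x - h) - a (x - h₀)‖ₑ ^ (3 : ℝ)) (𝓝 h₀) (𝓝 0) := by
  set τ : E3 → C(E3, E3) := fun h => ⟨fun x => x - h, by fun_prop⟩ with hτ
  have hτc : Continuous τ := ContinuousMap.continuous_of_continuous_uncurry _ (by
    simp only [hτ, ContinuousMap.coe_mk]; fun_prop)
  have hmp : ∀ h, MeasurePreserving (τ h) (volume : Measure E3) volume := fun h =>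
    measurePreserving_sub_right volume h
  have hc : Continuous fun h => Lp.compMeasurePreserving (τ h) (hmp h) (h3.toLp a) :=
    Continuous.compMeasurePreservingLp continuous_const hτc hmp (by norm_num)
  have hae : ∀ h, Lp.compMeasurePreserving (τ h) (hmp h) (h3.toLp a) =ᵐ[volume]
      fun x => a (x - h) := fun h =>
    (Lp.coeFn_compMeasurePreserving _ (hmp h)).trans
      ((hmp h).quasiMeasurePreserving.ae_eq_comp h3.coeFn_toLp)
  have h1 := (Lp.tendsto_Lp_iff_tendsto_eLpNorm' _ _).1 (hc.tendsto h₀)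
  have h2 := (ENNReal.continuous_rpow_const (y := 3)).tendsto 0 |>.comp h1
  rw [ENNReal.zero_rpow_of_pos (by norm_num)] at h2
  refine h2.congr fun h => ?_
  rw [Function.comp_apply, ← lintegral_enorm_rpow_three]
  refine lintegral_congr_ae ?_
  filter_upwards [hae h, hae h₀] with x hx hx0
  rw [Pi.sub_apply, hx, hx0]

/-- The `L³` distance between two translates of `a`, to the third power. -/
def translateDist (a : E3 → E3) (h h₀ : E3) : ℝ≥0∞ :=
  ∫⁻ x, ‖a (x - h) - a (x - h₀)‖ₑ ^ (3 : ℝ)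

lemma measurable_translate {a : E3 → E3} (ha : Measurable a) (r : ℝ) (x : E3) :
    Measurable fun z : E3 => a (x - r • z) :=
  ha.comp (by fun_prop)

lemma heatScaled_sub_heatScaled {a : E3 → E3} (ha : Measurable a) {A : ℝ} (hA : ∀ x, ‖a x‖ ≤ A)
    (r r₀ : ℝ) (x : E3) : heatScaled r a x - heatScaled r₀ a x =
      ∫ z, heatKernel 1 z • (a (x - r • z) - a (x - r₀ • z)) := by
  have h : ∀ r : ℝ, Integrable fun z => heatKernel 1 z • a (x - r • z) := fun r =>
    integrable_heatKernel_smul one_pos (measurable_translate ha r x) fun _ => hA _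
  simp_rw [smul_sub]
  exact (integral_sub (h r) (h r₀)).symm

lemma measurable_translate_sub {a : E3 → E3} (ha : Measurable a) (r r₀ : ℝ) :
    Measurable fun q : E3 × E3 => ‖a (q.2 - r • q.1) - a (q.2 - r₀ • q.1)‖ₑ :=
  ((measurable_heatScaled_integrand ha r).sub (measurable_heatScaled_integrand ha r₀)).enorm

/-- The increments of the heat flow are averages of differences of translates of `a`. -/
lemma eLpNorm_heatScaled_sub_le {a : E3 → E3} (ha : Measurable a) {A : ℝ} (hA : ∀ x, ‖a x‖ ≤ A)
    (r r₀ : ℝ) : eLpNorm (heatScaled r a - heatScaled r₀ a) 3 volume ^ (3 : ℝ) ≤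
      ∫⁻ z, translateDist a (r • z) (r₀ • z) ∂gaussMeasure := by
  rw [← lintegral_enorm_rpow_three]
  have h1 : ∀ x, ‖(heatScaled r a - heatScaled r₀ a) x‖ₑ ≤
      ∫⁻ z, ‖a (x - r • z) - a (x - r₀ • z)‖ₑ ∂gaussMeasure := fun x => by
    rw [Pi.sub_apply, heatScaled_sub_heatScaled ha hA]
    exact enorm_integral_heatKernel_smul_le
      ((measurable_translate ha r x).sub (measurable_translate ha r₀ x))
  refine (lintegral_mono fun x => ENNReal.rpow_le_rpow (h1 x) (by norm_num)).trans ?_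
  refine (lintegral_lintegral_rpow_le (ν := gaussMeasure) (μ := volume)
    (measurable_translate_sub ha r r₀) (p := 3) (by norm_num)).trans_eq ?_
  rw [measure_univ, ENNReal.one_rpow, one_mul]
  rfl

lemma translateDist_le {a : E3 → E3} (h3 : MemLp a 3 volume) (h h₀ : E3) :
    translateDist a h h₀ ≤ (eLpNorm a 3 volume + eLpNorm a 3 volume) ^ (3 : ℝ) := by
  have e : ∀ h : E3, eLpNorm (fun x => a (x - h)) 3 volume = eLpNorm a 3 volume := fun h =>
    eLpNorm_comp_measurePreserving h3.1 (measurePreserving_sub_right volume h)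
  have m : ∀ h : E3, AEStronglyMeasurable (fun x => a (x - h)) volume := fun h =>
    h3.1.comp_measurePreserving (measurePreserving_sub_right volume h)
  rw [translateDist, lintegral_enorm_rpow_three (fun x => a (x - h) - a (x - h₀))]
  refine ENNReal.rpow_le_rpow ?_ (by norm_num)
  refine (eLpNorm_sub_le (m h) (m h₀) (by norm_num)).trans_eq ?_
  rw [e, e]

lemma tendsto_lintegral_translateDist {a : E3 → E3} (ha : Measurable a) (h3 : MemLp a 3 volume)
    (r₀ : ℝ) : Tendsto (fun r : ℝ => ∫⁻ z, translateDist a (r • z) (r₀ • z) ∂gaussMeasure)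
      (𝓝 r₀) (𝓝 0) := by
  have h0 : ∫⁻ _z : E3, (0 : ℝ≥0∞) ∂gaussMeasure = 0 := lintegral_zero
  rw [← h0]
  refine tendsto_lintegral_filter_of_dominated_convergence
    (fun _ => (eLpNorm a 3 volume + eLpNorm a 3 volume) ^ (3 : ℝ))
    (Eventually.of_forall fun r =>
      ((measurable_translate_sub ha r r₀).pow_const (3 : ℝ)).lintegral_prod_right')
    (Eventually.of_forall fun r => Eventually.of_forall fun z => translateDist_le h3 _ _) ?_
    (Eventually.of_forall fun z => ?_)
  · rw [lintegral_const, measure_univ, mul_one]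
    exact ENNReal.rpow_ne_top_of_nonneg (by norm_num)
      (ENNReal.add_ne_top.2 ⟨h3.2.ne, h3.2.ne⟩)
  · have hcont : Tendsto (fun r : ℝ => r • z) (𝓝 r₀) (𝓝 (r₀ • z)) :=
      (continuous_id.smul continuous_const).tendsto r₀
    exact (tendsto_lintegral_translate_sub h3 (r₀ • z)).comp hcont

/-- The heat semigroup is strongly continuous in `L³`, up to and including time `0`. -/
lemma tendsto_eLpNorm_heatScaled_sub {a : E3 → E3} (ha : Measurable a) (h3 : MemLp a 3 volume)
    {A : ℝ} (hA : ∀ x, ‖a x‖ ≤ A) (r₀ : ℝ) :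
    Tendsto (fun r => eLpNorm (heatScaled r a - heatScaled r₀ a) 3 volume) (𝓝 r₀) (𝓝 0) := by
  have h1 := tendsto_of_tendsto_of_tendsto_of_le_of_le tendsto_const_nhds
    (tendsto_lintegral_translateDist ha h3 r₀) (fun r => zero_le)
    (fun r => eLpNorm_heatScaled_sub_le ha hA r r₀)
  have h2 := (ENNReal.continuous_rpow_const (y := 1 / 3)).tendsto 0 |>.comp h1
  rw [ENNReal.zero_rpow_of_pos (by norm_num)] at h2
  refine h2.congr fun r => ?_
  rw [Function.comp_apply, ← ENNReal.rpow_mul]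
  norm_num

/-! ### Continuity in time of the Duhamel integral -/

section Duhamel

variable {F G : ℝ → E3 → Fin 3 → Fin 3 → ℝ}

/-- For a tensor field bounded in time with values in `L³` (rather than `L^{3/2}`, as `u ⊗ u`) there
is a gain of `√t`. -/
lemma eLpNorm_duhamel_le (hF : Measurable (Function.uncurry F)) {A : ℝ≥0∞}
    (hA : ∀ s, eLpNorm (F s) 3 volume ≤ A) {t : ℝ} (ht : 0 ≤ t) :
    eLpNorm (duhamel t F) 3 volume ≤ ENNReal.ofReal (2 * oseenConst * √t) * A := by
  have h := lintegral_duhamelMajorant_rpow_le_const (measurable_enorm_field hF) ht (p := 3)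
    (by norm_num) (A := A ^ (3 : ℝ)) fun s _ => by
      rw [lintegral_enorm_rpow_three]
      exact ENNReal.rpow_le_rpow (hA s) (by norm_num)
  rw [sub_zero, ← ENNReal.mul_rpow_of_nonneg _ _ (by norm_num)] at h
  rw [← ENNReal.rpow_le_rpow_iff (z := 3) (by norm_num), ← lintegral_enorm_rpow_three]
  exact (lintegral_mono fun x => ENNReal.rpow_le_rpow (enorm_duhamel_le hF ht x)
    (by norm_num)).trans h

lemma ae_duhamelMajorant_ne_top (hF : Measurable (Function.uncurry F)) {A : ℝ≥0∞} (hAt : A ≠ ∞)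
    (hA : ∀ s, eLpNorm (F s) 3 volume ≤ A) {t : ℝ} (ht : 0 ≤ t) :
    ∀ᵐ x, duhamelMajorant 0 t (fun s y => ‖F s y‖ₑ) x ≠ ∞ :=
  ae_duhamelMajorant_lt_top (measurable_enorm_field hF) ht (p := 3) (by norm_num)
    (A := A ^ (3 : ℝ)) (ENNReal.rpow_ne_top_of_nonneg (by norm_num) hAt) fun s _ => by
      rw [lintegral_enorm_rpow_three]
      exact ENNReal.rpow_le_rpow (hA s) (by norm_num)

lemma memLp_duhamel (hF : Measurable (Function.uncurry F)) {A : ℝ≥0∞} (hAt : A ≠ ∞)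
    (hA : ∀ s, eLpNorm (F s) 3 volume ≤ A) {t : ℝ} (ht : 0 ≤ t) :
    MemLp (duhamel t F) 3 volume :=
  ⟨(measurable_duhamel hF ht).aestronglyMeasurable, (eLpNorm_duhamel_le hF hA ht).trans_lt
    (ENNReal.mul_lt_top ENNReal.ofReal_lt_top hAt.lt_top)⟩

/-- The field `F`, delayed by the time `h` and extended by zero. -/
def delay (h : ℝ) (F : ℝ → E3 → Fin 3 → Fin 3 → ℝ) (s : ℝ) : E3 → Fin 3 → Fin 3 → ℝ :=
  if h < s then F (s - h) else 0

lemma measurable_delay (hF : Measurable (Function.uncurry F)) (h : ℝ) :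
    Measurable (Function.uncurry (delay h F)) := by
  have e : Function.uncurry (delay h F) = {q : ℝ × E3 | h < q.1}.indicator
      fun q => Function.uncurry F (q.1 - h, q.2) := by
    ext q
    by_cases hq : h < q.1 <;> simp [delay, Function.uncurry, Set.indicator, hq]
  rw [e]
  exact (hF.comp ((measurable_fst.sub_const h).prodMk measurable_snd)).indicator
    (measurableSet_lt measurable_const measurable_fst)

lemma oseenTensor_zero (t : ℝ) (x : E3) : oseenTensor t 0 x = 0 := by
  ext j
  simp [oseenTensor]

/-- The Duhamel integral up to time `t - h` is the one up to time `t` of the delayed field, which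
turns increments in time into the Duhamel integral of a difference of fields. -/
lemma duhamel_delay (F : ℝ → E3 → Fin 3 → Fin 3 → ℝ) {h t : ℝ} (h0 : 0 ≤ h) (ht : h ≤ t)
    (x : E3) : duhamel t (delay h F) x = duhamel (t - h) F x := by
  have e : (fun s => oseenTensor (t - s) (delay h F s) x) =
      (Ioi h).indicator fun s => oseenTensor (t - h - (s - h)) (F (s - h)) x := by
    funext s
    by_cases hs : h < s
    · simp [delay, hs]
    · simp [delay, hs, oseenTensor_zero]
  rw [duhamel, duhamel, e, intervalIntegral.integral_of_le (h0.trans ht),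
    setIntegral_indicator measurableSet_Ioi, Ioc_inter_Ioi, max_eq_right h0,
    ← intervalIntegral.integral_of_le ht,
    intervalIntegral.integral_comp_sub_right (fun s => oseenTensor (t - h - s) (F s) x), sub_self]

/-- The modulus of continuity of the Duhamel integral in time. -/
lemma lintegral_duhamel_sub_le (hF : Measurable (Function.uncurry F)) {A ω : ℝ≥0∞} (hAt : A ≠ ∞)
    (hA : ∀ s, eLpNorm (F s) 3 volume ≤ A) {h t : ℝ} (h0 : 0 ≤ h) (ht : h ≤ t)
    (hω : ∀ s, eLpNorm (F s - F (s - h)) 3 volume ≤ ω) :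
    eLpNorm (duhamel t F - duhamel (t - h) F) 3 volume ^ (3 : ℝ) ≤
      ENNReal.ofReal (2 * oseenConst * √t) ^ (2 : ℝ) *
        (ENNReal.ofReal (2 * oseenConst * √h) * A ^ (3 : ℝ) +
          ENNReal.ofReal (2 * oseenConst * √t) * ω ^ (3 : ℝ)) := by
  have ht0 := h0.trans ht
  have hD := measurable_delay hF h
  have hDA : ∀ s, eLpNorm (delay h F s) 3 volume ≤ A := fun s => by
    unfold delay
    split_ifs
    · exact hA _
    · simp
  have hm : Measurable (Function.uncurry fun s y => ‖F s y - delay h F s y‖ₑ) :=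
    (hF.sub hD).enorm
  have hb : ∀ s, ∫⁻ x, ‖F s x - delay h F s x‖ₑ ^ (3 : ℝ) ≤
      (Iio h).indicator (fun _ => A ^ (3 : ℝ)) s + (Ici h).indicator (fun _ => ω ^ (3 : ℝ)) s +
        if s = h then A ^ (3 : ℝ) else 0 := fun s => by
    have e := lintegral_enorm_rpow_three (fun x => F s x - delay h F s x)
    rw [e]
    rcases lt_trichotomy s h with hs | hs | hs
    · have : (fun x => F s x - delay h F s x) = F s := by simp [delay, hs.not_gt]
      rw [this]
      simp only [mem_Iio, hs, indicator_of_mem]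
      exact (ENNReal.rpow_le_rpow (hA s) (by norm_num)).trans (by
        rw [add_assoc]; exact le_self_add)
    · have : (fun x => F s x - delay h F s x) = F s := by simp [delay, hs]
      rw [this, if_pos hs]
      exact (ENNReal.rpow_le_rpow (hA s) (by norm_num)).trans le_add_self
    · have : (fun x => F s x - delay h F s x) = F s - F (s - h) := by simp [delay, hs]; rfl
      rw [this]
      simp only [mem_Ici, hs.le, indicator_of_mem]
      exact (ENNReal.rpow_le_rpow (hω s) (by norm_num)).trans (le_add_right le_add_self)
  have hsub : ∀ᵐ x, ‖(duhamel t F - duhamel (t - h) F) x‖ₑ ≤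
      duhamelMajorant 0 t (fun s y => ‖F s y - delay h F s y‖ₑ) x := by
    filter_upwards [ae_duhamelMajorant_ne_top hF hAt hA ht0,
      ae_duhamelMajorant_ne_top hD hAt hDA ht0] with x hx hx'
    rw [Pi.sub_apply, ← duhamel_delay F h0 ht, duhamel_sub hF hD ht0 hx hx']
    exact enorm_duhamel_le (F := fun s y => F s y - delay h F s y) (hF.sub hD) ht0 x
  rw [← lintegral_enorm_rpow_three]
  refine (lintegral_mono_ae (hsub.mono fun x hx => ENNReal.rpow_le_rpow hx (by norm_num))).trans ?_
  refine (lintegral_duhamelMajorant_rpow_le hm 0 t (p := 3) (by norm_num)).trans ?_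
  have hmass : oseenMeasure 0 t univ ≤ ENNReal.ofReal (2 * oseenConst * √t) := by
    simpa using oseenMeasure_univ_le ht0
  rw [show (3 : ℝ) - 1 = 2 by norm_num]
  refine mul_le_mul' (ENNReal.rpow_le_rpow hmass (by norm_num)) ?_
  set κ : ℝ → ℝ≥0∞ := fun s => ENNReal.ofReal (oseenConst * (t - s) ^ (-(1 / 2) : ℝ)) with hκ
  have hκm : Measurable κ := by fun_prop
  have hne : ∀ᵐ s ∂(volume.restrict (Ioo 0 t)), s ≠ h :=
    ae_restrict_of_ae (Measure.ae_ne volume h)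
  calc _ ≤ ∫⁻ s in Ioo 0 t, ((Iio h).indicator (fun s => κ s * A ^ (3 : ℝ)) s +
          κ s * ω ^ (3 : ℝ)) := by
        refine lintegral_mono_ae (hne.mono fun s hs => ?_)
        refine (mul_le_mul_right (hb s) _).trans ?_
        rw [if_neg hs, add_zero, mul_add]
        refine add_le_add (le_of_eq ?_) (mul_le_mul_right (indicator_le_self _ _ _) _)
        by_cases h' : s < h <;> simp [h', hκ]
    _ = (∫⁻ s in Ioo 0 h, κ s * A ^ (3 : ℝ)) + ∫⁻ s in Ioo 0 t, κ s * ω ^ (3 : ℝ) := by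
        rw [lintegral_add_left ((hκm.mul_const _).indicator measurableSet_Iio),
          setLIntegral_indicator measurableSet_Iio, inter_comm, Ioo_inter_Iio, min_eq_right ht]
    _ ≤ _ := by
        rw [lintegral_mul_const _ hκm, lintegral_mul_const _ hκm]
        refine add_le_add (mul_le_mul_left ?_ _) (mul_le_mul_left ?_ _)
        · simpa only [sub_zero] using lintegral_Ioo_rpow h0 ht
        · simpa only [sub_zero] using lintegral_Ioo_rpow ht0 le_rfl

end Duhamel

/-! ### Local existence by Picard iteration -/

/-- The product `v ⊗ v` after clipping every coordinate of `v` to `[-R, R]`. Unlike `v ⊗ v` it is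
a globally Lipschitz function of `v`. -/
def clippedTensor (R : ℝ) (v : E3) (h k : Fin 3) : ℝ :=
  max (-R) (min R (v h)) * max (-R) (min R (v k))

lemma abs_clip_le {R : ℝ} (hR : 0 ≤ R) (y : ℝ) : |max (-R) (min R y)| ≤ R :=
  abs_le.2 ⟨le_max_left _ _, max_le (by linarith) (min_le_left _ _)⟩

lemma abs_clip_sub_le (R y z : ℝ) : |max (-R) (min R y) - max (-R) (min R z)| ≤ |y - z| := by
  refine (abs_max_sub_max_le_max _ _ _ _).trans ?_
  rw [sub_self, abs_zero, max_eq_right (abs_nonneg _)]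
  refine (abs_min_sub_min_le_max _ _ _ _).trans ?_
  rw [sub_self, abs_zero, max_eq_right (abs_nonneg _)]

lemma measurable_clippedTensor {α : Type*} [MeasurableSpace α] (R : ℝ) {f : α → E3}
    (hf : Measurable f) : Measurable fun a => clippedTensor R (f a) :=
  measurable_pi_lambda _ fun h => measurable_pi_lambda _ fun k => by
    unfold clippedTensor
    fun_prop

lemma clippedTensor_eq_tensor {R : ℝ} {v : E3} (hv : ‖v‖ ≤ R) :
    clippedTensor R v = tensor v v := by
  have h : ∀ i, max (-R) (min R (v i)) = v i := fun i => by
    have := abs_le.1 ((PiLp.norm_apply_le v i).trans hv)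
    rw [min_eq_right this.2, max_eq_right this.1]
  ext i j
  rw [clippedTensor, tensor, h, h]

lemma norm_clippedTensor_le {R : ℝ} (hR : 0 ≤ R) (v : E3) : ‖clippedTensor R v‖ ≤ R ^ 2 := by
  refine (pi_norm_le_iff_of_nonneg (by positivity)).2 fun h =>
    (pi_norm_le_iff_of_nonneg (by positivity)).2 fun k => ?_
  rw [clippedTensor, norm_mul, sq]
  exact mul_le_mul (abs_clip_le hR _) (abs_clip_le hR _) (norm_nonneg _) hR

lemma norm_clippedTensor_sub_le {R : ℝ} (hR : 0 ≤ R) (v w : E3) :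
    ‖clippedTensor R v - clippedTensor R w‖ ≤ 2 * R * ‖v - w‖ := by
  refine (pi_norm_le_iff_of_nonneg (by positivity)).2 fun h =>
    (pi_norm_le_iff_of_nonneg (by positivity)).2 fun k => ?_
  have hc : ∀ i, |max (-R) (min R (v i)) - max (-R) (min R (w i))| ≤ ‖v - w‖ := fun i =>
    (abs_clip_sub_le R _ _).trans (PiLp.norm_apply_le (v - w) i)
  simp only [Pi.sub_apply, clippedTensor]
  have e : ∀ p q r s : ℝ, p * q - r * s = p * (q - s) + (p - r) * s := fun p q r s => by ring
  rw [e, two_mul, add_mul]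
  refine (norm_add_le _ _).trans (add_le_add ?_ ?_)
  · rw [norm_mul]
    exact mul_le_mul (abs_clip_le hR _) (hc k) (norm_nonneg _) hR
  · rw [norm_mul, mul_comm]
    exact mul_le_mul (abs_clip_le hR _) (hc h) (norm_nonneg _) hR

lemma eLpNorm_clippedTensor_sub_le {R : ℝ} (hR : 0 ≤ R) (f g : E3 → E3) :
    eLpNorm ((fun y => clippedTensor R (f y)) - fun y => clippedTensor R (g y)) 3 volume ≤
      ENNReal.ofReal (2 * R) * eLpNorm (f - g) 3 volume :=
  eLpNorm_le_mul_eLpNorm_of_ae_le_mul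
    (Eventually.of_forall fun _ => norm_clippedTensor_sub_le hR _ _) 3

lemma clippedTensor_zero (R : ℝ) (hR : 0 ≤ R) : clippedTensor R 0 = 0 := by
  ext h k
  simp [clippedTensor, hR]

lemma eLpNorm_clippedTensor_le {R : ℝ} (hR : 0 ≤ R) (f : E3 → E3) :
    eLpNorm (fun y => clippedTensor R (f y)) 3 volume ≤
      ENNReal.ofReal (2 * R) * eLpNorm f 3 volume := by
  have h := eLpNorm_clippedTensor_sub_le hR f 0
  have e : ((fun y => clippedTensor R (f y)) - fun y => clippedTensor R ((0 : E3 → E3) y)) =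
      fun y => clippedTensor R (f y) := by
    funext y
    simp [clippedTensor_zero R hR]
  rwa [e, sub_zero] at h

section FixedPoint

variable {T : ℝ} (hT : 0 ≤ T)

/-- The curve `u` on `[0, T]`, extended by constants, has a jointly measurable representative. -/
lemma exists_representative (u : C(Icc 0 T, Lp E3 3 (volume : Measure E3))) :
    ∃ U : ℝ → E3 → E3, Measurable (Function.uncurry U) ∧
      ∀ s, U s =ᵐ[volume] u (projIcc 0 T hT s) :=
  exists_measurable_representative
    ((CompactSpace.uniformContinuous_of_continuous u.continuous).comp
      (LipschitzWith.projIcc hT).uniformContinuous)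

/-- A jointly measurable representative of the curve `u`. -/
def representative (u : C(Icc 0 T, Lp E3 3 (volume : Measure E3))) : ℝ → E3 → E3 :=
  (exists_representative hT u).choose

lemma measurable_representative (u : C(Icc 0 T, Lp E3 3 (volume : Measure E3))) :
    Measurable (Function.uncurry (representative hT u)) :=
  (exists_representative hT u).choose_spec.1

lemma representative_ae_eq (u : C(Icc 0 T, Lp E3 3 (volume : Measure E3))) (s : ℝ) :
    representative hT u s =ᵐ[volume] u (projIcc 0 T hT s) :=
  (exists_representative hT u).choose_spec.2 s

lemma eLpNorm_representative_sub (u v : C(Icc 0 T, Lp E3 3 (volume : Measure E3))) (s s' : ℝ) :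
    eLpNorm (representative hT u s - representative hT v s') 3 volume =
      edist (u (projIcc 0 T hT s)) (v (projIcc 0 T hT s')) := by
  rw [Lp.edist_def]
  exact eLpNorm_congr_ae ((representative_ae_eq hT u s).sub (representative_ae_eq hT v s'))

/-- The clipped nonlinearity along the curve `u`. -/
def clippedField (R : ℝ) (u : C(Icc 0 T, Lp E3 3 (volume : Measure E3))) (s : ℝ) (y : E3) :
    Fin 3 → Fin 3 → ℝ :=
  clippedTensor R (representative hT u s y)

lemma measurable_clippedField (R : ℝ) (u : C(Icc 0 T, Lp E3 3 (volume : Measure E3))) :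
    Measurable (Function.uncurry (clippedField hT R u)) :=
  measurable_clippedTensor R (measurable_representative hT u)

lemma eLpNorm_clippedField_le {R : ℝ} (hR : 0 ≤ R)
    (u : C(Icc 0 T, Lp E3 3 (volume : Measure E3))) (s : ℝ) :
    eLpNorm (clippedField hT R u s) 3 volume ≤ ENNReal.ofReal (2 * R) * ENNReal.ofReal ‖u‖ := by
  refine (eLpNorm_clippedTensor_le hR _).trans (mul_le_mul_right ?_ _)
  rw [eLpNorm_congr_ae (representative_ae_eq hT u s), ← Lp.enorm_def, ← ofReal_norm]
  exact ENNReal.ofReal_le_ofReal (u.norm_coe_le_norm _)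

lemma memLp_duhamel_clippedField {R : ℝ} (hR : 0 ≤ R)
    (u : C(Icc 0 T, Lp E3 3 (volume : Measure E3))) {t : ℝ} (ht : 0 ≤ t) :
    MemLp (duhamel t (clippedField hT R u)) 3 volume :=
  memLp_duhamel (measurable_clippedField hT R u)
    (ENNReal.mul_ne_top ENNReal.ofReal_ne_top ENNReal.ofReal_ne_top)
    (eLpNorm_clippedField_le hT hR u) ht

lemma eLpNorm_duhamel_clippedField_sub_le {R : ℝ} (hR : 0 ≤ R)
    (u v : C(Icc 0 T, Lp E3 3 (volume : Measure E3))) {t : ℝ} (ht : 0 ≤ t) :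
    eLpNorm (duhamel t (clippedField hT R u) - duhamel t (clippedField hT R v)) 3 volume ≤
      ENNReal.ofReal (2 * oseenConst * √t) * (ENNReal.ofReal (2 * R) * edist u v) := by
  have hu := measurable_clippedField hT R u
  have hv := measurable_clippedField hT R v
  have hfin : ∀ w : C(Icc 0 T, Lp E3 3 (volume : Measure E3)),
      ENNReal.ofReal (2 * R) * ENNReal.ofReal ‖w‖ ≠ ∞ := fun w =>
    ENNReal.mul_ne_top ENNReal.ofReal_ne_top ENNReal.ofReal_ne_top
  have h1 : duhamel t (clippedField hT R u) - duhamel t (clippedField hT R v) =ᵐ[volume]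
      duhamel t fun s y => clippedField hT R u s y - clippedField hT R v s y := by
    filter_upwards [ae_duhamelMajorant_ne_top hu (hfin u) (eLpNorm_clippedField_le hT hR u) ht,
      ae_duhamelMajorant_ne_top hv (hfin v) (eLpNorm_clippedField_le hT hR v) ht] with x hx hx'
    exact duhamel_sub hu hv ht hx hx'
  rw [eLpNorm_congr_ae h1]
  refine eLpNorm_duhamel_le
    (F := fun s y => clippedField hT R u s y - clippedField hT R v s y) (hu.sub hv)
    (fun s => ?_) ht
  refine (eLpNorm_clippedTensor_sub_le hR _ _).trans (mul_le_mul_right ?_ _)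
  rw [eLpNorm_representative_sub]
  rw [edist_dist, edist_dist]
  exact ENNReal.ofReal_le_ofReal (ContinuousMap.dist_apply_le_dist _)

/-- The oscillation of the curve `u` over times at distance at most `h`. -/
def timeModulus (u : C(Icc 0 T, Lp E3 3 (volume : Measure E3))) (h : ℝ) : ℝ≥0∞ :=
  ⨆ s, edist (u (projIcc 0 T hT s)) (u (projIcc 0 T hT (s - h)))

lemma tendsto_timeModulus (u : C(Icc 0 T, Lp E3 3 (volume : Measure E3))) :
    Tendsto (timeModulus hT u) (𝓝 0) (𝓝 0) := by
  have huc : UniformContinuous fun s => u (projIcc 0 T hT s) :=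
    (CompactSpace.uniformContinuous_of_continuous u.continuous).comp
      (LipschitzWith.projIcc hT).uniformContinuous
  rw [ENNReal.tendsto_nhds_zero]
  intro ε hε
  obtain ⟨δ, hδ, h⟩ := EMetric.uniformContinuous_iff.1 huc ε hε
  filter_upwards [Metric.eball_mem_nhds (0 : ℝ) hδ] with r hr
  refine iSup_le fun s => (h ?_).le
  rw [Metric.mem_eball, edist_dist, Real.dist_eq] at hr
  rw [edist_dist, Real.dist_eq]
  simpa using hr

/-- An upper bound for the increment of the Duhamel integral over a time step `h`. -/
def duhamelModulus (R : ℝ) (u : C(Icc 0 T, Lp E3 3 (volume : Measure E3))) (h : ℝ) : ℝ≥0∞ :=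
  ENNReal.ofReal (2 * oseenConst * √T) ^ (2 : ℝ) *
    (ENNReal.ofReal (2 * oseenConst * √h) *
        (ENNReal.ofReal (2 * R) * ENNReal.ofReal ‖u‖) ^ (3 : ℝ) +
      ENNReal.ofReal (2 * oseenConst * √T) *
        (ENNReal.ofReal (2 * R) * timeModulus hT u h) ^ (3 : ℝ))

lemma tendsto_duhamelModulus (R : ℝ) (u : C(Icc 0 T, Lp E3 3 (volume : Measure E3))) :
    Tendsto (duhamelModulus hT R u) (𝓝 0) (𝓝 0) := by
  have h1 : Tendsto (fun h => ENNReal.ofReal (2 * oseenConst * √h)) (𝓝 0) (𝓝 0) := by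
    have : Continuous fun h => ENNReal.ofReal (2 * oseenConst * √h) :=
      ENNReal.continuous_ofReal.comp (by fun_prop)
    simpa using this.tendsto 0
  have h2 : Tendsto (fun h => (ENNReal.ofReal (2 * R) * timeModulus hT u h) ^ (3 : ℝ))
      (𝓝 0) (𝓝 0) := by
    have h3 := ENNReal.Tendsto.const_mul (tendsto_timeModulus hT u)
      (Or.inr (ENNReal.ofReal_ne_top (r := 2 * R)))
    rw [mul_zero] at h3
    have h4 := ((ENNReal.continuous_rpow_const (y := 3)).tendsto 0).comp h3
    rwa [ENNReal.zero_rpow_of_pos (by norm_num)] at h4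
  have h5 := ENNReal.Tendsto.mul_const h1 (Or.inr (ENNReal.rpow_ne_top_of_nonneg
    (y := 3) (by norm_num) (ENNReal.mul_ne_top (ENNReal.ofReal_ne_top (r := 2 * R))
      (ENNReal.ofReal_ne_top (r := ‖u‖)))))
  have h6 := ENNReal.Tendsto.const_mul h2
    (Or.inr (ENNReal.ofReal_ne_top (r := 2 * oseenConst * √T)))
  have h7 := ENNReal.Tendsto.const_mul (h5.add h6) (Or.inr (ENNReal.rpow_ne_top_of_nonneg
    (y := 2) (by norm_num) (ENNReal.ofReal_ne_top (r := 2 * oseenConst * √T))))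
  simp only [zero_mul, mul_zero, add_zero] at h7
  exact h7

lemma eLpNorm_duhamel_clippedField_increment_le {R : ℝ} (hR : 0 ≤ R)
    (u : C(Icc 0 T, Lp E3 3 (volume : Measure E3))) {t t' : ℝ} (ht' : 0 ≤ t') (htt : t' ≤ t)
    (htT : t ≤ T) :
    eLpNorm (duhamel t (clippedField hT R u) - duhamel t' (clippedField hT R u)) 3 volume ^
      (3 : ℝ) ≤ duhamelModulus hT R u (t - t') := by
  have h := lintegral_duhamel_sub_le (measurable_clippedField hT R u)
    (ENNReal.mul_ne_top ENNReal.ofReal_ne_top ENNReal.ofReal_ne_top)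
    (eLpNorm_clippedField_le hT hR u) (sub_nonneg.2 htt) (sub_le_self t ht')
    (ω := ENNReal.ofReal (2 * R) * timeModulus hT u (t - t')) fun s => by
      refine (eLpNorm_clippedTensor_sub_le hR _ _).trans (mul_le_mul_right ?_ _)
      rw [eLpNorm_representative_sub]
      exact le_iSup (fun s => edist (u (projIcc 0 T hT s)) (u (projIcc 0 T hT (s - (t - t'))))) s
  rw [sub_sub_cancel] at h
  have hC := oseenConst_pos.le
  refine h.trans ?_
  unfold duhamelModulus
  gcongr

variable {a : E3 → E3}

/-- One step of the Picard iteration with the clipped nonlinearity, at time `t`. -/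
def picardStep (a : E3 → E3) (R : ℝ) (u : C(Icc 0 T, Lp E3 3 (volume : Measure E3))) (t : ℝ) :
    E3 → E3 :=
  heatScaled √t a - duhamel t (clippedField hT R u)

lemma memLp_picardStep (ha : Measurable a) (h3 : MemLp a 3 volume) {R : ℝ} (hR : 0 ≤ R)
    (u : C(Icc 0 T, Lp E3 3 (volume : Measure E3))) {t : ℝ} (ht : 0 ≤ t) :
    MemLp (picardStep hT a R u t) 3 volume :=
  (memLp_heatScaled ha h3 _).sub (memLp_duhamel_clippedField hT hR u ht)

lemma continuous_picardStep (ha : Measurable a) (h3 : MemLp a 3 volume) {A : ℝ}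
    (hA : ∀ x, ‖a x‖ ≤ A) {R : ℝ} (hR : 0 ≤ R)
    (u : C(Icc 0 T, Lp E3 3 (volume : Measure E3))) :
    Continuous fun t : Icc 0 T => (memLp_picardStep hT ha h3 hR u t.2.1).toLp := by
  rw [continuous_iff_continuousAt]
  intro t₀
  rw [ContinuousAt, tendsto_iff_edist_tendsto_0]
  have h1 : Tendsto (fun t : Icc 0 T => eLpNorm (heatScaled √t a - heatScaled √t₀ a) 3 volume)
      (𝓝 t₀) (𝓝 0) :=
    (tendsto_eLpNorm_heatScaled_sub ha h3 hA (√t₀)).comp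
      ((Real.continuous_sqrt.comp continuous_subtype_val).tendsto t₀)
  have h2 : Tendsto (fun t : Icc 0 T => duhamelModulus hT R u |(t : ℝ) - t₀| ^ (1 / 3 : ℝ))
      (𝓝 t₀) (𝓝 0) := by
    have h3 : Tendsto (fun t : Icc 0 T => |(t : ℝ) - t₀|) (𝓝 t₀) (𝓝 0) := by
      have : Continuous fun t : Icc 0 T => |(t : ℝ) - t₀| := by fun_prop
      simpa using this.tendsto t₀
    have h4 := ((ENNReal.continuous_rpow_const (y := 1 / 3)).tendsto 0).comp
      ((tendsto_duhamelModulus hT R u).comp h3)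
    rwa [ENNReal.zero_rpow_of_pos (by norm_num)] at h4
  have h4 := h1.add h2
  rw [add_zero] at h4
  refine tendsto_of_tendsto_of_tendsto_of_le_of_le tendsto_const_nhds h4 (fun _ => zero_le)
    fun t => ?_
  rw [Lp.edist_toLp_toLp]
  have e : picardStep hT a R u t - picardStep hT a R u t₀ =
      (heatScaled √t a - heatScaled √t₀ a) -
        (duhamel t (clippedField hT R u) - duhamel t₀ (clippedField hT R u)) := by
    unfold picardStep; abel
  rw [e]
  have m1 : ∀ s : Icc 0 T, MemLp (duhamel s (clippedField hT R u)) 3 volume := fun s =>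
    memLp_duhamel_clippedField hT hR u s.2.1
  refine (eLpNorm_sub_le ((memLp_heatScaled ha h3 _).sub (memLp_heatScaled ha h3 _)).1
    ((m1 t).sub (m1 t₀)).1 (by norm_num)).trans (add_le_add le_rfl ?_)
  rw [one_div, ENNReal.le_rpow_inv_iff (by norm_num)]
  rcases le_total (t₀ : ℝ) t with h | h
  · rw [abs_of_nonneg (sub_nonneg.2 h)]
    exact eLpNorm_duhamel_clippedField_increment_le hT hR u t₀.2.1 h t.2.2
  · rw [eLpNorm_sub_comm, abs_sub_comm, abs_of_nonneg (sub_nonneg.2 h)]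
    exact eLpNorm_duhamel_clippedField_increment_le hT hR u t.2.1 h t₀.2.2

/-- The Picard map with the clipped nonlinearity on `C([0, T], L³)`. -/
def picard (ha : Measurable a) (h3 : MemLp a 3 volume) {A : ℝ} (hA : ∀ x, ‖a x‖ ≤ A) {R : ℝ}
    (hR : 0 ≤ R) (u : C(Icc 0 T, Lp E3 3 (volume : Measure E3))) :
    C(Icc 0 T, Lp E3 3 (volume : Measure E3)) :=
  ⟨fun t => (memLp_picardStep hT ha h3 hR u t.2.1).toLp, continuous_picardStep hT ha h3 hA hR u⟩

/-- The clipped nonlinearity is globally Lipschitz in `L³`, so the Picard map contracts as soon as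
`√T` is small compared with `1 / R`. -/
lemma edist_picard_le (ha : Measurable a) (h3 : MemLp a 3 volume) {A : ℝ} (hA : ∀ x, ‖a x‖ ≤ A)
    {R : ℝ} (hR : 0 ≤ R) (u v : C(Icc 0 T, Lp E3 3 (volume : Measure E3))) :
    edist (picard hT ha h3 hA hR u) (picard hT ha h3 hA hR v) ≤
      ENNReal.ofReal (2 * oseenConst * √T * (2 * R)) * edist u v := by
  have hC := oseenConst_pos.le
  have key : ∀ t : Icc 0 T, edist (picard hT ha h3 hA hR u t) (picard hT ha h3 hA hR v t) ≤
      ENNReal.ofReal (2 * oseenConst * √T * (2 * R)) * edist u v := fun t => by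
    rw [picard, picard, ContinuousMap.coe_mk, ContinuousMap.coe_mk, Lp.edist_toLp_toLp]
    have e : picardStep hT a R u t - picardStep hT a R v t =
        duhamel t (clippedField hT R v) - duhamel t (clippedField hT R u) := by
      unfold picardStep; abel
    rw [e, eLpNorm_sub_comm]
    refine (eLpNorm_duhamel_clippedField_sub_le hT hR u v t.2.1).trans ?_
    rw [ENNReal.ofReal_mul (p := 2 * oseenConst * √T) (by positivity),
      mul_assoc (ENNReal.ofReal _)]
    have := t.2.2
    gcongr
  have hfin : edist u v ≠ ∞ := edist_ne_top _ _
  rw [edist_dist]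
  refine ENNReal.ofReal_le_of_le_toReal ((ContinuousMap.dist_le ENNReal.toReal_nonneg).2
    fun t => ?_)
  rw [dist_edist]
  exact ENNReal.toReal_mono (ENNReal.mul_ne_top ENNReal.ofReal_ne_top hfin) (key t)

end FixedPoint

/-- Local existence for bounded data in `L³`. The clipping level exceeds the supremum of the datum,
so that the fixed point stays below it for a short time and solves the original equation. -/
theorem exists_isL3Solution {a : E3 → E3} (ha : Measurable a) (h3 : MemLp a 3 volume) {A : ℝ}
    (hA : ∀ x, ‖a x‖ ≤ A) :
    ∃ T : EReal, 0 < T ∧ ∃ u : ℝ → Lp E3 3 (volume : Measure E3), IsL3Solution a T u := by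
  have hA0 : 0 ≤ A := (norm_nonneg _).trans (hA 0)
  set R := A + 1 with hRdef
  have hR : 0 < R := by positivity
  have hC := oseenConst_pos
  -- on `[0, T]` the map contracts by `1/2`, and the Duhamel term is at most `1`
  set r : ℝ := 1 / (4 * oseenConst * R * (R + 1)) with hr
  have hr0 : 0 < r := by positivity
  have hcon : 2 * oseenConst * r * (2 * R) < 1 := by
    rw [hr, show 2 * oseenConst * (1 / (4 * oseenConst * R * (R + 1))) * (2 * R) = 1 / (R + 1) by
      field_simp; norm_num, div_lt_one (by positivity)]
    linarith
  have hsup : 2 * oseenConst * r * R ^ 2 ≤ 1 := by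
    rw [hr, show 2 * oseenConst * (1 / (4 * oseenConst * R * (R + 1))) * R ^ 2 =
      R / (2 * (R + 1)) by field_simp; norm_num, div_le_one (by positivity)]
    linarith
  have hT : (0 : ℝ) ≤ r ^ 2 := by positivity
  have hsq : √(r ^ 2) = r := Real.sqrt_sq hr0.le
  have hcontr : ContractingWith (2 * oseenConst * r * (2 * R)).toNNReal
      (picard hT ha h3 hA hR.le) := by
    refine ⟨by rwa [← NNReal.coe_lt_coe, Real.coe_toNNReal _ (by positivity)], fun u v => ?_⟩
    have := edist_picard_le hT ha h3 hA hR.le u v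
    rwa [hsq] at this
  obtain ⟨u, hu⟩ : ∃ u, picard hT ha h3 hA hR.le u = u := ⟨_, hcontr.fixedPoint_isFixedPt⟩
  have hut : ∀ t : Icc 0 (r ^ 2), u t =ᵐ[volume] picardStep hT a R u t := fun t => by
    have h := (memLp_picardStep hT ha h3 hR.le u t.2.1).coeFn_toLp
    have e : (memLp_picardStep hT ha h3 hR.le u t.2.1).toLp = u t :=
      congrArg (fun w : C(Icc 0 (r ^ 2), Lp E3 3 (volume : Measure E3)) => w t) hu
    rwa [e] at h
  have hbound : ∀ t : Icc 0 (r ^ 2), ∀ᵐ x, ‖u t x‖ ≤ R := fun t => by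
    filter_upwards [hut t] with x hx
    rw [hx]
    have h1 : ‖duhamel t (clippedField hT R u) x‖ₑ ≤ ENNReal.ofReal 1 := by
      refine (enorm_duhamel_le (measurable_clippedField hT R u) t.2.1 x).trans ?_
      refine (duhamelMajorant_le_const (A := ENNReal.ofReal (R ^ 2)) t.2.1 (fun s y => ?_) x).trans
        ?_
      · rw [← ofReal_norm]
        exact ENNReal.ofReal_le_ofReal (norm_clippedTensor_le hR.le _)
      · rw [sub_zero, ← ENNReal.ofReal_mul (by positivity)]
        refine ENNReal.ofReal_le_ofReal (le_trans ?_ hsup)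
        have : √(t : ℝ) ≤ r := (Real.sqrt_le_sqrt t.2.2).trans_eq hsq
        gcongr
    rw [← ofReal_norm, ENNReal.ofReal_le_ofReal_iff zero_le_one] at h1
    exact (norm_sub_le _ _).trans (add_le_add (norm_heatScaled_le hA _ x) h1)
  have hproj : Continuous fun t : ℝ => u (projIcc 0 (r ^ 2) hT t) :=
    u.continuous.comp continuous_projIcc
  refine ⟨((r ^ 2 : ℝ) : EReal), by exact_mod_cast (by positivity : 0 < r ^ 2),
    fun t => u (projIcc 0 (r ^ 2) hT t), hproj.continuousOn, ?_, fun t ht htT => ?_⟩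
  · filter_upwards [hut (projIcc 0 (r ^ 2) hT 0)] with x hx
    rw [hx, projIcc_left]
    simp [picardStep, duhamel, heatScaled_zero]
  · have htI : t ∈ Icc 0 (r ^ 2) := ⟨ht.le, (EReal.coe_lt_coe_iff.1 htT).le⟩
    have h := hut (projIcc 0 (r ^ 2) hT t)
    rw [projIcc_of_mem hT htI] at h ⊢
    filter_upwards [h] with x hx
    rw [hx, picardStep, Pi.sub_apply, bilinear_eq_neg_duhamel, heat_eq_heatScaled ht,
      ← sub_eq_add_neg]
    congr 1
    refine duhamel_congr ht.le (fun s hs => ?_) x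
    filter_upwards [representative_ae_eq hT u s, hbound (projIcc 0 (r ^ 2) hT s)] with y hy hy'
    rw [clippedField, hy, clippedTensor_eq_tensor hy']

/-! ### Functions of symbol type -/

/-- The weight `q(x) = e + |x|²`. -/
def quad (x : E3) : ℝ := Real.exp 1 + ‖x‖ ^ 2

lemma one_le_quad (x : E3) : 1 ≤ quad x := by
  have := Real.add_one_le_exp (1 : ℝ)
  have := sq_nonneg ‖x‖
  unfold quad; linarith

lemma quad_pos (x : E3) : 0 < quad x := one_pos.trans_le (one_le_quad x)

lemma one_le_log_quad (x : E3) : 1 ≤ Real.log (quad x) := by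
  rw [Real.le_log_iff_exp_le (quad_pos x)]
  exact le_add_of_nonneg_right (sq_nonneg _)

lemma invLog_eq (x : E3) : invLog x = (Real.log (quad x))⁻¹ := rfl

lemma invLog_nonneg (x : E3) : 0 ≤ invLog x :=
  inv_nonneg.2 (zero_le_one.trans (one_le_log_quad x))

lemma invLog_le_one (x : E3) : invLog x ≤ 1 := inv_le_one_of_one_le₀ (one_le_log_quad x)

/-- The decaying weight `q(x)^{-1/2}`. -/
def decay (x : E3) : ℝ := (√(quad x))⁻¹

lemma one_le_sqrt_quad (x : E3) : 1 ≤ √(quad x) := Real.one_le_sqrt.2 (one_le_quad x)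

lemma decay_pos (x : E3) : 0 < decay x := inv_pos.2 (one_pos.trans_le (one_le_sqrt_quad x))

lemma decay_le_one (x : E3) : decay x ≤ 1 := inv_le_one_of_one_le₀ (one_le_sqrt_quad x)

lemma decay_sq (x : E3) : decay x ^ 2 = (quad x)⁻¹ := by
  rw [decay, inv_pow, Real.sq_sqrt (quad_pos x).le]

lemma norm_le_sqrt_quad (x : E3) : ‖x‖ ≤ √(quad x) :=
  Real.le_sqrt_of_sq_le (le_add_of_nonneg_left (Real.exp_pos 1).le)

lemma continuous_quad : Continuous quad := by unfold quad; fun_prop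

lemma continuous_decay : Continuous decay :=
  (continuous_quad.sqrt).inv₀ fun x => (one_pos.trans_le (one_le_sqrt_quad x)).ne'

/-- Peetre's inequality for the weight `decay`. -/
lemma decay_sub_le (x z : E3) : decay (x - z) ≤ (1 + ‖z‖) * decay x := by
  have h1 := one_le_sqrt_quad (x - z)
  have h2 : √(quad x) ≤ (1 + ‖z‖) * √(quad (x - z)) := by
    refine Real.sqrt_le_iff.2 ⟨by positivity, ?_⟩
    have h3 : ‖x‖ ≤ ‖x - z‖ + ‖z‖ := by simpa using norm_add_le (x - z) z
    have h4 := norm_le_sqrt_quad (x - z)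
    have h5 : √(quad (x - z)) ^ 2 = Real.exp 1 + ‖x - z‖ ^ 2 := Real.sq_sqrt (quad_pos _).le
    have h6 : √(quad (x - z)) + ‖z‖ ≤ (1 + ‖z‖) * √(quad (x - z)) := by
      nlinarith [norm_nonneg z]
    calc quad x ≤ Real.exp 1 + (‖x - z‖ + ‖z‖) ^ 2 := by unfold quad; gcongr
      _ ≤ (√(quad (x - z)) + ‖z‖) ^ 2 := by
          have := mul_le_mul_of_nonneg_right h4 (norm_nonneg z)
          linarith [add_sq ‖x - z‖ ‖z‖, add_sq (√(quad (x - z))) ‖z‖]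
      _ ≤ _ := by gcongr
  rw [decay, decay, inv_le_iff_one_le_mul₀ (by positivity), mul_assoc, mul_comm, mul_assoc]
  have h0 : 0 < √(quad x) := one_pos.trans_le (one_le_sqrt_quad x)
  rw [← div_eq_inv_mul, one_le_div h0, mul_comm]
  exact h2

lemma hasFDerivAt_quad (x : E3) : HasFDerivAt quad (2 • innerSL ℝ x) x :=
  (hasStrictFDerivAt_norm_sq x).hasFDerivAt.const_add _

lemma fderiv_quad_single (i : Fin 3) (x : E3) :
    (2 • innerSL ℝ x) (EuclideanSpace.single i (1 : ℝ)) = 2 * x i := by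
  simp [EuclideanSpace.inner_single_right]

/-- Functions of symbol type: those generated by the constants, `xᵢ / q`, `1 / q` and `1 / log q`
under sums and products. A member of order `m` is `O(q^{-m/2})`, and its partial derivatives are
members of order `m + 1`. The constants are given the order `0`, so that the order is a lower bound
for the decay and not determined by the function. -/
inductive IsSymbol : ℕ → (E3 → ℝ) → Prop
  | const (c : ℝ) : IsSymbol 0 fun _ => c
  | coord (i : Fin 3) : IsSymbol 1 fun x => x i / quad x
  | inv : IsSymbol 2 fun x => (quad x)⁻¹
  | invLog : IsSymbol 0 invLog
  | mul {m n : ℕ} {f g : E3 → ℝ} : IsSymbol m f → IsSymbol n g →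
      IsSymbol (m + n) fun x => f x * g x
  | add {m : ℕ} {f g : E3 → ℝ} : IsSymbol m f → IsSymbol m g → IsSymbol m fun x => f x + g x

/-- A symbol of order `m` decays at least like `|x|^{-m}`. -/
lemma IsSymbol.exists_bound {m : ℕ} {f : E3 → ℝ} (hf : IsSymbol m f) :
    ∃ C, 0 ≤ C ∧ ∀ x, |f x| ≤ C * decay x ^ m := by
  induction hf with
  | const c => exact ⟨|c|, abs_nonneg c, fun x => by simp⟩
  | coord i =>
    refine ⟨1, zero_le_one, fun x => ?_⟩
    rw [abs_div, abs_of_pos (quad_pos x), pow_one, one_mul, decay, div_le_iff₀ (quad_pos x),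
      ← Real.mul_self_sqrt (quad_pos x).le, ← mul_assoc, Real.mul_self_sqrt (quad_pos x).le,
      inv_mul_cancel₀ (one_pos.trans_le (one_le_sqrt_quad x)).ne', one_mul]
    exact (PiLp.norm_apply_le x i).trans (norm_le_sqrt_quad x)
  | inv =>
    refine ⟨1, zero_le_one, fun x => ?_⟩
    rw [decay_sq, one_mul, abs_of_pos (inv_pos.2 (quad_pos x))]
  | invLog =>
    refine ⟨1, zero_le_one, fun x => ?_⟩
    rw [pow_zero, mul_one, abs_of_nonneg (invLog_nonneg x)]
    exact invLog_le_one x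
  | mul _ _ ihf ihg =>
    obtain ⟨C, hC, h⟩ := ihf
    obtain ⟨D, hD, h'⟩ := ihg
    refine ⟨C * D, by positivity, fun x => ?_⟩
    rw [abs_mul, pow_add, mul_mul_mul_comm]
    exact mul_le_mul (h x) (h' x) (abs_nonneg _)
      (mul_nonneg hC (pow_nonneg (decay_pos x).le _))
  | add _ _ ihf ihg =>
    obtain ⟨C, hC, h⟩ := ihf
    obtain ⟨D, hD, h'⟩ := ihg
    refine ⟨C + D, by positivity, fun x => (abs_add_le _ _).trans ?_⟩
    rw [add_mul]
    exact add_le_add (h x) (h' x)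

lemma hasFDerivAt_inv_quad (x : E3) :
    HasFDerivAt (fun x => (quad x)⁻¹) (-(quad x ^ 2)⁻¹ • (2 • innerSL ℝ x)) x :=
  (hasDerivAt_inv (quad_pos x).ne').comp_hasFDerivAt x (hasFDerivAt_quad x)

lemma hasFDerivAt_invLog (x : E3) :
    HasFDerivAt invLog
      (-(Real.log (quad x) ^ 2)⁻¹ • ((quad x)⁻¹ • (2 • innerSL ℝ x))) x :=
  (hasDerivAt_inv (zero_lt_one.trans_le (one_le_log_quad x)).ne').comp_hasFDerivAt x
    ((hasFDerivAt_quad x).log (quad_pos x).ne')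

lemma hasFDerivAt_coord (i : Fin 3) (x : E3) :
    HasFDerivAt (fun x : E3 => x i) (EuclideanSpace.proj i : E3 →L[ℝ] ℝ) x :=
  (EuclideanSpace.proj i : E3 →L[ℝ] ℝ).hasFDerivAt

lemma IsSymbol.differentiable {m : ℕ} {f : E3 → ℝ} (hf : IsSymbol m f) : Differentiable ℝ f := by
  induction hf with
  | const c => exact differentiable_const c
  | coord i =>
    exact fun x => (hasFDerivAt_coord i x).differentiableAt.mul
      (hasFDerivAt_inv_quad x).differentiableAt
  | inv => exact fun x => (hasFDerivAt_inv_quad x).differentiableAt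
  | invLog => exact fun x => (hasFDerivAt_invLog x).differentiableAt
  | mul _ _ ihf ihg => exact ihf.mul ihg
  | add _ _ ihf ihg => exact ihf.add ihg

lemma IsSymbol.continuous {m : ℕ} {f : E3 → ℝ} (hf : IsSymbol m f) : Continuous f :=
  hf.differentiable.continuous

lemma partialDeriv_mul {f g : E3 → ℝ} (hf : Differentiable ℝ f) (hg : Differentiable ℝ g)
    (i : Fin 3) (x : E3) : partialDeriv i (fun x => f x * g x) x =
      partialDeriv i f x * g x + f x * partialDeriv i g x := by
  rw [partialDeriv, fderiv_fun_mul (hf x) (hg x)]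
  simp [partialDeriv]
  ring

lemma partialDeriv_add {f g : E3 → ℝ} (hf : Differentiable ℝ f) (hg : Differentiable ℝ g)
    (i : Fin 3) (x : E3) : partialDeriv i (fun x => f x + g x) x =
      partialDeriv i f x + partialDeriv i g x := by
  rw [partialDeriv, fderiv_fun_add (hf x) (hg x)]
  rfl

lemma partialDeriv_coord (i j : Fin 3) (x : E3) :
    partialDeriv i (fun x : E3 => x j) x = if j = i then 1 else 0 := by
  rw [partialDeriv, (hasFDerivAt_coord j x).fderiv]
  simp

lemma partialDeriv_inv_quad (i : Fin 3) (x : E3) :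
    partialDeriv i (fun x => (quad x)⁻¹) x = -2 * (x i / quad x * (quad x)⁻¹) := by
  rw [partialDeriv, (hasFDerivAt_inv_quad x).fderiv, smul_apply,
    fderiv_quad_single, smul_eq_mul]
  have := (quad_pos x).ne'
  field_simp

lemma partialDeriv_invLog (i : Fin 3) (x : E3) :
    partialDeriv i invLog x = -2 * (x i / quad x * (invLog x * invLog x)) := by
  rw [partialDeriv, (hasFDerivAt_invLog x).fderiv, smul_apply,
    smul_apply, fderiv_quad_single, smul_eq_mul, smul_eq_mul, invLog_eq]
  have := (quad_pos x).ne'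
  have := (zero_lt_one.trans_le (one_le_log_quad x)).ne'
  field_simp

lemma IsSymbol.const_mul {m : ℕ} {f : E3 → ℝ} (hf : IsSymbol m f) (c : ℝ) :
    IsSymbol m fun x => c * f x := by
  simpa only [zero_add] using (IsSymbol.const c).mul hf

/-- Differentiation raises the order by one: the generators satisfy `∂ᵢ(xⱼ/q) = δᵢⱼ/q - 2 xᵢxⱼ/q²`,
`∂ᵢ(1/q) = -2 xᵢ/q²` and `∂ᵢ(1/log q) = -2 xᵢ / (q log² q)`. -/
lemma IsSymbol.partialDeriv {m : ℕ} {f : E3 → ℝ} (hf : IsSymbol m f) (i : Fin 3) :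
    IsSymbol (m + 1) (partialDeriv i f) := by
  induction hf with
  | const c =>
    have e : NavierStokes.partialDeriv i (fun _ : E3 => c) = fun x => 0 * (x i / quad x) := by
      funext x; simp [NavierStokes.partialDeriv]
    rw [e]
    exact (IsSymbol.coord i).const_mul 0
  | coord j =>
    have e : NavierStokes.partialDeriv i (fun x : E3 => x j / quad x) = fun x =>
        (if j = i then 1 else 0) * (quad x)⁻¹ + -2 * (x j / quad x * (x i / quad x)) := by
      funext x
      simp only [div_eq_mul_inv]
      rw [partialDeriv_mul (f := fun x : E3 => x j)
        (fun x => (hasFDerivAt_coord j x).differentiableAt) IsSymbol.inv.differentiable,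
        partialDeriv_coord, partialDeriv_inv_quad]
      ring
    rw [e]
    exact (IsSymbol.inv.const_mul _).add (((IsSymbol.coord j).mul (IsSymbol.coord i)).const_mul _)
  | inv =>
    rw [funext (partialDeriv_inv_quad i)]
    exact ((IsSymbol.coord i).mul IsSymbol.inv).const_mul _
  | invLog =>
    rw [funext (partialDeriv_invLog i)]
    exact ((IsSymbol.coord i).mul (IsSymbol.invLog.mul IsSymbol.invLog)).const_mul _
  | @mul m n f g hf hg ihf ihg =>
    rw [funext (partialDeriv_mul hf.differentiable hg.differentiable i)]
    have h := ihf.mul hg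
    rw [add_right_comm] at h
    exact h.add (hf.mul ihg)
  | add hf hg ihf ihg =>
    rw [funext (partialDeriv_add hf.differentiable hg.differentiable i)]
    exact ihf.add ihg

/-! ### The data: divergence and integrability -/

/-- The linear field `(x₂, -x₁, 0)`, tangent to the circles around the third axis. -/
def swirl (x : E3) : E3 := !₂[x 1, -x 0, 0]

lemma dotA_eq (η : ℝ) (x : E3) :
    dotA η x = (η * (2 * (invLog x * invLog x * (quad x)⁻¹))) • swirl x := by
  unfold dotA swirl
  rw [partialDeriv_invLog, partialDeriv_invLog]
  ext j
  fin_cases j <;> simp <;> ring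

lemma barA_eq (η : ℝ) (x : E3) :
    barA η x = (Real.sin (‖x‖ ^ 2) * (η * (2 * (invLog x * invLog x * (quad x)⁻¹)))) • swirl x := by
  rw [barA, dotA_eq, smul_smul]

lemma isSymbol_dotA (η : ℝ) (j : Fin 3) : IsSymbol 1 fun x => dotA η x j := by
  have h : ∀ i c, IsSymbol 1 fun x => c * partialDeriv i invLog x := fun i c =>
    (IsSymbol.invLog.partialDeriv i).const_mul c
  fin_cases j
  · simpa [dotA] using h 1 (-η)
  · simpa [dotA] using h 0 η
  · simpa [dotA] using h 0 0

/-- A differentiable function whose gradient is everywhere parallel to the position vector, as for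
every smooth radial function. -/
def HasRadialGradient (g : E3 → ℝ) : Prop :=
  Differentiable ℝ g ∧ ∃ h : E3 → ℝ, ∀ i x, partialDeriv i g x = x i * h x

lemma HasRadialGradient.mul {f g : E3 → ℝ} (hf : HasRadialGradient f) (hg : HasRadialGradient g) :
    HasRadialGradient fun x => f x * g x := by
  obtain ⟨hf, h, hh⟩ := hf
  obtain ⟨hg, k, hk⟩ := hg
  refine ⟨hf.mul hg, fun x => h x * g x + f x * k x, fun i x => ?_⟩
  rw [partialDeriv_mul hf hg, hh, hk]
  ring

lemma hasRadialGradient_const (c : ℝ) : HasRadialGradient fun _ => c :=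
  ⟨differentiable_const c, fun _ => 0, fun i x => by simp [partialDeriv]⟩

lemma hasRadialGradient_invLog : HasRadialGradient invLog :=
  ⟨IsSymbol.invLog.differentiable, fun x => -2 * (invLog x * invLog x) / quad x, fun i x => by
    rw [partialDeriv_invLog]; ring⟩

lemma hasRadialGradient_inv_quad : HasRadialGradient fun x => (quad x)⁻¹ :=
  ⟨IsSymbol.inv.differentiable, fun x => -2 * (quad x)⁻¹ / quad x, fun i x => by
    rw [partialDeriv_inv_quad]; ring⟩

lemma hasFDerivAt_sin_sq (c : ℝ) (x : E3) : HasFDerivAt (fun x => Real.sin (‖x‖ ^ 2 + c))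
    (Real.cos (‖x‖ ^ 2 + c) • (2 • innerSL ℝ x)) x :=
  ((hasStrictFDerivAt_norm_sq x).hasFDerivAt.add_const c).sin

lemma partialDeriv_sin_sq (c : ℝ) (i : Fin 3) (x : E3) :
    partialDeriv i (fun x => Real.sin (‖x‖ ^ 2 + c)) x =
      Real.cos (‖x‖ ^ 2 + c) * (2 * x i) := by
  rw [partialDeriv, (hasFDerivAt_sin_sq c x).fderiv, smul_apply, fderiv_quad_single, smul_eq_mul]

lemma hasRadialGradient_sin_sq : HasRadialGradient fun x => Real.sin (‖x‖ ^ 2) := by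
  have h : HasRadialGradient fun x => Real.sin (‖x‖ ^ 2 + 0) :=
    ⟨fun x => (hasFDerivAt_sin_sq 0 x).differentiableAt, fun x => Real.cos (‖x‖ ^ 2 + 0) * 2,
      fun i x => by rw [partialDeriv_sin_sq]; ring⟩
  simpa only [add_zero] using h

/-- The swirl is divergence-free and tangent to the spheres, hence orthogonal to radial
gradients. -/
lemma HasRadialGradient.isDivergenceFree {g : E3 → ℝ} (hg : HasRadialGradient g) :
    IsDivergenceFree fun x => g x • swirl x := by
  obtain ⟨hg, h, hh⟩ := hg
  have hc : ∀ i, Differentiable ℝ fun x : E3 => x i := fun i x =>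
    (hasFDerivAt_coord i x).differentiableAt
  refine ⟨hg.smul (differentiable_euclidean.2 fun i => ?_), fun x => ?_⟩
  · fin_cases i
    · simpa [swirl] using hc 1
    · simpa [swirl] using (hc 0).neg
    · simp [swirl]
  · have e0 : (fun y => (g y • swirl y) 0) = fun y => g y * y 1 := by funext y; simp [swirl]
    have e1 : (fun y => (g y • swirl y) 1) = fun y => (-1 * g y) * y 0 := by
      funext y; simp [swirl]
    have e2 : (fun y => (g y • swirl y) 2) = fun y => 0 := by funext y; simp [swirl]
    rw [Fin.sum_univ_three, e0, e1, e2, partialDeriv_mul hg (hc 1),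
      partialDeriv_mul (hg.const_mul (-1)) (hc 0), partialDeriv_mul (differentiable_const _) hg,
      hh, hh, partialDeriv_coord, partialDeriv_coord]
    simp [partialDeriv]
    ring

lemma hasRadialGradient_dotA_coeff (η : ℝ) :
    HasRadialGradient fun x => η * (2 * (invLog x * invLog x * (quad x)⁻¹)) :=
  (hasRadialGradient_const η).mul ((hasRadialGradient_const 2).mul
    ((hasRadialGradient_invLog.mul hasRadialGradient_invLog).mul hasRadialGradient_inv_quad))

lemma isDivergenceFree_dotA (η : ℝ) : IsDivergenceFree (dotA η) := by
  rw [funext (dotA_eq η)]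
  exact (hasRadialGradient_dotA_coeff η).isDivergenceFree

lemma isDivergenceFree_barA (η : ℝ) : IsDivergenceFree (barA η) := by
  rw [funext (barA_eq η)]
  exact (hasRadialGradient_sin_sq.mul (hasRadialGradient_dotA_coeff η)).isDivergenceFree

lemma continuous_dotA (η : ℝ) : Continuous (dotA η) := (isDivergenceFree_dotA η).1.continuous

lemma continuous_barA (η : ℝ) : Continuous (barA η) := (isDivergenceFree_barA η).1.continuous

lemma norm_swirl (x : E3) : ‖swirl x‖ = √(x 0 ^ 2 + x 1 ^ 2) := by
  rw [EuclideanSpace.norm_eq, Fin.sum_univ_three]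
  simp [swirl, add_comm]

lemma norm_swirl_le (x : E3) : ‖swirl x‖ ≤ ‖x‖ := by
  rw [norm_swirl, EuclideanSpace.norm_eq, Fin.sum_univ_three]
  refine Real.sqrt_le_sqrt ?_
  simp only [Real.norm_eq_abs, sq_abs]
  linarith [sq_nonneg (x 2)]

lemma norm_dotA (η : ℝ) (x : E3) :
    ‖dotA η x‖ = |η| * (2 * (invLog x ^ 2 * (quad x)⁻¹)) * ‖swirl x‖ := by
  have := (quad_pos x).le
  have := invLog_nonneg x
  rw [dotA_eq, norm_smul, norm_mul, Real.norm_eq_abs, Real.norm_of_nonneg (by positivity), sq]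

lemma norm_dotA_le (η : ℝ) (x : E3) : ‖dotA η x‖ ≤ 2 * |η| * (invLog x ^ 2 * decay x) := by
  rw [norm_dotA]
  have h0 := (quad_pos x).le
  have h1 := invLog_nonneg x
  have h2 : (quad x)⁻¹ * ‖swirl x‖ ≤ decay x := by
    rw [← decay_sq, sq, mul_assoc]
    refine mul_le_of_le_one_right (decay_pos x).le ?_
    rw [decay, inv_mul_le_one₀ (one_pos.trans_le (one_le_sqrt_quad x))]
    exact (norm_swirl_le x).trans (norm_le_sqrt_quad x)
  calc _ = 2 * |η| * (invLog x ^ 2 * ((quad x)⁻¹ * ‖swirl x‖)) := by ring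
    _ ≤ _ := by gcongr

lemma norm_dotA_le_decay (η : ℝ) (x : E3) : ‖dotA η x‖ ≤ 2 * |η| * decay x := by
  refine (norm_dotA_le η x).trans ?_
  have := pow_le_one₀ (n := 2) (invLog_nonneg x) (invLog_le_one x)
  have := decay_pos x
  gcongr
  nlinarith

lemma norm_barA_le (η : ℝ) (x : E3) : ‖barA η x‖ ≤ ‖dotA η x‖ := by
  rw [barA, norm_smul]
  exact mul_le_of_le_one_left (norm_nonneg _) (Real.abs_sin_le_one _)

/-- The function `q^{-3/2} log⁻² q` is integrable; in polar coordinates it is dominated by the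
derivative of `-1 / (2 log (e + r²))`. -/
lemma integrable_invLog_sq_mul_decay_pow :
    Integrable fun x : E3 => invLog x ^ 2 * decay x ^ 3 := by
  set f : ℝ → ℝ := fun r => (Real.log (Real.exp 1 + r ^ 2))⁻¹ ^ 2 *
    (√(Real.exp 1 + r ^ 2))⁻¹ ^ 3 with hf
  have he : (fun x : E3 => invLog x ^ 2 * decay x ^ 3) = fun x => f ‖x‖ := rfl
  rw [he, integrable_fun_norm_addHaar volume]
  have hpos : ∀ r : ℝ, 0 < Real.exp 1 + r ^ 2 := fun r => by positivity
  have hlog : ∀ r : ℝ, 0 < Real.log (Real.exp 1 + r ^ 2) := fun r => by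
    refine zero_lt_one.trans_le ((Real.le_log_iff_exp_le (hpos r)).2 ?_)
    exact le_add_of_nonneg_right (sq_nonneg r)
  set g : ℝ → ℝ := fun r => -(Real.log (Real.exp 1 + r ^ 2))⁻¹ with hg
  set g' : ℝ → ℝ := fun r => 2 * r / (Real.exp 1 + r ^ 2) / Real.log (Real.exp 1 + r ^ 2) ^ 2
  have hder : ∀ r, HasDerivAt g (g' r) r := fun r => by
    have h1 : HasDerivAt (fun r : ℝ => Real.exp 1 + r ^ 2) (2 * r) r := by
      simpa using (hasDerivAt_pow 2 r).const_add (Real.exp 1)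
    have h2 := ((h1.log (hpos r).ne').inv (hlog r).ne').neg
    refine h2.congr_deriv ?_
    simp only [g']
    ring
  have hlim : Tendsto g atTop (𝓝 0) := by
    have h1 : Tendsto (fun r : ℝ => Real.exp 1 + r ^ 2) atTop atTop :=
      tendsto_atTop_add_const_left _ _ (tendsto_pow_atTop two_ne_zero)
    simpa using (Real.tendsto_log_atTop.comp h1).inv_tendsto_atTop.neg
  have hint : IntegrableOn g' (Ioi 0) :=
    integrableOn_Ioi_deriv_of_nonneg (hder 0).continuousAt.continuousWithinAt
      (fun r _ => hder r) (fun r hr => by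
        have := hpos r; have := hlog r; have : 0 < r := hr; simp only [g']; positivity) hlim
  refine hint.mono' ?_ ((ae_restrict_iff' measurableSet_Ioi).2
    (Eventually.of_forall fun r hr => ?_))
  · refine Continuous.aestronglyMeasurable ?_
    have h1 : Continuous fun r : ℝ => (Real.log (Real.exp 1 + r ^ 2))⁻¹ :=
      (Continuous.log (by fun_prop) fun r => (hpos r).ne').inv₀ fun r => (hlog r).ne'
    have h2 : Continuous fun r : ℝ => (√(Real.exp 1 + r ^ 2))⁻¹ :=
      Continuous.inv₀ (by fun_prop) fun r => (Real.sqrt_pos.2 (hpos r)).ne'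
    exact (continuous_pow _).smul ((h1.pow 2).mul (h2.pow 3))
  · have hr0 : 0 < r := hr
    have h0 := hpos r
    have h1 := hlog r
    have h2 : √(Real.exp 1 + r ^ 2) ^ 2 = Real.exp 1 + r ^ 2 := Real.sq_sqrt h0.le
    have h3 : r ≤ √(Real.exp 1 + r ^ 2) :=
      Real.le_sqrt_of_sq_le (le_add_of_nonneg_left (Real.exp_pos 1).le)
    have h4 : 0 < √(Real.exp 1 + r ^ 2) := Real.sqrt_pos.2 h0
    rw [Real.norm_of_nonneg (by simp only [hf, smul_eq_mul]; positivity)]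
    simp only [hf, g', smul_eq_mul, finrank_euclideanSpace, Fintype.card_fin]
    set s := √(Real.exp 1 + r ^ 2)
    set L := Real.log (Real.exp 1 + r ^ 2)
    rw [← h2]
    calc r ^ (3 - 1) * (L⁻¹ ^ 2 * s⁻¹ ^ 3) = r * r / (s ^ 2 * s) / L ^ 2 := by
          field_simp
      _ ≤ 2 * r / s ^ 2 / L ^ 2 := by
          gcongr ?_ / _
          rw [div_le_div_iff₀ (by positivity) (by positivity)]
          nlinarith [mul_pos hr0 (pow_pos h4 2), mul_pos hr0 (pow_pos h4 3),
            mul_le_mul_of_nonneg_left h3 (mul_pos hr0 (pow_pos h4 2)).le]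

/-- The logarithm is what makes the critical decay `|x|⁻¹` integrable to the third power. -/
lemma memLp_three_dotA (η : ℝ) : MemLp (dotA η) 3 volume := by
  rw [← integrable_norm_rpow_iff (continuous_dotA η).aestronglyMeasurable (by norm_num)
    (by norm_num)]
  refine (integrable_invLog_sq_mul_decay_pow.const_mul ((2 * |η|) ^ 3)).mono'
    (((continuous_dotA η).norm.rpow_const fun x => Or.inr (by norm_num)).aestronglyMeasurable)
    (Eventually.of_forall fun x => ?_)
  have h0 := invLog_nonneg x
  have h1 := invLog_le_one x
  have h2 := decay_pos x
  rw [Real.norm_of_nonneg (by positivity), ENNReal.toReal_ofNat]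
  norm_cast
  calc ‖dotA η x‖ ^ 3 ≤ (2 * |η| * (invLog x ^ 2 * decay x)) ^ 3 := by
        gcongr; exact norm_dotA_le η x
    _ = (2 * |η|) ^ 3 * (invLog x ^ 6 * decay x ^ 3) := by ring
    _ ≤ _ := by
        gcongr ?_ * (?_ * _)
        exact pow_le_pow_of_le_one h0 h1 (by norm_num)

lemma memLp_three_barA (η : ℝ) : MemLp (barA η) 3 volume :=
  (memLp_three_dotA η).mono (continuous_barA η).aestronglyMeasurable
    (Eventually.of_forall (norm_barA_le η))

/-! ### The data: failure of integrability below the exponent three -/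

/-- A lower bound for the amplitude of `ȧ` at distance comparable to `R` from the third axis; the
logarithm is bounded by a small power. -/
lemma le_norm_dotA (η : ℝ) {ε R : ℝ} (hε : 0 < ε) (hR : 1 ≤ R) {y : E3} (h0 : R / 2 ≤ y 0)
    (hy : ‖y‖ ≤ 2 * R) :
    |η| * ε ^ 2 * (7 : ℝ) ^ (-(1 + 2 * ε)) * R ^ (-(1 + 4 * ε)) ≤ ‖dotA η y‖ := by
  have hR0 : 0 < R := one_pos.trans_le hR
  -- `e + (2R)² ≤ 7R²`
  have hq : quad y ≤ 7 * R ^ 2 := by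
    have := Real.exp_one_lt_d9
    unfold quad
    nlinarith [norm_nonneg y]
  have hq0 := quad_pos y
  have hsw : R / 2 ≤ ‖swirl y‖ := by
    rw [norm_swirl]
    refine Real.le_sqrt_of_sq_le ?_
    nlinarith [sq_nonneg (y 1)]
  have hlog0 := zero_lt_one.trans_le (one_le_log_quad y)
  have hlog : Real.log (quad y) ≤ (7 * R ^ 2) ^ ε / ε :=
    (Real.log_le_rpow_div hq0.le hε).trans (by gcongr)
  have hinv : ε / (7 * R ^ 2) ^ ε ≤ invLog y := by
    rw [invLog_eq, ← inv_div]
    exact inv_anti₀ hlog0 hlog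
  have e : |η| * ε ^ 2 * (7 : ℝ) ^ (-(1 + 2 * ε)) * R ^ (-(1 + 4 * ε)) =
      |η| * (2 * ((ε / (7 * R ^ 2) ^ ε) ^ 2 * (7 * R ^ 2)⁻¹)) * (R / 2) := by
    have h1 : ((7 : ℝ) * R ^ 2) ^ ε = 7 ^ ε * (R ^ ε) ^ 2 := by
      rw [Real.mul_rpow (by norm_num) (by positivity), ← Real.rpow_natCast R 2,
        ← Real.rpow_mul hR0.le, mul_comm _ ε, Real.rpow_mul hR0.le, Real.rpow_natCast]
    have h2 : (7 : ℝ) ^ (-(1 + 2 * ε)) = (7 * (7 ^ ε) ^ 2)⁻¹ := by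
      rw [Real.rpow_neg (by norm_num), Real.rpow_add (by norm_num), Real.rpow_one, mul_comm 2 ε,
        Real.rpow_mul (by norm_num)]
      norm_num
    have h3 : R ^ (-(1 + 4 * ε)) = (R * (R ^ ε) ^ 4)⁻¹ := by
      rw [Real.rpow_neg hR0.le, Real.rpow_add hR0, Real.rpow_one, mul_comm 4 ε,
        Real.rpow_mul hR0.le]
      norm_num
    rw [h1, h2, h3]
    have h4 : (7 : ℝ) ^ ε ≠ 0 := (Real.rpow_pos_of_pos (by norm_num) _).ne'
    have h5 : R ^ ε ≠ 0 := (Real.rpow_pos_of_pos hR0 _).ne'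
    field_simp
  rw [e, norm_dotA]
  gcongr

lemma abs_sin_sub_le (a b : ℝ) : |Real.sin (b - a)| ≤ |Real.sin a| + |Real.sin b| := by
  rw [Real.sin_sub, add_comm]
  refine (abs_sub _ _).trans (add_le_add ?_ ?_)
  · rw [abs_mul]
    exact mul_le_of_le_one_right (abs_nonneg _) (Real.abs_cos_le_one _)
  · rw [abs_mul]
    exact mul_le_of_le_one_left (abs_nonneg _) (Real.abs_cos_le_one _)

/-- A translation by `e₁ / (2R)` changes the phase `|x|²` by an amount that stays away from the
multiples of `π`, as long as `x₁` is close to `R`. -/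
lemma one_div_eight_le_abs_sin {R : ℝ} (hR : 1 ≤ R) {x : E3} (h1 : 3 / 4 * R ≤ x 0)
    (h2 : x 0 ≤ 5 / 4 * R) :
    1 / 8 ≤ |Real.sin (‖x‖ ^ 2)| ∨
      1 / 8 ≤ |Real.sin (‖x + EuclideanSpace.single 0 (1 / (2 * R))‖ ^ 2)| := by
  have hR0 : 0 < R := one_pos.trans_le hR
  set ρ := ‖x‖ ^ 2
  set ρ' := ‖x + EuclideanSpace.single 0 (1 / (2 * R))‖ ^ 2 with hρ'
  have hδ : ρ' - ρ = x 0 / R + 1 / (4 * R ^ 2) := by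
    rw [hρ', norm_add_sq_real, EuclideanSpace.inner_single_right, PiLp.norm_single,
      Real.norm_eq_abs, sq_abs]
    simp only [conj_trivial]
    field_simp
    ring
  have hl : 3 / 4 ≤ ρ' - ρ := by
    rw [hδ]
    have : 3 / 4 ≤ x 0 / R := by rwa [le_div_iff₀ hR0]
    have : 0 < 1 / (4 * R ^ 2) := by positivity
    linarith
  have hu : ρ' - ρ ≤ 3 / 2 := by
    rw [hδ]
    have h3 : x 0 / R ≤ 5 / 4 := by rwa [div_le_iff₀ hR0]
    have h4 : 1 / (4 * R ^ 2) ≤ 1 / 4 := by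
      rw [div_le_div_iff₀ (by positivity) (by norm_num)]
      nlinarith
    linarith
  have hsin := Real.mul_le_sin (x := ρ' - ρ) (by linarith) (by linarith [Real.pi_gt_three])
  have hpi : 1 / 4 ≤ 2 / Real.pi * (ρ' - ρ) := by
    have : 1 / 2 ≤ 2 / Real.pi := by
      rw [div_le_div_iff₀ (by norm_num) Real.pi_pos]
      linarith [Real.pi_le_four]
    nlinarith
  have h := abs_sin_sub_le ρ ρ'
  have := le_abs_self (Real.sin (ρ' - ρ))
  by_contra! hcon
  linarith [hcon.1, hcon.2]

/-- A lower bound for the mass of `|ā|ᵖ`, from the points near `R e₁`: at each of them or at its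
translate by `e₁ / (2R)` the sine is at least `1/8`. -/
lemma mul_volume_ball_le (η : ℝ) {ε R p : ℝ} (hε : 0 < ε) (hR : 1 ≤ R) (hp : 0 ≤ p) :
    ENNReal.ofReal (|η| * ε ^ 2 * (7 : ℝ) ^ (-(1 + 2 * ε)) * R ^ (-(1 + 4 * ε)) * (1 / 8)) ^ p *
      volume (Metric.ball (EuclideanSpace.single 0 R : E3) (R / 4)) ≤
        2 * ∫⁻ x, ‖barA η x‖ₑ ^ p := by
  have hR0 : 0 < R := one_pos.trans_le hR
  set m := |η| * ε ^ 2 * (7 : ℝ) ^ (-(1 + 2 * ε)) * R ^ (-(1 + 4 * ε)) with hm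
  have hm0 : 0 ≤ m := by positivity
  set v : E3 := EuclideanSpace.single 0 (1 / (2 * R)) with hv
  set B := Metric.ball (EuclideanSpace.single 0 R : E3) (R / 4) with hB
  have hlow : ∀ y : E3, R / 2 ≤ y 0 → ‖y‖ ≤ 2 * R → 1 / 8 ≤ |Real.sin (‖y‖ ^ 2)| →
      ENNReal.ofReal (m * (1 / 8)) ^ p ≤ ‖barA η y‖ₑ ^ p := fun y h0 hy hs => by
    refine ENNReal.rpow_le_rpow ?_ hp
    rw [← ofReal_norm]
    refine ENNReal.ofReal_le_ofReal ?_
    rw [barA, norm_smul, mul_comm, Real.norm_eq_abs]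
    exact mul_le_mul hs (le_norm_dotA η hε hR h0 hy) hm0 (abs_nonneg _)
  have hvn : ‖v‖ = 1 / (2 * R) := by
    rw [hv, PiLp.norm_single, Real.norm_of_nonneg (by positivity)]
  have hvle : 1 / (2 * R) ≤ R / 2 := by
    rw [div_le_div_iff₀ (by positivity) (by norm_num)]
    nlinarith
  have key : ∀ x ∈ B, ENNReal.ofReal (m * (1 / 8)) ^ p ≤
      ‖barA η x‖ₑ ^ p + ‖barA η (x + v)‖ₑ ^ p := fun x hx => by
    rw [hB, Metric.mem_ball, dist_eq_norm] at hx
    have h0 : |x 0 - R| ≤ R / 4 := by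
      have := PiLp.norm_apply_le (x - EuclideanSpace.single 0 R) 0
      simp only [PiLp.sub_apply, PiLp.single_apply, if_pos, Real.norm_eq_abs] at this
      exact this.trans hx.le
    have h0' := abs_le.1 h0
    have hn : ‖x‖ ≤ 5 / 4 * R := by
      have := norm_sub_norm_le x (EuclideanSpace.single 0 R)
      rw [PiLp.norm_single, Real.norm_of_nonneg hR0.le] at this
      linarith
    rcases one_div_eight_le_abs_sin hR (x := x) (by linarith) (by linarith) with h | h
    · exact (hlow x (by linarith) (by linarith) h).trans le_self_add
    · refine (hlow (x + v) ?_ ?_ h).trans le_add_self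
      · have : (0 : ℝ) < 1 / (2 * R) := by positivity
        simp only [PiLp.add_apply, hv, PiLp.single_apply, if_pos]
        linarith
      · refine (norm_add_le _ _).trans ?_
        rw [hvn]
        linarith
  have hmeas : Measurable fun x => ‖barA η x‖ₑ ^ p :=
    (continuous_barA η).measurable.enorm.pow_const p
  calc _ = ∫⁻ _ in B, ENNReal.ofReal (m * (1 / 8)) ^ p := by rw [setLIntegral_const]
    _ ≤ ∫⁻ x in B, (‖barA η x‖ₑ ^ p + ‖barA η (x + v)‖ₑ ^ p) :=
        setLIntegral_mono' Metric.isOpen_ball.measurableSet key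
    _ ≤ ∫⁻ x, (‖barA η x‖ₑ ^ p + ‖barA η (x + v)‖ₑ ^ p) := setLIntegral_le_lintegral _ _
    _ = _ := by
        rw [lintegral_add_left hmeas,
          lintegral_add_right_eq_self (fun x => ‖barA η x‖ₑ ^ p) v, two_mul]

/-- The balls of radius `R / 4` around `R e₁` carry a mass of order at least `R^{3-p}` up to
logarithms, which is unbounded in `R`. -/
lemma not_memLp_barA {η : ℝ} (hη : η ≠ 0) {p : ℝ≥0∞} (hp : 1 ≤ p) (hp3 : p < 3) :
    ¬ MemLp (barA η) p volume := by
  intro hmem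
  have hpt : p ≠ ∞ := hp3.ne_top
  have hp1 : 1 ≤ p.toReal := by rwa [← ENNReal.toReal_one, ENNReal.toReal_le_toReal (by simp) hpt]
  have hp3' : p.toReal < 3 := by
    rw [← ENNReal.toReal_ofNat]; exact (ENNReal.toReal_lt_toReal hpt (by simp)).2 hp3
  have hI := lintegral_rpow_enorm_lt_top_of_eLpNorm_lt_top (by positivity) hpt hmem.2
  set q := p.toReal
  have hq0 : 0 < q := by linarith
  -- the power absorbing the logarithms, so small that `R^{3-q}` only drops to `R^{(3-q)/2}`
  set ε : ℝ := (3 - q) / (8 * q) with hεd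
  have hε : 0 < ε := div_pos (by linarith) (by linarith)
  set c : ℝ := |η| * ε ^ 2 * (7 : ℝ) ^ (-(1 + 2 * ε)) / 8 with hcd
  have hη0 : 0 < |η| := abs_pos.2 hη
  have hc : 0 < c := by positivity
  set V := volume (Metric.ball (0 : E3) 1) with hV
  have hV0 : V ≠ 0 := (Metric.measure_ball_pos volume _ one_pos).ne'
  have hVt : V ≠ ∞ := measure_ball_lt_top.ne
  set I := 2 * ∫⁻ x, ‖barA η x‖ₑ ^ q with hId
  have hIt : I ≠ ∞ := ENNReal.mul_ne_top (by simp) hI.ne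
  have hbound : ∀ R : ℝ, 1 ≤ R → c ^ q / 64 * R ^ ((3 - q) / 2) ≤ (I / V).toReal := fun R hR => by
    have hR0 : 0 < R := one_pos.trans_le hR
    have h := mul_volume_ball_le η (p := q) hε hR hq0.le
    rw [Measure.addHaar_ball volume _ (by positivity), ← mul_assoc,
      ENNReal.ofReal_rpow_of_nonneg (by positivity) hq0.le, ← ENNReal.ofReal_mul (by positivity),
      ← ENNReal.le_div_iff_mul_le (Or.inl hV0) (Or.inl hVt)] at h
    have h' := (ENNReal.ofReal_le_iff_le_toReal (ENNReal.div_ne_top hIt hV0)).1 h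
    refine le_trans (le_of_eq ?_) h'
    have e1 : |η| * ε ^ 2 * (7 : ℝ) ^ (-(1 + 2 * ε)) * R ^ (-(1 + 4 * ε)) * (1 / 8) =
        c * R ^ (-(1 + 4 * ε)) := by rw [hcd]; ring
    have e2 : R ^ ((3 - q) / 2) = R ^ (-(1 + 4 * ε) * q) * R ^ 3 := by
      rw [← Real.rpow_natCast R 3, ← Real.rpow_add hR0]
      congr 1
      rw [hεd]
      field_simp
      push_cast
      ring
    rw [e1, Real.mul_rpow hc.le (by positivity), ← Real.rpow_mul hR0.le, e2,
      finrank_euclideanSpace, Fintype.card_fin]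
    ring
  have htend : Tendsto (fun R : ℝ => c ^ q / 64 * R ^ ((3 - q) / 2)) atTop atTop :=
    (tendsto_rpow_atTop (by linarith)).const_mul_atTop (by positivity)
  obtain ⟨R, hR1, hR2⟩ := ((eventually_ge_atTop (1 : ℝ)).and
    (htend.eventually_gt_atTop (I / V).toReal)).exists
  exact (hbound R hR1).not_gt hR2

/-- Since `|ā| ≤ |ȧ|`, the failure for `ā` implies that for `ȧ`. -/
lemma not_memLp_dotA {η : ℝ} (hη : η ≠ 0) {p : ℝ≥0∞} (hp : 1 ≤ p) (hp3 : p < 3) :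
    ¬ MemLp (dotA η) p volume := fun h =>
  not_memLp_barA hη hp hp3 (h.mono (continuous_barA η).aestronglyMeasurable
    (Eventually.of_forall (norm_barA_le η)))

/-! ### Oscillating symbols and non-stationary phase -/

/-- The convolution of `F` with the kernel `r⁻³ K (· / r)`, written as an integral against `K`. -/
def scaledConv (K : 𝓢(E3, ℝ)) (r : ℝ) (F : E3 → ℝ) (x : E3) : ℝ :=
  ∫ z, K z * F (x - r • z)

/-- Bounded measurable functions. -/
def IsBoundedMeasurable (F : E3 → ℝ) : Prop := Measurable F ∧ ∃ C, ∀ x, |F x| ≤ C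

lemma IsBoundedMeasurable.integrable {F : E3 → ℝ} (hF : IsBoundedMeasurable F) (K : 𝓢(E3, ℝ))
    (r : ℝ) (x : E3) : Integrable fun z => K z * F (x - r • z) := by
  obtain ⟨hm, C, hC⟩ := hF
  exact K.integrable.mul_bdd (c := C) (hm.comp (by fun_prop)).aestronglyMeasurable
    (Eventually.of_forall fun _ => hC _)

lemma IsBoundedMeasurable.add {F G : E3 → ℝ} (hF : IsBoundedMeasurable F)
    (hG : IsBoundedMeasurable G) : IsBoundedMeasurable fun x => F x + G x := by
  obtain ⟨hm, C, hC⟩ := hF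
  obtain ⟨hm', D, hD⟩ := hG
  exact ⟨hm.add hm', C + D, fun x => (abs_add_le _ _).trans (add_le_add (hC x) (hD x))⟩

lemma IsBoundedMeasurable.mul {F G : E3 → ℝ} (hF : IsBoundedMeasurable F)
    (hG : IsBoundedMeasurable G) : IsBoundedMeasurable fun x => F x * G x := by
  obtain ⟨hm, C, hC⟩ := hF
  obtain ⟨hm', D, hD⟩ := hG
  refine ⟨hm.mul hm', C * D, fun x => ?_⟩
  rw [abs_mul]
  exact mul_le_mul (hC x) (hD x) (abs_nonneg _) ((abs_nonneg _).trans (hC x))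

lemma IsSymbol.isBoundedMeasurable {m : ℕ} {f : E3 → ℝ} (hf : IsSymbol m f) :
    IsBoundedMeasurable f := by
  obtain ⟨C, hC, h⟩ := hf.exists_bound
  refine ⟨hf.continuous.measurable, C, fun x => (h x).trans ?_⟩
  exact mul_le_of_le_one_right hC (pow_le_one₀ (decay_pos x).le (decay_le_one x))

lemma scaledConv_add {F G : E3 → ℝ} (hF : IsBoundedMeasurable F) (hG : IsBoundedMeasurable G)
    (K : 𝓢(E3, ℝ)) (r : ℝ) (x : E3) :
    scaledConv K r (fun y => F y + G y) x = scaledConv K r F x + scaledConv K r G x := by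
  simp_rw [scaledConv, mul_add]
  exact integral_add (hF.integrable K r x) (hG.integrable K r x)

/-- The partial derivative of a Schwartz function. -/
def schwartzPartial (i : Fin 3) (K : 𝓢(E3, ℝ)) : 𝓢(E3, ℝ) :=
  LineDeriv.lineDerivOp (EuclideanSpace.single i (1 : ℝ) : E3) K

lemma schwartzPartial_apply (i : Fin 3) (K : 𝓢(E3, ℝ)) (z : E3) :
    schwartzPartial i K z = fderiv ℝ K z (EuclideanSpace.single i 1) :=
  SchwartzMap.lineDerivOp_apply_eq_fderiv _ _ _

/-- A derivative falling on `G` is moved to the kernel, at the price of a factor `1 / r`. -/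
lemma scaledConv_partialDeriv {G : E3 → ℝ} (hG : Differentiable ℝ G) (hb : IsBoundedMeasurable G)
    {i : Fin 3} (hb' : IsBoundedMeasurable (partialDeriv i G)) (K : 𝓢(E3, ℝ)) {r : ℝ}
    (hr : r ≠ 0) (x : E3) :
    scaledConv K r (partialDeriv i G) x = r⁻¹ * scaledConv (schwartzPartial i K) r G x := by
  have hd : ∀ z, HasFDerivAt (fun z => G (x - r • z))
      ((fderiv ℝ G (x - r • z)).comp (-(r • ContinuousLinearMap.id ℝ E3))) z := fun z =>
    (hG _).hasFDerivAt.comp z (((hasFDerivAt_id z).const_smul r).const_sub x)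
  have hd' : ∀ z, fderiv ℝ (fun z => G (x - r • z)) z (EuclideanSpace.single i 1) =
      -r * partialDeriv i G (x - r • z) := fun z => by
    rw [(hd z).fderiv, partialDeriv]
    simp
  have h := integral_mul_fderiv_eq_neg_fderiv_mul_of_integrable (μ := (volume : Measure E3))
    (f := K) (g := fun z => G (x - r • z)) (v := EuclideanSpace.single i 1)
    (by simp_rw [← schwartzPartial_apply]; exact hb.integrable _ r x)
    (by
      simp_rw [hd', mul_left_comm _ (-r)]
      exact (hb'.integrable K r x).const_mul (-r))
    (hb.integrable K r x) (fun z _ => K.differentiable z)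
    (fun z _ => (hd z).differentiableAt)
  simp_rw [hd', mul_left_comm _ (-r), ← schwartzPartial_apply] at h
  rw [integral_const_mul, neg_mul, neg_inj] at h
  rw [scaledConv, scaledConv, ← h, ← mul_assoc, inv_mul_cancel₀ hr, one_mul]

/-- The weighted `L¹` norms of a Schwartz kernel are finite. -/
lemma integrable_abs_mul_one_add_norm_pow (K : 𝓢(E3, ℝ)) (c : ℝ) (m : ℕ) :
    Integrable fun z => |K z| * (1 + c * ‖z‖) ^ m := by
  have h : ∀ z, |K z| * (1 + c * ‖z‖) ^ m =
      ∑ k ∈ Finset.range (m + 1), c ^ (m - k) * m.choose k * (‖z‖ ^ (m - k) * ‖K z‖) := fun z => by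
    rw [add_pow, Finset.mul_sum, Real.norm_eq_abs]
    exact Finset.sum_congr rfl fun k _ => by rw [mul_pow, one_pow]; ring
  simp_rw [h]
  exact integrable_finsetSum _ fun k _ => (K.integrable_pow_mul volume (m - k)).const_mul _

/-- The convolution with a Schwartz kernel preserves the order of decay. -/
lemma exists_bound_scaledConv_of_le {m : ℕ} {C : ℝ} (hC : 0 ≤ C) (K : 𝓢(E3, ℝ)) {r₀ : ℝ}
    (hr₀ : 0 ≤ r₀) :
    ∃ D, 0 ≤ D ∧ ∀ F : E3 → ℝ, (∀ x, |F x| ≤ C * decay x ^ m) → ∀ r, 0 < r → r ≤ r₀ → ∀ x,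
      |scaledConv K r F x| ≤ D * decay x ^ m := by
  refine ⟨C * ∫ z, |K z| * (1 + r₀ * ‖z‖) ^ m, ?_, fun F hF r hr hrr x => ?_⟩
  · exact mul_nonneg hC (integral_nonneg fun z => by positivity)
  · rw [scaledConv, ← Real.norm_eq_abs]
    refine (norm_integral_le_of_norm_le (((integrable_abs_mul_one_add_norm_pow K r₀ m).const_mul
      (C * decay x ^ m))) (Eventually.of_forall fun z => ?_)).trans_eq ?_
    · rw [norm_mul, Real.norm_eq_abs, Real.norm_eq_abs]
      have h1 : decay (x - r • z) ≤ (1 + r₀ * ‖z‖) * decay x := by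
        refine (decay_sub_le x (r • z)).trans ?_
        rw [norm_smul, Real.norm_of_nonneg hr.le]
        have := (decay_pos x).le
        gcongr
      calc |K z| * |F (x - r • z)| ≤ |K z| * (C * ((1 + r₀ * ‖z‖) * decay x) ^ m) := by
            refine mul_le_mul_of_nonneg_left ((hF _).trans ?_) (abs_nonneg _)
            have := (decay_pos (x - r • z)).le
            gcongr
        _ = _ := by rw [mul_pow]; ring
    · rw [integral_const_mul]
      ring

/-- The oscillating factor `sin (|x|² + c)`. -/
def osc (c : ℝ) (x : E3) : ℝ := Real.sin (‖x‖ ^ 2 + c)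

lemma isBoundedMeasurable_osc (c : ℝ) : IsBoundedMeasurable (osc c) :=
  ⟨by unfold osc; fun_prop, 1, fun _ => Real.abs_sin_le_one _⟩

lemma differentiable_osc (c : ℝ) : Differentiable ℝ (osc c) := fun x =>
  (hasFDerivAt_sin_sq c x).differentiableAt

lemma abs_osc_mul_le (c : ℝ) (f : E3 → ℝ) (x : E3) : |osc c x * f x| ≤ |f x| := by
  rw [abs_mul]
  exact mul_le_of_le_one_left (abs_nonneg _) (Real.abs_sin_le_one _)

/-- The symbol `xᵢ f / (2 q)`: differentiating `sin (|x|² + c - π/2)` times it, and summing over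
`i`, gives `sin (|x|² + c) |x|² f / q` and terms of higher order. -/
def radialPart (f : E3 → ℝ) (i : Fin 3) (x : E3) : ℝ := 1 / 2 * (x i / quad x * f x)

lemma IsSymbol.radialPart {m : ℕ} {f : E3 → ℝ} (hf : IsSymbol m f) (i : Fin 3) :
    IsSymbol (m + 1) (radialPart f i) := by
  have h := ((IsSymbol.coord i).mul hf).const_mul (1 / 2)
  rwa [add_comm] at h

lemma partialDeriv_osc_mul_radialPart {m : ℕ} {f : E3 → ℝ} (hf : IsSymbol m f) (c : ℝ) (i : Fin 3)
    (x : E3) : partialDeriv i (fun x => osc (c - Real.pi / 2) x * radialPart f i x) x =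
      osc c x * (x i * (x i / quad x) * f x) +
        osc (c - Real.pi / 2) x * partialDeriv i (radialPart f i) x := by
  rw [partialDeriv_mul (differentiable_osc _) (hf.radialPart i).differentiable]
  congr 1
  have e : partialDeriv i (osc (c - Real.pi / 2)) x =
      Real.cos (‖x‖ ^ 2 + (c - Real.pi / 2)) * (2 * x i) := partialDeriv_sin_sq _ _ _
  rw [e, ← add_sub_assoc, Real.cos_sub_pi_div_two, radialPart, osc]
  ring

/-- Although the derivative of the oscillating factor grows like `|x|`, the factor `xᵢ / q` of the
radial part compensates it. -/
lemma isBoundedMeasurable_partialDeriv_osc {m : ℕ} {f : E3 → ℝ} (hf : IsSymbol m f) (c : ℝ)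
    (i : Fin 3) : IsBoundedMeasurable
      (partialDeriv i fun x => osc (c - Real.pi / 2) x * radialPart f i x) := by
  rw [funext (partialDeriv_osc_mul_radialPart hf c i)]
  have h1 : IsBoundedMeasurable fun x : E3 => x i * (x i / quad x) := by
    refine ⟨((EuclideanSpace.proj i : E3 →L[ℝ] ℝ).continuous.mul
      (IsSymbol.coord i).continuous).measurable, 1, fun x => ?_⟩
    have h0 := quad_pos x
    beta_reduce
    rw [← mul_div_assoc, abs_of_nonneg (div_nonneg (mul_self_nonneg _) h0.le), div_le_one h0,
      ← abs_mul_abs_self]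
    have h2 : |x i| ≤ ‖x‖ := PiLp.norm_apply_le x i
    have := Real.exp_pos 1
    unfold quad
    nlinarith [abs_nonneg (x i)]
  exact ((isBoundedMeasurable_osc c).mul (h1.mul hf.isBoundedMeasurable)).add
    ((isBoundedMeasurable_osc _).mul ((hf.radialPart i).partialDeriv i).isBoundedMeasurable)

/-- The part of `f` left out by `|x|² f / q = f - e f / q`. -/
def inverseQuadPart (f : E3 → ℝ) (x : E3) : ℝ := Real.exp 1 * ((quad x)⁻¹ * f x)

lemma IsSymbol.inverseQuadPart {m : ℕ} {f : E3 → ℝ} (hf : IsSymbol m f) :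
    IsSymbol (m + 2) (inverseQuadPart f) := by
  have h := (IsSymbol.inv.mul hf).const_mul (Real.exp 1)
  rwa [add_comm] at h

/-- Since `∇ sin (|x|² + c - π/2) = 2 x sin (|x|² + c)`, the oscillating function `sin (|x|² + c) f`
is a divergence up to terms that decay faster. -/
lemma osc_mul_eq {m : ℕ} {f : E3 → ℝ} (hf : IsSymbol m f) (c : ℝ) (x : E3) :
    osc c x * f x = osc c x * inverseQuadPart f x +
      ∑ i, (partialDeriv i (fun x => osc (c - Real.pi / 2) x * radialPart f i x) x +
        osc (c - Real.pi / 2) x * (-1 * partialDeriv i (radialPart f i) x)) := by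
  simp_rw [partialDeriv_osc_mul_radialPart hf]
  have hq := (quad_pos x).ne'
  have hn : quad x = Real.exp 1 + (x 0 ^ 2 + x 1 ^ 2 + x 2 ^ 2) := by
    rw [quad, EuclideanSpace.real_norm_sq_eq, Fin.sum_univ_three]
  rw [Fin.sum_univ_three, inverseQuadPart]
  field_simp
  rw [hn]
  ring

/-- The non-stationary phase estimate: each integration by parts gains one order of decay and costs
one factor `1 / r`. -/
theorem exists_bound_scaledConv_osc {r₀ : ℝ} (hr₀ : 0 ≤ r₀) (n : ℕ) : ∀ (m : ℕ) (f : E3 → ℝ) (c : ℝ)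
    (K : 𝓢(E3, ℝ)), IsSymbol m f → ∃ C, 0 ≤ C ∧ ∀ r, 0 < r → r ≤ r₀ → ∀ x,
      |scaledConv K r (fun y => osc c y * f y) x| ≤ C * r⁻¹ ^ n * decay x ^ (m + n) := by
  induction n with
  | zero =>
    intro m f c K hf
    obtain ⟨C, hC, h⟩ := hf.exists_bound
    obtain ⟨D, hD, h'⟩ := exists_bound_scaledConv_of_le (m := m) hC K hr₀
    refine ⟨D, hD, fun r hr hrr x => ?_⟩
    simpa using h' _ (fun x => (abs_osc_mul_le c f x).trans (h x)) r hr hrr x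
  | succ n ih =>
    intro m f c K hf
    obtain ⟨C, hC, h⟩ := ih (m + 2) _ c K hf.inverseQuadPart
    choose D hD hD' using fun i => ih (m + 1) _ (c - Real.pi / 2) (schwartzPartial i K)
      (hf.radialPart i)
    choose B hB hB' using fun i => ih (m + 1 + 1) _ (c - Real.pi / 2) K
      (((hf.radialPart i).partialDeriv i).const_mul (-1))
    refine ⟨C * r₀ + ∑ i, (D i + B i * r₀), add_nonneg (mul_nonneg hC hr₀)
      (Finset.sum_nonneg fun i _ => add_nonneg (hD i) (mul_nonneg (hB i) hr₀)),
      fun r hr hrr x => ?_⟩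
    have hbo := isBoundedMeasurable_osc
    have b1 := (hbo c).mul hf.inverseQuadPart.isBoundedMeasurable
    have b2 := fun i => isBoundedMeasurable_partialDeriv_osc hf c i
    have b3 := fun i => (hbo (c - Real.pi / 2)).mul
      (((hf.radialPart i).partialDeriv i).const_mul (-1)).isBoundedMeasurable
    have b4 := fun i => (hbo (c - Real.pi / 2)).mul (hf.radialPart i).isBoundedMeasurable
    have b5 : ∀ i, Differentiable ℝ fun x => osc (c - Real.pi / 2) x * radialPart f i x :=
      fun i => (differentiable_osc (c - Real.pi / 2)).mul (hf.radialPart i).differentiable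
    have e : scaledConv K r (fun y => osc c y * f y) x =
        scaledConv K r (fun y => osc c y * inverseQuadPart f y) x +
        ∑ i, (r⁻¹ * scaledConv (schwartzPartial i K) r
            (fun y => osc (c - Real.pi / 2) y * radialPart f i y) x +
          scaledConv K r (fun y => osc (c - Real.pi / 2) y *
            (-1 * partialDeriv i (radialPart f i) y)) x) := by
      rw [funext (osc_mul_eq hf c)]
      simp_rw [Fin.sum_univ_three]
      rw [scaledConv_add b1 ((((b2 0).add (b3 0)).add ((b2 1).add (b3 1))).add ((b2 2).add (b3 2))),
        scaledConv_add (((b2 0).add (b3 0)).add ((b2 1).add (b3 1))) ((b2 2).add (b3 2)),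
        scaledConv_add ((b2 0).add (b3 0)) ((b2 1).add (b3 1)),
        scaledConv_add (b2 0) (b3 0), scaledConv_add (b2 1) (b3 1), scaledConv_add (b2 2) (b3 2)]
      have hs := fun i => scaledConv_partialDeriv (b5 i) (b4 i) (b2 i) K hr.ne' x
      rw [hs 0, hs 1, hs 2]
    have hw := (decay_pos x).le
    -- the two remainders decay faster by one order, and carry one factor `1 / r` less
    have hrem : ∀ A : ℝ, 0 ≤ A → A * r⁻¹ ^ n * decay x ^ (m + 2 + n) ≤
        A * r₀ * r⁻¹ ^ (n + 1) * decay x ^ (m + (n + 1)) := fun A hA => by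
      have h1 : r⁻¹ ^ n ≤ r₀ * r⁻¹ ^ (n + 1) := by
        rw [pow_succ, mul_left_comm, ← div_eq_mul_inv]
        exact le_mul_of_one_le_right (by positivity) ((one_le_div hr).2 hrr)
      have h2 : decay x ^ (m + 2 + n) ≤ decay x ^ (m + (n + 1)) :=
        pow_le_pow_of_le_one hw (decay_le_one x) (by omega)
      calc _ ≤ A * (r₀ * r⁻¹ ^ (n + 1)) * decay x ^ (m + (n + 1)) := by gcongr
        _ = _ := by ring
    rw [e, add_mul, add_mul, Finset.sum_mul, Finset.sum_mul]
    refine (abs_add_le _ _).trans (add_le_add ((h r hr hrr x).trans (hrem C hC)) ?_)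
    refine (Finset.abs_sum_le_sum_abs _ _).trans (Finset.sum_le_sum fun i _ => ?_)
    rw [add_mul, add_mul]
    refine (abs_add_le _ _).trans (add_le_add ?_ ((hB' i r hr hrr x).trans (hrem _ (hB i))))
    rw [abs_mul, abs_of_pos (inv_pos.2 hr)]
    refine (mul_le_mul_of_nonneg_left (hD' i r hr hrr x) (inv_pos.2 hr).le).trans_eq ?_
    rw [show m + 1 + n = m + (n + 1) by omega]
    ring

/-! ### The heat flow of the oscillating datum -/

lemma decay_rpow_le {α : ℝ} (hα : 0 ≤ α) (x : E3) : decay x ^ α ≤ (1 + ‖x‖ ^ 2) ^ (-α / 2) := by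
  have h1 : 1 + ‖x‖ ^ 2 ≤ quad x := by
    have := Real.add_one_le_exp (1 : ℝ)
    unfold quad
    linarith
  have h2 : decay x ≤ (1 + ‖x‖ ^ 2) ^ (-(1 / 2) : ℝ) := by
    rw [decay, Real.rpow_neg (by positivity), ← Real.sqrt_eq_rpow]
    exact inv_anti₀ (by positivity) (Real.sqrt_le_sqrt h1)
  refine (Real.rpow_le_rpow (decay_pos x).le h2 hα).trans_eq ?_
  rw [← Real.rpow_mul (by positivity)]
  congr 1
  ring

lemma integrable_decay_rpow {α : ℝ} (hα : 3 < α) : Integrable fun x => decay x ^ α := by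
  refine (integrable_rpow_neg_one_add_norm_sq (E := E3) (μ := volume) (r := α)
    (by simpa using hα)).mono'
    (continuous_decay.rpow_const fun x => Or.inr (by linarith)).aestronglyMeasurable
    (Eventually.of_forall fun x => ?_)
  rw [Real.norm_of_nonneg (Real.rpow_nonneg (decay_pos x).le _)]
  exact decay_rpow_le (by linarith) x

lemma norm_E3_le_sum (v : E3) : ‖v‖ ≤ ∑ j, |v j| := by
  rw [EuclideanSpace.norm_eq]
  refine Real.sqrt_le_iff.2 ⟨Finset.sum_nonneg fun j _ => abs_nonneg _, ?_⟩
  simp only [Real.norm_eq_abs]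
  exact Finset.sum_sq_le_sq_sum_of_nonneg fun j _ => abs_nonneg _

/-- The components of the heat flow are convolutions with a rescaled Schwartz kernel. -/
lemma heatScaled_apply {a : E3 → E3} (ha : Measurable a) {A : ℝ} (hA : ∀ x, ‖a x‖ ≤ A) (r : ℝ)
    (x : E3) (j : Fin 3) :
    heatScaled r a x j = scaledConv (heatSchwartz 1 one_pos) r (fun y => a y j) x := by
  have hint : Integrable fun z => heatKernel 1 z • a (x - r • z) :=
    integrable_heatKernel_smul one_pos (measurable_translate ha r x) fun _ => hA _
  have h := (EuclideanSpace.proj j : E3 →L[ℝ] ℝ).integral_comp_comm hint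
  rw [heatScaled, scaledConv]
  refine Eq.trans h.symm ?_
  simp [heatSchwartz_apply]

lemma norm_dotA_le_const (η : ℝ) (x : E3) : ‖dotA η x‖ ≤ 2 * |η| :=
  (norm_dotA_le_decay η x).trans (mul_le_of_le_one_right (by positivity) (decay_le_one x))

lemma norm_barA_le_const (η : ℝ) (x : E3) : ‖barA η x‖ ≤ 2 * |η| :=
  (norm_barA_le η x).trans (norm_dotA_le_const η x)

/-- The heat flow makes the oscillating datum decay to any order, with the corresponding loss for
small times. -/
lemma exists_bound_heatScaled_barA (η : ℝ) {r₀ : ℝ} (hr₀ : 0 ≤ r₀) (n : ℕ) :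
    ∃ C, 0 ≤ C ∧ ∀ r, 0 < r → r ≤ r₀ → ∀ x,
      ‖heatScaled r (barA η) x‖ ≤ C * r⁻¹ ^ n * decay x ^ (1 + n) := by
  choose C hC h using fun j => exists_bound_scaledConv_osc hr₀ n 1 (fun x => dotA η x j) 0
    (heatSchwartz 1 one_pos) (isSymbol_dotA η j)
  refine ⟨∑ j, C j, Finset.sum_nonneg fun j _ => hC j, fun r hr hrr x => ?_⟩
  refine (norm_E3_le_sum _).trans ?_
  rw [Finset.sum_mul, Finset.sum_mul]
  refine Finset.sum_le_sum fun j _ => ?_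
  rw [heatScaled_apply (continuous_barA η).measurable (norm_barA_le_const η)]
  have e : (fun y => barA η y j) = fun y => osc 0 y * dotA η y j := by
    funext y
    simp [barA, osc]
  rw [e]
  exact h j r hr hrr x

/-- Three integrations by parts give the decay `|x|⁻⁴`, which is integrable. -/
lemma lintegral_enorm_heat_barA_ne_top (η : ℝ) {t : ℝ} (ht : 0 < t) :
    ∫⁻ x, ‖heat t (barA η) x‖ₑ ≠ ∞ := by
  obtain ⟨C, hC, h⟩ := exists_bound_heatScaled_barA η (Real.sqrt_nonneg t) 3
  have hint := (integrable_decay_rpow (α := 4) (by norm_num)).const_mul (C * (√t)⁻¹ ^ 3)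
  refine ((lintegral_mono fun x => ?_).trans_lt hint.lintegral_lt_top).ne
  rw [heat_eq_heatScaled ht, ← ofReal_norm]
  refine ENNReal.ofReal_le_ofReal ((h _ (Real.sqrt_pos.2 ht) le_rfl x).trans_eq ?_)
  norm_cast

/-- The square of the `L²` norm of `e^{sΔ} ā` is `O(s^{-3/4})`, hence integrable near `s = 0`. -/
lemma exists_lintegral_heat_barA_sq_le (η t : ℝ) :
    ∃ C, 0 ≤ C ∧ ∀ s, 0 < s → s ≤ t →
      ∫⁻ x, ‖heat s (barA η) x‖ₑ ^ (2 : ℝ) ≤ ENNReal.ofReal (C * s ^ (-(3 / 4) : ℝ)) := by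
  obtain ⟨C, hC, h⟩ := exists_bound_heatScaled_barA η (Real.sqrt_nonneg t) 0
  obtain ⟨D, hD, h'⟩ := exists_bound_heatScaled_barA η (Real.sqrt_nonneg t) 1
  have hint := integrable_decay_rpow (α := 7 / 2) (by norm_num)
  have hnn : ∀ x, 0 ≤ decay x ^ (7 / 2 : ℝ) := fun x => Real.rpow_nonneg (decay_pos x).le _
  set J := ∫ x, decay x ^ (7 / 2 : ℝ) with hJ
  have hJ0 : 0 ≤ J := integral_nonneg hnn
  refine ⟨C ^ (1 / 2 : ℝ) * D ^ (3 / 2 : ℝ) * J, by positivity, fun s hs hst => ?_⟩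
  have hr : 0 < √s := Real.sqrt_pos.2 hs
  have hb : ∀ x, ‖heat s (barA η) x‖ₑ ^ (2 : ℝ) ≤ ENNReal.ofReal
      (C ^ (1 / 2 : ℝ) * D ^ (3 / 2 : ℝ) * s ^ (-(3 / 4) : ℝ) * decay x ^ (7 / 2 : ℝ)) :=
    fun x => by
    have h1 := h _ hr (Real.sqrt_le_sqrt hst) x
    have h2 := h' _ hr (Real.sqrt_le_sqrt hst) x
    have hw := decay_pos x
    rw [pow_zero, mul_one, add_zero, pow_one] at h1
    rw [pow_one, ← heat_eq_heatScaled hs] at h2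
    rw [← heat_eq_heatScaled hs] at h1
    rw [← ofReal_norm, ENNReal.ofReal_rpow_of_nonneg (norm_nonneg _) (by norm_num)]
    refine ENNReal.ofReal_le_ofReal ?_
    set y := ‖heat s (barA η) x‖
    have hy : 0 ≤ y := norm_nonneg _
    calc y ^ (2 : ℝ) = y ^ (1 / 2 : ℝ) * y ^ (3 / 2 : ℝ) := by
          rw [← Real.rpow_add' hy (by norm_num)]
          norm_num
      -- interpolation between no and one integration by parts gives the integrable decay `q^{-7/4}`
      _ ≤ (C * decay x) ^ (1 / 2 : ℝ) * (D * (√s)⁻¹ * decay x ^ (1 + 1)) ^ (3 / 2 : ℝ) := by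
          gcongr
      _ = C ^ (1 / 2 : ℝ) * D ^ (3 / 2 : ℝ) * (√s)⁻¹ ^ (3 / 2 : ℝ) *
            (decay x ^ (1 / 2 : ℝ) * (decay x ^ (1 + 1)) ^ (3 / 2 : ℝ)) := by
          rw [Real.mul_rpow hC hw.le, Real.mul_rpow (by positivity) (by positivity),
            Real.mul_rpow hD (by positivity)]
          ring
      _ = _ := by
          congr 1
          · rw [Real.sqrt_eq_rpow, ← Real.rpow_neg hs.le, ← Real.rpow_mul hs.le]
            norm_num
          · rw [← Real.rpow_natCast, ← Real.rpow_mul hw.le, ← Real.rpow_add hw]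
            norm_num
  refine (lintegral_mono hb).trans ?_
  rw [← ofReal_integral_eq_lintegral_ofReal (hint.const_mul _)
    (Eventually.of_forall fun x => mul_nonneg (by positivity) (hnn x)), integral_const_mul]
  refine ENNReal.ofReal_le_ofReal (le_of_eq ?_)
  ring

/-! ### The solution arising from the non-oscillating datum -/

lemma rpow_le_rpow_add_rpow {p q r : ℝ} (hpr : p ≤ r) (hrq : r ≤ q) (y : ℝ≥0∞) :
    y ^ r ≤ y ^ p + y ^ q := by
  rcases le_total y 1 with h | h
  · exact (ENNReal.rpow_le_rpow_of_exponent_ge h hpr).trans le_self_add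
  · exact (ENNReal.rpow_le_rpow_of_exponent_le h hrq).trans le_add_self

/-- Interpolation: a function in `Lᵖ` and in `L^q` is in every `L^r` in between. -/
lemma memLp_of_memLp_of_memLp {X E : Type*} [MeasurableSpace X] {μ : Measure X}
    [NormedAddCommGroup E] {f : X → E} {p q r : ℝ≥0∞} (hp : p ≠ 0) (hq : q ≠ ∞) (hpr : p ≤ r)
    (hrq : r ≤ q) (hfp : MemLp f p μ) (hfq : MemLp f q μ) : MemLp f r μ := by
  have hr : r ≠ ∞ := ne_top_of_le_ne_top hq hrq
  have hp' : p ≠ ∞ := ne_top_of_le_ne_top hr hpr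
  have hr0 : r ≠ 0 := fun h => hp (le_antisymm (h ▸ hpr) zero_le)
  have hq0 : q ≠ 0 := fun h => hr0 (le_antisymm (h ▸ hrq) zero_le)
  refine ⟨hfp.1, (eLpNorm_lt_top_iff_lintegral_rpow_enorm_lt_top hr0 hr).2 ?_⟩
  refine (lintegral_mono fun x => rpow_le_rpow_add_rpow (ENNReal.toReal_mono hr hpr)
    (ENNReal.toReal_mono hq hrq) _).trans_lt ?_
  rw [lintegral_add_left' (hfp.1.enorm.pow_const _)]
  exact ENNReal.add_lt_top.2
    ⟨lintegral_rpow_enorm_lt_top_of_eLpNorm_lt_top hp hp' hfp.2,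
      lintegral_rpow_enorm_lt_top_of_eLpNorm_lt_top hq0 hq hfq.2⟩

lemma eLpNorm_heatScaled_le {a : E3 → E3} (ha : Measurable a) (r : ℝ) :
    eLpNorm (heatScaled r a) 3 volume ≤ eLpNorm a 3 volume := by
  have h := lintegral_heatScaled_rpow_le ha r (p := 3) (by norm_num)
  rw [lintegral_enorm_rpow_three, lintegral_enorm_rpow_three] at h
  exact (ENNReal.rpow_le_rpow_iff (by norm_num)).1 h

section Solution

variable {a : E3 → E3} {T : EReal} {u : ℝ → Lp E3 3 (volume : Measure E3)}

lemma lintegral_duhamel_tensor_rpow_le {U : ℝ → E3 → E3} (hU : Measurable (Function.uncurry U))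
    {A : ℝ≥0∞} (hA : ∀ s, eLpNorm (U s) 3 volume ≤ A) {t : ℝ} (ht : 0 ≤ t) :
    ∫⁻ x, ‖duhamel t (fun s y => tensor (U s y) (U s y)) x‖ₑ ^ (3 / 2 : ℝ) ≤
      ENNReal.ofReal (2 * oseenConst * √t) ^ (3 / 2 : ℝ) * A ^ (3 : ℝ) := by
  have hm : Measurable (Function.uncurry fun s y => tensor (U s y) (U s y)) :=
    measurable_tensor hU hU
  have h := lintegral_duhamelMajorant_rpow_le_const (measurable_enorm_field hm) ht
    (p := 3 / 2) (by norm_num) fun s _ => lintegral_tensor_rpow_le (hA s)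
  rw [sub_zero] at h
  refine (lintegral_mono fun x => ENNReal.rpow_le_rpow ?_ (by norm_num)).trans h
  exact enorm_duhamel_le (F := fun s y => tensor (U s y) (U s y)) hm ht x

/-- The Duhamel term of a solution lies in `L³`, as the difference of two such functions. -/
lemma IsL3Solution.lintegral_duhamel_rpow_three_le (hu : IsL3Solution a T u) (ha : Measurable a)
    {t₁ : ℝ} (hT : (t₁ : EReal) < T) {U : ℝ → E3 → E3} (hUm : Measurable (Function.uncurry U))
    (hU : ∀ s ∈ Icc 0 t₁, U s =ᵐ[volume] u s) {A : ℝ≥0∞}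
    (hA : ∀ s, eLpNorm (U s) 3 volume ≤ A) {t : ℝ} (ht : t ∈ Ioc 0 t₁) :
    ∫⁻ x, ‖duhamel t (fun s y => tensor (U s y) (U s y)) x‖ₑ ^ (3 : ℝ) ≤
      (eLpNorm a 3 volume + A) ^ (3 : ℝ) := by
  rw [lintegral_enorm_rpow_three (duhamel t fun s y => tensor (U s y) (U s y))]
  refine ENNReal.rpow_le_rpow ?_ (by norm_num)
  have e : duhamel t (fun s y => tensor (U s y) (U s y)) =ᵐ[volume]
      heatScaled √t a - U t := by
    filter_upwards [hu.ae_eq_sub_duhamel hT hU ht] with x hx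
    rw [Pi.sub_apply, hx, heat_eq_heatScaled ht.1]
    abel
  rw [eLpNorm_congr_ae e]
  exact (eLpNorm_sub_le (measurable_heatScaled ha _).aestronglyMeasurable
    (hUm.comp measurable_prodMk_left).aestronglyMeasurable (by norm_num)).trans
    (add_le_add (eLpNorm_heatScaled_le ha _) (hA t))

/-- The Duhamel term of a solution lies in `L^r` for `3/2 ≤ r ≤ 3`. -/
lemma IsL3Solution.memLp_sub_heat (hu : IsL3Solution a T u) (ha : Measurable a)
    (h3 : MemLp a 3 volume) {t : ℝ} (ht : 0 < t) (hT : (t : EReal) < T) {r : ℝ≥0∞}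
    (hr : 3 / 2 ≤ r) (hr3 : r ≤ 3) : MemLp (fun x => heat t a x - u t x) r volume := by
  obtain ⟨U, hUm, hU, A, hAt, hA⟩ := exists_representative_of_continuousOn ht.le
    (hu.continuousOn_Icc hT)
  have htI : t ∈ Ioc 0 t := ⟨ht, le_rfl⟩
  have hm : Measurable (Function.uncurry fun s y => tensor (U s y) (U s y)) :=
    measurable_tensor hUm hUm
  set D := duhamel t fun s y => tensor (U s y) (U s y) with hD
  have hDm : AEStronglyMeasurable D volume := (measurable_duhamel hm ht.le).aestronglyMeasurable
  have e : (fun x => heat t a x - u t x) =ᵐ[volume] D := by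
    filter_upwards [hu.ae_eq_sub_duhamel hT hU htI, hU t ⟨ht.le, le_rfl⟩] with x hx hx'
    rw [← hx', hx]
    abel
  rw [memLp_congr_ae e]
  have h32 : (3 / 2 : ℝ≥0∞).toReal = 3 / 2 := by simp
  refine memLp_of_memLp_of_memLp (p := 3 / 2) (q := 3) (by norm_num) (by norm_num) hr hr3
    ⟨hDm, (eLpNorm_lt_top_iff_lintegral_rpow_enorm_lt_top (by norm_num)
      (ENNReal.div_ne_top (by norm_num) (by norm_num))).2 ?_⟩
    ⟨hDm, (eLpNorm_lt_top_iff_lintegral_rpow_enorm_lt_top (by norm_num) (by norm_num)).2 ?_⟩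
  · rw [h32]
    exact (lintegral_duhamel_tensor_rpow_le hUm hA ht.le).trans_lt
      (ENNReal.mul_lt_top (ENNReal.rpow_lt_top_of_nonneg (by norm_num) ENNReal.ofReal_ne_top)
        (ENNReal.rpow_lt_top_of_nonneg (by norm_num) hAt))
  · rw [ENNReal.toReal_ofNat]
    exact (hu.lintegral_duhamel_rpow_three_le ha hT hUm hU hA htI).trans_lt
      (ENNReal.rpow_lt_top_of_nonneg (by norm_num) (ENNReal.add_ne_top.2 ⟨h3.2.ne, hAt⟩))

end Solution

lemma norm_fderiv_le_sum (f : E3 → ℝ) (x : E3) : ‖fderiv ℝ f x‖ ≤ ∑ i, |partialDeriv i f x| := by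
  refine ContinuousLinearMap.opNorm_le_bound _ (Finset.sum_nonneg fun _ _ => abs_nonneg _)
    fun v => ?_
  have hv : v = ∑ i, v i • (EuclideanSpace.single i (1 : ℝ) : E3) := by
    ext j
    simp [Finset.sum_apply, Pi.single_apply]
  conv_lhs => rw [hv, map_sum]
  rw [Finset.sum_mul]
  refine (norm_sum_le _ _).trans (Finset.sum_le_sum fun i _ => ?_)
  rw [map_smul, smul_eq_mul, norm_mul, mul_comm]
  exact mul_le_mul_of_nonneg_left (PiLp.norm_apply_le v i) (abs_nonneg _)

/-- The increments of a symbol of order `m` gain one order of decay. -/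
lemma IsSymbol.exists_bound_sub {m : ℕ} {f : E3 → ℝ} (hf : IsSymbol m f) :
    ∃ C, 0 ≤ C ∧ ∀ x w, |f (x - w) - f x| ≤ C * (1 + ‖w‖) ^ (m + 2) * decay x ^ (m + 1) := by
  choose C hC h using fun i => (hf.partialDeriv i).exists_bound
  refine ⟨∑ i, C i, Finset.sum_nonneg fun i _ => hC i, fun x w => ?_⟩
  have hS : 0 ≤ ∑ i, C i := Finset.sum_nonneg fun i _ => hC i
  have hbound : ∀ y ∈ segment ℝ x (x - w),
      ‖fderiv ℝ f y‖ ≤ (∑ i, C i) * ((1 + ‖w‖) * decay x) ^ (m + 1) := fun y hy => by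
    rw [segment_eq_image'] at hy
    obtain ⟨θ, hθ, rfl⟩ := hy
    have hdec : decay (x + θ • (x - w - x)) ≤ (1 + ‖w‖) * decay x := by
      rw [show x + θ • (x - w - x) = x - θ • w by module]
      refine (decay_sub_le x _).trans (mul_le_mul_of_nonneg_right ?_ (decay_pos x).le)
      rw [norm_smul, Real.norm_of_nonneg hθ.1]
      linarith [mul_le_of_le_one_left (norm_nonneg w) hθ.2]
    refine (norm_fderiv_le_sum f _).trans ((Finset.sum_le_sum fun i _ => h i _).trans ?_)
    rw [← Finset.sum_mul]
    have := (decay_pos (x + θ • (x - w - x))).le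
    gcongr
  have key := (convex_segment x (x - w)).norm_image_sub_le_of_norm_fderiv_le (𝕜 := ℝ)
    (fun y _ => hf.differentiable y) hbound (left_mem_segment ℝ _ _) (right_mem_segment ℝ _ _)
  rw [Real.norm_eq_abs, sub_sub_cancel_left, norm_neg] at key
  refine key.trans ?_
  have hw := (decay_pos x).le
  calc _ ≤ (∑ i, C i) * ((1 + ‖w‖) * decay x) ^ (m + 1) * (1 + ‖w‖) := by
        gcongr
        linarith
    _ = _ := by rw [mul_pow]; ring

/-- The heat flow moves `ȧ` by a function that is `O(1 / q)`. -/
lemma exists_bound_heat_dotA_sub (η : ℝ) {t : ℝ} (ht : 0 < t) :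
    ∃ C, 0 ≤ C ∧ ∀ x, ‖heat t (dotA η) x - dotA η x‖ ≤ C * decay x ^ 2 := by
  choose C hC h using fun j => (isSymbol_dotA η j).exists_bound_sub
  have hS : 0 ≤ ∑ j, C j := Finset.sum_nonneg fun j _ => hC j
  set J := ∫ z, |heatSchwartz 1 one_pos z| * (1 + √t * ‖z‖) ^ 3 with hJ
  refine ⟨(∑ j, C j) * J, mul_nonneg hS (integral_nonneg fun z => by positivity), fun x => ?_⟩
  have e := heatScaled_sub_heatScaled (continuous_dotA η).measurable (norm_dotA_le_const η) (√t) 0 x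
  rw [heatScaled_zero, ← heat_eq_heatScaled ht] at e
  rw [e]
  refine (norm_integral_le_of_norm_le ((integrable_abs_mul_one_add_norm_pow
    (heatSchwartz 1 one_pos) √t 3).const_mul ((∑ j, C j) * decay x ^ 2))
    (Eventually.of_forall fun z => ?_)).trans_eq ?_
  · rw [norm_smul, Real.norm_eq_abs, heatSchwartz_apply, zero_smul, sub_zero, mul_left_comm]
    refine mul_le_mul_of_nonneg_left ((norm_E3_le_sum _).trans ?_) (abs_nonneg _)
    rw [Finset.sum_mul, Finset.sum_mul]
    refine Finset.sum_le_sum fun j _ => (h j x (√t • z)).trans_eq ?_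
    rw [norm_smul, Real.norm_of_nonneg (Real.sqrt_nonneg t)]
    ring
  · rw [integral_const_mul]
    ring

lemma memLp_decay_sq {r : ℝ≥0∞} (hr : 2 ≤ r) (hrt : r ≠ ∞) :
    MemLp (fun x => decay x ^ 2) r volume := by
  have h2 : 2 ≤ r.toReal := by
    rw [← ENNReal.toReal_ofNat]; exact ENNReal.toReal_mono hrt hr
  have hr0 : r ≠ 0 := fun h => by simp [h] at hr
  have hm : AEStronglyMeasurable (fun x => decay x ^ 2) volume :=
    (continuous_decay.pow 2).aestronglyMeasurable
  rw [← integrable_norm_rpow_iff hm hr0 hrt]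
  refine (integrable_decay_rpow (α := 2 * r.toReal) (by linarith)).congr
    (Eventually.of_forall fun x => ?_)
  beta_reduce
  rw [Real.norm_of_nonneg (by positivity), Real.rpow_mul (decay_pos x).le]
  norm_cast

/-- The solution arising from `ȧ` inherits the slow decay of `ȧ`: both the Duhamel term and
`e^{tΔ} ȧ - ȧ` lie in `L^r` for `2 ≤ r < 3`. -/
theorem not_memLp_of_isL3Solution_dotA {η : ℝ} (hη : η ≠ 0) {T : EReal}
    {u : ℝ → Lp E3 3 (volume : Measure E3)} (hu : IsL3Solution (dotA η) T u) {t : ℝ} (ht : 0 < t)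
    (hT : (t : EReal) < T) {q : ℝ≥0∞} (hq : 1 ≤ q) (hq3 : q < 3) : ¬ MemLp (u t) q volume := by
  intro hmem
  -- for exponents from `2` on, the remainder `O(1 / q)` and the Duhamel term are both in `L^r`
  set r : ℝ≥0∞ := max q 2 with hr
  have hr3 : r < 3 := max_lt hq3 (by norm_num)
  have hr2 : 2 ≤ r := le_max_right _ _
  have hur : MemLp (u t) r volume := memLp_of_memLp_of_memLp (zero_lt_one.trans_le hq).ne'
    (by norm_num) (le_max_left _ _) hr3.le hmem (Lp.memLp (u t))
  have hB := hu.memLp_sub_heat (continuous_dotA η).measurable (memLp_three_dotA η) ht hT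
    (r := r) (le_trans (by
      rw [ENNReal.div_le_iff (by norm_num) (by norm_num)]; norm_num) hr2) hr3.le
  have hheat : MemLp (heat t (dotA η)) r volume := by
    have := hB.add hur
    refine (memLp_congr_ae (Eventually.of_forall fun x => ?_)).1 this
    simp
  obtain ⟨C, hC, h⟩ := exists_bound_heat_dotA_sub η ht
  have hdiff : MemLp (fun x => heat t (dotA η) x - dotA η x) r volume := by
    refine ((memLp_decay_sq hr2 hr3.ne_top).const_mul C).mono
      (hheat.1.sub (continuous_dotA η).aestronglyMeasurable) (Eventually.of_forall fun x => ?_)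
    exact (h x).trans (le_abs_self _)
  refine not_memLp_dotA hη (le_max_of_le_left hq) hr3 ?_
  have := hheat.sub hdiff
  refine (memLp_congr_ae (Eventually.of_forall fun x => ?_)).1 this
  simp

/-! ### The solution arising from the oscillating datum -/

/-- The product of the two integrable singularities `(t - s)^{-1/2}` and `s^{-3/4}` at the ends of
the interval is integrable. -/
lemma lintegral_rpow_mul_rpow_ne_top {C : ℝ} (hC : 0 ≤ C) {t : ℝ} (ht : 0 < t) :
    ∫⁻ s in Ioo 0 t, ENNReal.ofReal (oseenConst * (t - s) ^ (-(1 / 2) : ℝ)) *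
      ENNReal.ofReal (C * s ^ (-(3 / 4) : ℝ)) ≠ ∞ := by
  have hoc := oseenConst_pos.le
  have h1 : IntervalIntegrable (fun s : ℝ => s ^ (-(3 / 4) : ℝ)) volume 0 t :=
    intervalIntegral.intervalIntegrable_rpow' (by norm_num)
  have h2 : IntervalIntegrable (fun s : ℝ => (t - s) ^ (-(1 / 2) : ℝ)) volume 0 t := by
    have h := (intervalIntegral.intervalIntegrable_rpow' (a := t) (b := 0)
      (r := (-(1 / 2) : ℝ)) (by norm_num)).comp_sub_left t
    rwa [sub_self, sub_zero] at h
  have h3 := ((h1.const_mul ((t / 2) ^ (-(1 / 2) : ℝ))).add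
    (h2.const_mul ((t / 2) ^ (-(3 / 4) : ℝ)))).const_mul (oseenConst * C)
  rw [intervalIntegrable_iff_integrableOn_Ioo_of_le ht.le] at h3
  refine ((setLIntegral_mono' measurableSet_Ioo fun s hs => ?_).trans_lt h3.lintegral_lt_top).ne
  have hs1 : 0 < s := hs.1
  have hs2 : 0 < t - s := sub_pos.2 hs.2
  rw [← ENNReal.ofReal_mul (by positivity)]
  refine ENNReal.ofReal_le_ofReal ?_
  rw [mul_mul_mul_comm]
  refine mul_le_mul_of_nonneg_left ?_ (by positivity)
  rcases le_total s (t / 2) with h | h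
  · refine le_add_of_le_of_nonneg ?_ (by positivity)
    exact mul_le_mul_of_nonneg_right (Real.rpow_le_rpow_of_nonpos (by positivity) (by linarith)
      (by norm_num)) (by positivity)
  · refine le_add_of_nonneg_of_le (by positivity) ?_
    rw [mul_comm]
    exact mul_le_mul_of_nonneg_right (Real.rpow_le_rpow_of_nonpos (by positivity) h
      (by norm_num)) (by positivity)

variable {η : ℝ} {T : EReal} {u : ℝ → Lp E3 3 (volume : Measure E3)}

/-- For the oscillating datum the heat flow is integrable, and so is the Duhamel term, because
`‖u(s)‖₂²` has an integrable singularity at `s = 0`. -/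
theorem memLp_one_of_isL3Solution_barA (hu : IsL3Solution (barA η) T u) {t : ℝ} (ht : 0 < t)
    (hT : (t : EReal) < T) : MemLp (u t) 1 volume := by
  have ha := (continuous_barA η).measurable
  obtain ⟨U, hUm, hU, A, hAt, hA⟩ := exists_representative_of_continuousOn ht.le
    (hu.continuousOn_Icc hT)
  have hm : Measurable (Function.uncurry fun s y => tensor (U s y) (U s y)) :=
    measurable_tensor hUm hUm
  set D : ℝ → E3 → E3 := fun s => duhamel s fun s y => tensor (U s y) (U s y) with hD
  have hDm : ∀ s, 0 ≤ s → Measurable (D s) := fun s hs => measurable_duhamel hm hs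
  have hUD : ∀ s ∈ Ioc 0 t, ∀ᵐ x, U s x = heat s (barA η) x - D s x := fun s hs =>
    hu.ae_eq_sub_duhamel hT hU hs
  obtain ⟨C, hC, hheat⟩ := exists_lintegral_heat_barA_sq_le η t
  set M : ℝ≥0∞ := ENNReal.ofReal (2 * oseenConst * √t) ^ (3 / 2 : ℝ) * A ^ (3 : ℝ) +
    (eLpNorm (barA η) 3 volume + A) ^ (3 : ℝ) with hM
  have hMt : M ≠ ∞ := ENNReal.add_ne_top.2 ⟨ENNReal.mul_ne_top
    (ENNReal.rpow_ne_top_of_nonneg (by norm_num) ENNReal.ofReal_ne_top)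
    (ENNReal.rpow_ne_top_of_nonneg (by norm_num) hAt),
    ENNReal.rpow_ne_top_of_nonneg (by norm_num)
      (ENNReal.add_ne_top.2 ⟨(memLp_three_barA η).2.ne, hAt⟩)⟩
  have hoc := oseenConst_pos.le
  have hD2 : ∀ s ∈ Ioc 0 t, ∫⁻ x, ‖D s x‖ₑ ^ (2 : ℝ) ≤ M := fun s hs => by
    refine (lintegral_mono fun x => rpow_le_rpow_add_rpow (p := 3 / 2) (q := 3) (by norm_num)
      (by norm_num) _).trans ?_
    rw [lintegral_add_left ((hDm s hs.1.le).enorm.pow_const _)]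
    refine add_le_add ((lintegral_duhamel_tensor_rpow_le hUm hA hs.1.le).trans ?_)
      (hu.lintegral_duhamel_rpow_three_le ha hT hUm hU hA hs)
    have := hs.2
    gcongr
  have hU2 : ∀ s ∈ Ioc 0 t, ∫⁻ x, ‖U s x‖ₑ ^ (2 : ℝ) ≤
      2 * (ENNReal.ofReal (C * s ^ (-(3 / 4) : ℝ)) + M) := fun s hs => by
    have h1 : ∀ᵐ x, ‖U s x‖ₑ ^ (2 : ℝ) ≤
        2 * (‖heat s (barA η) x‖ₑ ^ (2 : ℝ) + ‖D s x‖ₑ ^ (2 : ℝ)) := by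
      filter_upwards [hUD s hs] with x hx
      rw [hx]
      refine (ENNReal.rpow_le_rpow enorm_sub_le (by norm_num)).trans ?_
      refine (ENNReal.rpow_add_le_mul_rpow_add_rpow _ _ (p := 2) (by norm_num)).trans_eq ?_
      norm_num
    refine (lintegral_mono_ae h1).trans ?_
    rw [lintegral_const_mul' _ _ (by norm_num), lintegral_add_right _
      ((hDm s hs.1.le).enorm.pow_const _)]
    exact mul_le_mul_right (add_le_add (hheat s hs.1 hs.2) (hD2 s hs)) _
  have hT1 : ∀ s ∈ Ioo 0 t, ∫⁻ x, ‖tensor (U s x) (U s x)‖ₑ ^ (1 : ℝ) ≤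
      2 * (ENNReal.ofReal (C * s ^ (-(3 / 4) : ℝ)) + M) := fun s hs => by
    refine le_trans (lintegral_mono fun x => ?_) (hU2 s ⟨hs.1, hs.2.le⟩)
    rw [ENNReal.rpow_one, ENNReal.rpow_ofNat, sq]
    exact enorm_tensor_le _ _
  set κ : ℝ → ℝ≥0∞ := fun s => ENNReal.ofReal (oseenConst * (t - s) ^ (-(1 / 2) : ℝ)) with hκ
  have hκm : Measurable κ := by fun_prop
  have hfin : ∫⁻ x, ‖D t x‖ₑ ≠ ∞ := by
    have h1 := lintegral_duhamelMajorant_rpow_le (measurable_enorm_field hm) 0 t (p := 1) le_rfl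
    simp only [ENNReal.rpow_one, sub_self, ENNReal.rpow_zero, one_mul] at h1 hT1
    refine ne_top_of_le_ne_top ?_ ((lintegral_mono fun x => enorm_duhamel_le
      (F := fun s y => tensor (U s y) (U s y)) hm ht.le x).trans (h1.trans
      (setLIntegral_mono' measurableSet_Ioo fun s hs => mul_le_mul_right (hT1 s hs) _)))
    have e : ∀ s, κ s * (2 * (ENNReal.ofReal (C * s ^ (-(3 / 4) : ℝ)) + M)) =
        2 * (κ s * ENNReal.ofReal (C * s ^ (-(3 / 4) : ℝ))) + κ s * (2 * M) := fun s => by ring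
    change ∫⁻ s in Ioo 0 t, κ s * (2 * (ENNReal.ofReal (C * s ^ (-(3 / 4) : ℝ)) + M)) ≠ ∞
    simp_rw [e]
    rw [lintegral_add_right _ (hκm.mul_const _), lintegral_const_mul' _ _ (by norm_num),
      lintegral_mul_const _ hκm]
    refine ENNReal.add_ne_top.2 ⟨ENNReal.mul_ne_top (by norm_num)
      (lintegral_rpow_mul_rpow_ne_top hC ht), ENNReal.mul_ne_top (ne_top_of_le_ne_top
        ENNReal.ofReal_ne_top (lintegral_Ioo_rpow ht.le le_rfl)) (ENNReal.mul_ne_top (by norm_num)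
        hMt)⟩
  refine ⟨(Lp.memLp (u t)).1, ?_⟩
  rw [← eLpNorm_congr_ae (hU t ⟨ht.le, le_rfl⟩), eLpNorm_congr_ae (hUD t ⟨ht, le_rfl⟩),
    eLpNorm_one_eq_lintegral_enorm]
  refine (lintegral_mono fun x => enorm_sub_le).trans_lt ?_
  rw [lintegral_add_right _ (hDm t ht.le).enorm]
  exact ENNReal.add_lt_top.2
    ⟨(lintegral_enorm_heat_barA_ne_top η ht).lt_top, hfin.lt_top⟩

/-- Interpolation between `L¹` and `L³`. -/
theorem memLp_of_isL3Solution_barA (hu : IsL3Solution (barA η) T u) {t : ℝ} (ht : 0 < t)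
    (hT : (t : EReal) < T) {q : ℝ≥0∞} (hq : 1 ≤ q) (hq3 : q < 3) : MemLp (u t) q volume :=
  memLp_of_memLp_of_memLp one_ne_zero (by norm_num) hq hq3.le
    (memLp_one_of_isL3Solution_barA hu ht hT) (Lp.memLp (u t))

end NavierStokes

end

theorem mainTheorem3 (η : ℝ) (hη : η ≠ 0) :
    -- both data are divergence-free, in `L³` but not in `Lᵖ` for `1 ≤ p < 3`, and give rise to
    -- a unique solution in `C([0,T), L³)`
    (∀ a : NavierStokes.E3 → NavierStokes.E3,
      (a = NavierStokes.dotA η ∨ a = NavierStokes.barA η) →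
        NavierStokes.IsDivergenceFree a ∧
        MemLp a 3 volume ∧
        (∀ p : ℝ≥0∞, 1 ≤ p → p < 3 → ¬ MemLp a p volume) ∧
        (∃ T : EReal, 0 < T ∧ ∃ u : ℝ → Lp NavierStokes.E3 3 (volume : Measure NavierStokes.E3),
          NavierStokes.IsL3Solution a T u) ∧
        (∀ (T : EReal) (u v : ℝ → Lp NavierStokes.E3 3 (volume : Measure NavierStokes.E3)),
          NavierStokes.IsL3Solution a T u → NavierStokes.IsL3Solution a T v →
            ∀ t : ℝ, 0 ≤ t → (t : EReal) < T → u t = v t)) ∧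
    -- the solution arising from `ȧ` is never in `L^q`, `1 ≤ q < 3`
    (∀ (T : EReal) (u : ℝ → Lp NavierStokes.E3 3 (volume : Measure NavierStokes.E3)),
      NavierStokes.IsL3Solution (NavierStokes.dotA η) T u →
        ∀ t : ℝ, 0 < t → (t : EReal) < T →
          ∀ q : ℝ≥0∞, 1 ≤ q → q < 3 → ¬ MemLp (u t) q volume) ∧
    -- the solution arising from `ā` is in `L^q`, `1 ≤ q < 3`, at all positive times
    (∀ (T : EReal) (u : ℝ → Lp NavierStokes.E3 3 (volume : Measure NavierStokes.E3)),
      NavierStokes.IsL3Solution (NavierStokes.barA η) T u →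
        ∀ t : ℝ, 0 < t → (t : EReal) < T →
          ∀ q : ℝ≥0∞, 1 ≤ q → q < 3 → MemLp (u t) q volume) := by
  refine ⟨?_, fun T u hu t ht htT q hq hq3 =>
      NavierStokes.not_memLp_of_isL3Solution_dotA hη hu ht htT hq hq3,
    fun T u hu t ht htT q hq hq3 => NavierStokes.memLp_of_isL3Solution_barA hu ht htT hq hq3⟩
  rintro a (rfl | rfl)
  · exact ⟨NavierStokes.isDivergenceFree_dotA η, NavierStokes.memLp_three_dotA η,
      fun p hp hp3 => NavierStokes.not_memLp_dotA hη hp hp3,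
      NavierStokes.exists_isL3Solution (NavierStokes.continuous_dotA η).measurable
        (NavierStokes.memLp_three_dotA η) (NavierStokes.norm_dotA_le_const η),
      fun T u v hu hv t ht hT => hu.unique hv ht hT⟩
  · exact ⟨NavierStokes.isDivergenceFree_barA η, NavierStokes.memLp_three_barA η,
      fun p hp hp3 => NavierStokes.not_memLp_barA hη hp hp3,
      NavierStokes.exists_isL3Solution (NavierStokes.continuous_barA η).measurable
        (NavierStokes.memLp_three_barA η) (NavierStokes.norm_barA_le_const η),
      fun T u v hu hv t ht hT => hu.unique hv ht hT⟩
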